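/- Let $(M,g)$ be a smooth (Hausdorff, second countable, finite-dimensional) Riemannian manifold without boundary, let $\mathcal H=H^2([0,1],M)$ be the space of Sobolev curves with its $H^2$ topology and Borel $\sigma$-algebra, and for $\gamma\in\mathcal H$ put $$j_t(\gamma)=(\gamma(t),\dot\gamma(t))\in TM,\qquad \mathcal E(\gamma)=\int_0^1 g\Big(\tfrac{D}{Dt}\dot\gamma,\tfrac{D}{Dt}\dot\gamma\Big)\,dt .$$ Given Borel probability measures $\bar\rho_0,\bar\rho_1$ on $TM$, consider the problem of minimizing $\int_{\mathcal H}\mathcal E\,d\mu$ among all Borel probability measures $\mu$ on $\mathcal H$ with $[j_0]_*\mu=\bar\rho_0$ and $[j_1]_*\mu=\bar\rho_1$. A minimizer of finite cost is called an optimal solution. A curve $\gamma\in\mathcal H$ is called a cubic spline if it minimizes $\mathcal E$ among all curves $\eta\in\mathcal H$ with $j_0(\eta)=j_0(\gamma)$ and $j_1(\eta)=j_1(\gamma)$. 1. If $\mu$ is an optimal solution, then every $\gamma\in\operatorname{supp}\mu$ is a cubic spline with $j_0(\gamma)\in\operatorname{supp}\bar\rho_0$ and $j_1(\gamma)\in\operatorname{supp}\bar\rho_1$.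 2. Let $M=\mathbb R^d$ with the Euclidean metric, so that $TM=\mathbb R^d\times\mathbb R^d$. For $(x,v),(y,w)\in TM$, the unique cubic spline $\gamma$ with $j_0(\gamma)=(x,v)$, $j_1(\gamma)=(y,w)$ is the cubic polynomial $$s_{(x,v),(y,w)}(t)=x+tv+t^2\big(3(y-x)-2v-w\big)+t^3\big(2(x-y)+v+w\big),$$ and $$\mathcal E\big(s_{(x,v),(y,w)}\big)=c_{ph}((x,v),(y,w))=12|x-y|^2+4\big(|v|^2+|w|^2+\langle v,w\rangle+3\langle v+w,x-y\rangle\big)\ \ge 0 .$$ The cost $c_{ph}$ satisfies the twist condition: it is differentiable in its first variable $p\in TM$, and for every $p$ the map $q\mapsto\nabla_p c_{ph}(p,q)$ is injective. 3. Let $M=\mathbb R^d$, let $\bar\rho_0$ be absolutely continuous with respect to the Lebesgue measure of $\mathbb R^d\times\mathbb R^d$, and suppose that some admissible $\mu$ has finite cost. Then there is exactly one optimal solution $\mu$, and it is given by a map: there is a Borel map $\varphi:TM\to TM$, unique up to $\bar\rho_0$-null sets, such that $\varphi_*\bar\rho_0=\bar\rho_1$ and $\mu$ is the image of $\bar\rho_0$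 under $z\mapsto s_{z,\varphi(z)}$. -/

import Mathlib

open MeasureTheory Set
open scoped Manifold ContDiff ENNReal Bundle

/- With this instance off, `ℝ^d` as a manifold is found through `chartedSpaceSelf` (the two are
definitionally equal). -/
attribute [-instance] TopCat.of.chartedSpace

noncomputable section

namespace PhaseOT

/-- `u` restricted to `[0,1]` is (the `C¹` representative of) an element of the Sobolev space
`H²([0,1], ℝ)`: it is differentiable on `[0,1]` and its derivative is a primitive of a
square-integrable function. -/
def IsH2 (u : ℝ → ℝ) : Prop :=
  ∃ v w : ℝ → ℝ, MemLp w 2 (volume.restrict (Icc (0 : ℝ) 1)) ∧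
    (∀ t ∈ Icc (0 : ℝ) 1, HasDerivWithinAt u (v t) (Icc 0 1) t) ∧
    ∀ t ∈ Icc (0 : ℝ) 1, v t = v 0 + ∫ s in (0 : ℝ)..t, w s

/-- The distance of `H²([0,1], ℝ)`: the sum of the `L²` distances of the functions, of their
first derivatives and of their second derivatives. -/
def h2EDist (u v : ℝ → ℝ) : ℝ≥0∞ :=
  ∑ k ∈ Finset.range 3,
    eLpNorm (fun t => iteratedDerivWithin k u (Icc 0 1) t - iteratedDerivWithin k v (Icc 0 1) t)
      2 (volume.restrict (Icc (0 : ℝ) 1))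

/-- The path space `H²([0,1], M)`: continuous curves on `[0,1]` with `f ∘ γ ∈ H²([0,1], ℝ)` for
every smooth real function `f` on `M` (equivalently, curves that are `H²` in local charts, or in a
closed embedding of `M` in a Euclidean space). -/
structure H2Path (n : ℕ) (M : Type*) [TopologicalSpace M]
    [ChartedSpace (EuclideanSpace ℝ (Fin n)) M] where
  curve : C(unitInterval, M)
  isH2 : ∀ f : M → ℝ, ContMDiff (𝓡 n) 𝓘(ℝ, ℝ) ∞ f →
    IsH2 (fun t => f (curve (projIcc 0 1 zero_le_one t)))

section Manifold

variable {n : ℕ} {M : Type*} [TopologicalSpace M] [ChartedSpace (EuclideanSpace ℝ (Fin n)) M]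

/-- The curve as a function on `ℝ`, constant on each side of `[0,1]`; only its restriction to
`[0,1]` matters. -/
def H2Path.path (γ : H2Path n M) (t : ℝ) : M := γ.curve (projIcc 0 1 zero_le_one t)

/-- The `H²` topology, the coarsest one for which `γ ↦ f ∘ γ ∈ H²([0,1], ℝ)` is continuous for
every smooth `f : M → ℝ`. -/
instance : TopologicalSpace (H2Path n M) :=
  TopologicalSpace.generateFrom
    {U | ∃ f : M → ℝ, ContMDiff (𝓡 n) 𝓘(ℝ, ℝ) ∞ f ∧ ∃ (γ : H2Path n M) (ε : ℝ≥0∞), 0 < ε ∧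
      U = {η | h2EDist (fun t => f (η.path t)) (fun t => f (γ.path t)) < ε}}

instance : MeasurableSpace (H2Path n M) := borel _

instance : BorelSpace (H2Path n M) := ⟨rfl⟩

/-- The map `j_t(γ) = (γ(t), γ'(t)) ∈ TM` (one-sided derivatives at `t = 0` and `t = 1`). -/
def jet (t : ℝ) (γ : H2Path n M) : TangentBundle (𝓡 n) M :=
  ⟨γ.path t, mfderivWithin 𝓘(ℝ, ℝ) (𝓡 n) γ.path (Icc 0 1) t (1 : ℝ)⟩

variable [IsManifold (𝓡 n) ∞ M]

instance : MeasurableSpace (TangentBundle (𝓡 n) M) := borel _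

instance : BorelSpace (TangentBundle (𝓡 n) M) := ⟨rfl⟩

/-- Smooth Riemannian metrics on `M`. -/
abbrev RMetric (n : ℕ) (M : Type*) [TopologicalSpace M] [ChartedSpace (EuclideanSpace ℝ (Fin n)) M]
    [IsManifold (𝓡 n) ∞ M] :=
  Bundle.ContMDiffRiemannianMetric (𝓡 n) ∞ (EuclideanSpace ℝ (Fin n))
    (fun x : M => TangentSpace (𝓡 n) x)

/-- The coordinate vector field `∂_i` of the chart at `p`, at the point with coordinates `y`. -/
def coordVec (p : M) (y : EuclideanSpace ℝ (Fin n)) (i : Fin n) :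
    TangentSpace (𝓡 n) ((extChartAt (𝓡 n) p).symm y) :=
  mfderiv 𝓘(ℝ, EuclideanSpace ℝ (Fin n)) (𝓡 n) (extChartAt (𝓡 n) p).symm y
    (EuclideanSpace.single i (1 : ℝ))

/-- The matrix `g_{ij}` of the metric in the chart at `p`, at the point with coordinates `y`. -/
def metricCoeff (g : RMetric n M) (p : M) (y : EuclideanSpace ℝ (Fin n)) :
    Matrix (Fin n) (Fin n) ℝ :=
  Matrix.of fun i j => g.inner ((extChartAt (𝓡 n) p).symm y) (coordVec p y i) (coordVec p y j)

/-- The partial derivative `∂_i g_{jl}` in the chart at `p`, at the point `p`. -/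
def metricDeriv (g : RMetric n M) (p : M) (i j l : Fin n) : ℝ :=
  fderiv ℝ (fun y => metricCoeff g p y j l) (extChartAt (𝓡 n) p p) (EuclideanSpace.single i 1)

/-- The Christoffel symbols `Γ^k_{ij}` of the Levi-Civita connection in the chart at `p`, at `p`:
`Γ^k_{ij} = ½ ∑_l g^{kl} (∂_i g_{jl} + ∂_j g_{il} - ∂_l g_{ij})`. -/
def christoffel (g : RMetric n M) (p : M) (k i j : Fin n) : ℝ :=
  (1 / 2 : ℝ) * ∑ l, (metricCoeff g p (extChartAt (𝓡 n) p p))⁻¹ k l *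
    (metricDeriv g p i j l + metricDeriv g p j i l - metricDeriv g p l i j)

/-- The covariant acceleration `(D/Dt) γ' = γ'' + Γ(γ)(γ', γ')` at time `t`, computed in the chart
at `γ(t)`, which is also the chart in which Mathlib identifies the tangent space at `γ(t)` with the
model space. -/
def covAccel (g : RMetric n M) (γ : H2Path n M) (t : ℝ) : TangentSpace (𝓡 n) (γ.path t) :=
  let u : ℝ → EuclideanSpace ℝ (Fin n) := fun s => extChartAt (𝓡 n) (γ.path t) (γ.path s)
  let u' : EuclideanSpace ℝ (Fin n) := derivWithin u (Icc 0 1) t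
  (iteratedDerivWithin 2 u (Icc 0 1) t +
    WithLp.toLp 2 (fun k => ∑ i, ∑ j, christoffel g (γ.path t) k i j * u' i * u' j) :
    EuclideanSpace ℝ (Fin n))

/-- The acceleration energy `∫_0^1 g(γ)((D/Dt) γ', (D/Dt) γ') dt` of a path. -/
def energy (g : RMetric n M) (γ : H2Path n M) : ℝ≥0∞ :=
  ∫⁻ t in Icc (0 : ℝ) 1, ENNReal.ofReal (g.inner (γ.path t) (covAccel g γ t) (covAccel g γ t))

/-- Variational cubic splines: minimizers of the acceleration energy among all `H²` paths with the
same positions and velocities at the times `0` and `1`. -/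
def IsCubicSpline (g : RMetric n M) (γ : H2Path n M) : Prop :=
  ∀ η : H2Path n M, jet 0 η = jet 0 γ → jet 1 η = jet 1 γ → energy g γ ≤ energy g η

/-- The total cost of a measure on paths. -/
def cost (g : RMetric n M) (μ : Measure (H2Path n M)) : ℝ≥0∞ := ∫⁻ γ, energy g γ ∂μ

/-- Probability measures on the path space with the prescribed marginals on `TM`. -/
structure IsAdmissible (ρ₀ ρ₁ : Measure (TangentBundle (𝓡 n) M)) (μ : Measure (H2Path n M)) :
    Prop where
  prob : IsProbabilityMeasure μ
  marginal_zero : μ.map (jet 0) = ρ₀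
  marginal_one : μ.map (jet 1) = ρ₁

/-- Optimal solutions of the phase-space problem: admissible measures of finite cost that minimize
the cost among all admissible measures. -/
structure IsOptimal (g : RMetric n M) (ρ₀ ρ₁ : Measure (TangentBundle (𝓡 n) M))
    (μ : Measure (H2Path n M)) : Prop where
  admissible : IsAdmissible ρ₀ ρ₁ μ
  finite : cost g μ ≠ ⊤
  le : ∀ ν : Measure (H2Path n M), IsAdmissible ρ₀ ρ₁ ν → cost g μ ≤ cost g ν

end Manifold

section Euclidean

variable {d : ℕ}

/-- The Euclidean metric of `ℝ^d`. -/
def euclideanMetric (d : ℕ) : RMetric d (EuclideanSpace ℝ (Fin d)) :=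
  { riemannianMetricVectorSpace (EuclideanSpace ℝ (Fin d)) with
    contMDiff := (riemannianMetricVectorSpace (EuclideanSpace ℝ (Fin d))).contMDiff.of_le le_top }

/-- Phase space `ℝ^d × ℝ^d` of positions and velocities. -/
abbrev Phase (d : ℕ) := EuclideanSpace ℝ (Fin d) × EuclideanSpace ℝ (Fin d)

/-- The identification of the tangent bundle of `ℝ^d` with `ℝ^d × ℝ^d`. -/
def toPhase (p : TangentBundle (𝓡 d) (EuclideanSpace ℝ (Fin d))) : Phase d := (p.proj, p.snd)

/-- The cost `c_ph((x,v),(y,w))`. -/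
def cph (p q : Phase d) : ℝ :=
  12 * ‖p.1 - q.1‖ ^ 2 + 4 * (‖p.2‖ ^ 2 + ‖q.2‖ ^ 2 + inner ℝ p.2 q.2
    + 3 * inner ℝ (p.2 + q.2) (p.1 - q.1))

/-- The twist condition: `c` is differentiable in its first variable and
`q ↦ ∇_p c(p, q)` is injective for every `p`. -/
def TwistCondition (c : Phase d → Phase d → ℝ) : Prop :=
  (∀ q, Differentiable ℝ (fun p => c p q)) ∧
    ∀ p, Function.Injective (fun q => fderiv ℝ (fun p' => c p' q) p)

/-- The cubic polynomial curve with position and velocity `p = (x, v)` at time `0` and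
`q = (y, w)` at time `1`. -/
def hermite (p q : Phase d) (t : ℝ) : EuclideanSpace ℝ (Fin d) :=
  p.1 + t • p.2 + t ^ 2 • ((3 : ℝ) • (q.1 - p.1) - (2 : ℝ) • p.2 - q.2)
    + t ^ 3 • ((2 : ℝ) • (p.1 - q.1) + p.2 + q.2)

theorem contDiff_hermite (p q : Phase d) : ContDiff ℝ ∞ (hermite p q) := by
  unfold hermite
  fun_prop

theorem isH2_of_contDiff {u h : ℝ → ℝ} (hh : ContDiff ℝ ∞ h) (hu : EqOn u h (Icc 0 1)) :
    IsH2 u := by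
  have h1 : ContDiff ℝ ∞ (deriv h) := ((contDiff_infty_iff_deriv).1 hh).2
  have h2 : ContDiff ℝ ∞ (deriv (deriv h)) := ((contDiff_infty_iff_deriv).1 h1).2
  refine ⟨deriv h, deriv (deriv h), ?_, fun t ht => ?_, fun t _ => ?_⟩
  · obtain ⟨C, hC⟩ := isCompact_Icc.exists_bound_of_continuousOn
      (h2.continuous.continuousOn (s := Icc (0 : ℝ) 1))
    exact MemLp.of_bound h2.continuous.aestronglyMeasurable C
      (ae_restrict_of_forall_mem measurableSet_Icc hC)
  · exact ((hh.differentiable (by simp) t).hasDerivAt.hasDerivWithinAt).congr hu (hu ht)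
  · rw [intervalIntegral.integral_deriv_eq_sub
      (fun x _ => h1.differentiable (by simp) x) (h2.continuous.intervalIntegrable _ _)]
    ring

/-- The Hermite cubic joining `p` to `q` as an element of the path space. -/
def hermitePath (p q : TangentBundle (𝓡 d) (EuclideanSpace ℝ (Fin d))) :
    H2Path d (EuclideanSpace ℝ (Fin d)) where
  curve := ⟨fun t => hermite (toPhase p) (toPhase q) t,
    (contDiff_hermite _ _).continuous.comp continuous_subtype_val⟩
  isH2 f hf := by
    refine isH2_of_contDiff ((contMDiff_iff_contDiff.1 hf).comp
      (contDiff_hermite (toPhase p) (toPhase q))) fun t ht => ?_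
    simp [projIcc_of_mem zero_le_one ht]

end Euclidean

end PhaseOT

end

/-! Statement 1 is a local exchange argument, and needs no selection theorem. The energy and the end
jets are continuous for the `H²` topology (`continuous_energy`, `continuous_jet`). If a path γ₀ in
the support of μ were not a spline, some η with the same end jets would have smaller energy. There
is a map T, continuous at each point of a neighbourhood of γ₀, with T γ₀ = η and T γ having the end
jets of γ (`exists_jet_transport`): it adds to η, in charts at its two end points, a small affine
function of time times a bump. By continuity T lowers the energy on an open U containing γ₀. Pushing
μ forward by T on U and by the identity elsewhere keeps the marginals and strictly lowers the cost,
because μ U > 0 and the cost is finite.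

Continuity of the energy comes from a fixed chart: positions and velocities converge uniformly,
accelerations converge in L², and the density is quadratic in the acceleration with coefficients
continuous in position and velocity, so it converges in L¹ (`exists_nhds_tendsto_density`). Since
`covAccel` is computed in a chart that moves with the path, this requires the invariance of the
density under changes of chart (`accelForm_comp`, `densityAt_transition`).

In Euclidean space the second derivative of the Hermite cubic is affine in t, and the integrals of
u'' and t u'' are fixed by the end data. Hence the energy of a path is `cph` of its end jets plus
the squared L² distance of its acceleration to that of the cubic (`energy_eq_cph_add`), which gives
statement 2 and reduces statement 3 to optimal plans for `cph` (`isOptimal_iff`).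

Completing the square, `cph` is |A p - B q|² with linear isomorphisms A and B (`norm_shear_sub_sq`),
so Brenier's theorem applies. It is proved without potentials. An optimal plan has monotone support
(`IsOptimalPlan.monotoneSet_support`), and a monotone set is single valued almost everywhere
(`MonotoneSet.measure_multiDomain`): by Minty's transform it is parametrized by a Lipschitz map R,
whose image of the points of non-differentiability or of singular differential is null. Uniqueness
follows because the average of two optimal plans is optimal, hence carried by one graph. -/

noncomputable section

set_option linter.unusedSectionVars false

namespace PhaseOT

open Filter Topology

/-! ### Calculus of `H²` functions on the unit interval -/

/-- Lebesgue measure on the unit interval. -/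
abbrev unitVol : Measure ℝ := volume.restrict (Icc (0 : ℝ) 1)

/-- First derivative within the unit interval. -/
def d1 (u : ℝ → ℝ) : ℝ → ℝ := derivWithin u (Icc 0 1)

/-- Second derivative within the unit interval. -/
def d2 (u : ℝ → ℝ) : ℝ → ℝ := derivWithin (d1 u) (Icc 0 1)

theorem iteratedDerivWithin_two_eq (u : ℝ → ℝ) :
    iteratedDerivWithin 2 u (Icc 0 1) = d2 u := by
  rw [show (2 : ℕ) = 1 + 1 from rfl, iteratedDerivWithin_succ, iteratedDerivWithin_one]; rfl

theorem absolutelyContinuousOnInterval_congr {f g : ℝ → ℝ} {a b : ℝ}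
    (hf : AbsolutelyContinuousOnInterval f a b) (h : EqOn g f (uIcc a b)) :
    AbsolutelyContinuousOnInterval g a b := by
  rw [absolutelyContinuousOnInterval_iff] at hf ⊢
  intro ε hε
  obtain ⟨δ, hδ, H⟩ := hf ε hε
  refine ⟨δ, hδ, fun E hE hEδ => ?_⟩
  convert H E hE hEδ using 1
  refine Finset.sum_congr rfl fun i hi => ?_
  have hE' := hE.1 i hi
  rw [h hE'.1, h hE'.2]

theorem absolutelyContinuousOnInterval_sum {ι : Type*} {a b : ℝ} (s : Finset ι) {f : ι → ℝ → ℝ}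
    (hf : ∀ i, AbsolutelyContinuousOnInterval (f i) a b) :
    AbsolutelyContinuousOnInterval (fun t => ∑ i ∈ s, f i t) a b := by
  classical
  induction s using Finset.induction_on with
  | empty =>
    simp only [Finset.sum_empty]
    exact (contDiffOn_const (c := (0 : ℝ))).absolutelyContinuousOnInterval
  | insert i s hi ih =>
    simp only [Finset.sum_insert hi]
    exact (hf i).add ih

theorem ae_unitVol_mem_Ioo : ∀ᵐ t ∂unitVol, t ∈ Ioo (0 : ℝ) 1 := by
  rw [unitVol, ← restrict_Ioo_eq_restrict_Icc]
  exact ae_restrict_mem measurableSet_Ioo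

instance : IsProbabilityMeasure unitVol := ⟨by simp⟩

theorem intervalIntegrable_of_memLp_two {w : ℝ → ℝ} (hw : MemLp w 2 unitVol) :
    IntervalIntegrable w volume 0 1 := by
  rw [intervalIntegrable_iff_integrableOn_Icc_of_le zero_le_one]
  exact hw.integrable (by norm_num)

/-- An absolutely continuous derivative with square-integrable derivative gives an `H²` function. -/
theorem isH2_of_ac {u v w : ℝ → ℝ}
    (hu : ∀ t ∈ Icc (0 : ℝ) 1, HasDerivWithinAt u (v t) (Icc 0 1) t)
    (hv : AbsolutelyContinuousOnInterval v 0 1) (hw : MemLp w 2 unitVol)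
    (hvw : ∀ᵐ t ∂unitVol, HasDerivAt v (w t) t) : IsH2 u := by
  refine ⟨v, w, hw, hu, fun t ht => ?_⟩
  have hsub : uIcc 0 t ⊆ uIcc (0 : ℝ) 1 := by
    rw [uIcc_of_le ht.1, uIcc_of_le zero_le_one]
    exact Icc_subset_Icc_right ht.2
  have h1 := (hv.mono hsub).integral_deriv_eq_sub
  have h2 : ∫ x in (0 : ℝ)..t, deriv v x = ∫ x in (0 : ℝ)..t, w x := by
    apply intervalIntegral.integral_congr_ae
    rw [ae_restrict_iff' measurableSet_Icc] at hvw
    filter_upwards [hvw] with x hx hxt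
    rw [uIoc_of_le ht.1] at hxt
    exact (hx ⟨hxt.1.le, hxt.2.trans ht.2⟩).deriv
  linarith

namespace IsH2

variable {u v : ℝ → ℝ}

/-- Derivatives within [0,1] are unique, so the first witness in `IsH2` agrees with `d1 u` on [0,1].
From here on the canonical `d1` and `d2` replace the existential witnesses. -/
theorem hasDerivWithinAt (hu : IsH2 u) {t : ℝ} (ht : t ∈ Icc (0 : ℝ) 1) :
    HasDerivWithinAt u (d1 u t) (Icc 0 1) t := by
  obtain ⟨v, w, -, h, -⟩ := hu
  exact (h t ht).differentiableWithinAt.hasDerivWithinAt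

theorem exists_primitive (hu : IsH2 u) : ∃ w : ℝ → ℝ, MemLp w 2 unitVol ∧
    ∀ t ∈ Icc (0 : ℝ) 1, d1 u t = d1 u 0 + ∫ s in (0 : ℝ)..t, w s := by
  obtain ⟨v, w, hw, h, h'⟩ := hu
  have key : ∀ t ∈ Icc (0 : ℝ) 1, d1 u t = v t := fun t ht =>
    (h t ht).derivWithin (uniqueDiffOn_Icc zero_lt_one t ht)
  refine ⟨w, hw, fun t ht => ?_⟩
  rw [key t ht, key 0 (by simp), h' t ht]

theorem ac_d1 (hu : IsH2 u) : AbsolutelyContinuousOnInterval (d1 u) 0 1 := by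
  obtain ⟨w, hw, h⟩ := hu.exists_primitive
  have h1 := (intervalIntegrable_of_memLp_two hw).absolutelyContinuousOnInterval_intervalIntegral
    (c := 0) (by simp)
  have h2 : AbsolutelyContinuousOnInterval (fun _ : ℝ => d1 u 0) 0 1 :=
    (contDiffOn_const (c := d1 u 0)).absolutelyContinuousOnInterval
  refine absolutelyContinuousOnInterval_congr (h2.add h1) fun t ht => ?_
  rw [uIcc_of_le zero_le_one] at ht
  exact h t ht

theorem continuousOn_d1 (hu : IsH2 u) : ContinuousOn (d1 u) (Icc 0 1) := by
  simpa [uIcc_of_le zero_le_one] using hu.ac_d1.continuousOn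

theorem continuousOn (hu : IsH2 u) : ContinuousOn u (Icc 0 1) :=
  fun _ ht => (hu.hasDerivWithinAt ht).continuousWithinAt

theorem ae_exists (hu : IsH2 u) : ∃ w : ℝ → ℝ, MemLp w 2 unitVol ∧
    ∀ᵐ t ∂unitVol, HasDerivAt (d1 u) (w t) t := by
  obtain ⟨w, hw, h⟩ := hu.exists_primitive
  refine ⟨w, hw, ?_⟩
  have h1 := (intervalIntegrable_of_memLp_two hw).ae_hasDerivAt_integral
  filter_upwards [ae_restrict_of_ae h1, ae_unitVol_mem_Ioo] with t h1 ht
  have h2 := (h1 (by rw [uIcc_of_le zero_le_one]; exact Ioo_subset_Icc_self ht) 0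
    (by simp)).const_add (d1 u 0)
  refine h2.congr_of_eventuallyEq ?_
  filter_upwards [Icc_mem_nhds ht.1 ht.2] with s hs using h s hs

/-- `d2 u` takes the default value 0 where `d1 u` is not differentiable. By Lebesgue's
differentiation theorem this happens only on a null set, so `d2 u` is the weak second derivative. -/
theorem ae_hasDerivAt_d1 (hu : IsH2 u) : ∀ᵐ t ∂unitVol, HasDerivAt (d1 u) (d2 u t) t := by
  obtain ⟨w, -, h⟩ := hu.ae_exists
  filter_upwards [h, ae_unitVol_mem_Ioo] with t h ht
  rwa [d2, derivWithin_of_mem_nhds (Icc_mem_nhds ht.1 ht.2), h.deriv]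

theorem memLp_d2 (hu : IsH2 u) : MemLp (d2 u) 2 unitVol := by
  obtain ⟨w, hw, h⟩ := hu.ae_exists
  refine hw.ae_eq ?_
  filter_upwards [h, hu.ae_hasDerivAt_d1] with t h1 h2 using h1.unique h2

theorem integral_d2 (hu : IsH2 u) {s t : ℝ} (hs : s ∈ Icc (0 : ℝ) 1) (ht : t ∈ Icc (0 : ℝ) 1) :
    ∫ x in s..t, d2 u x = d1 u t - d1 u s := by
  have hsub : uIcc s t ⊆ Icc (0 : ℝ) 1 := uIcc_subset_Icc hs ht
  have h1 := (hu.ac_d1.mono (c := s) (d := t)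
    (by rwa [uIcc_of_le zero_le_one (α := ℝ)])).integral_deriv_eq_sub
  rw [← h1]
  apply intervalIntegral.integral_congr_ae
  have := hu.ae_hasDerivAt_d1
  rw [ae_restrict_iff' measurableSet_Icc] at this
  filter_upwards [this] with x hx hxt
  exact (hx (hsub (uIoc_subset_uIcc hxt))).deriv.symm

theorem d1_eq_of_hasDerivWithinAt {u : ℝ → ℝ} {a t : ℝ} (ht : t ∈ Icc (0 : ℝ) 1)
    (h : HasDerivWithinAt u a (Icc 0 1) t) : d1 u t = a :=
  h.derivWithin (uniqueDiffOn_Icc zero_lt_one t ht)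

theorem d1_congr {u v : ℝ → ℝ} (h : EqOn u v (Icc 0 1)) : EqOn (d1 u) (d1 v) (Icc 0 1) :=
  fun _ ht => derivWithin_congr h (h ht)

theorem d2_congr {u v : ℝ → ℝ} (h : EqOn u v (Icc 0 1)) : EqOn (d2 u) (d2 v) (Icc 0 1) :=
  fun _ ht => derivWithin_congr (d1_congr h) (d1_congr h ht)

theorem congr (hu : IsH2 u) (h : EqOn v u (Icc 0 1)) : IsH2 v := by
  obtain ⟨a, w, hw, h1, h2⟩ := hu
  exact ⟨a, w, hw, fun t ht => (h1 t ht).congr h (h ht), h2⟩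

/-- Identification of the second derivative from an almost everywhere formula for the first one. -/
theorem d2_eq_of_hasDerivAt {u v : ℝ → ℝ} {a t : ℝ} (ht : t ∈ Ioo (0 : ℝ) 1)
    (h1 : EqOn (d1 u) v (Icc 0 1)) (h : HasDerivAt v a t) : d2 u t = a := by
  have hn := Icc_mem_nhds ht.1 ht.2
  rw [d2, derivWithin_of_mem_nhds hn]
  exact (h.congr_of_eventuallyEq (by filter_upwards [hn] with s hs using h1 hs)).deriv

theorem add (hu : IsH2 u) (hv : IsH2 v) : IsH2 (fun t => u t + v t) :=
  isH2_of_ac (v := fun t => d1 u t + d1 v t) (w := fun t => d2 u t + d2 v t)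
    (fun _ ht => (hu.hasDerivWithinAt ht).add (hv.hasDerivWithinAt ht))
    (hu.ac_d1.add hv.ac_d1) (hu.memLp_d2.add hv.memLp_d2)
    (by filter_upwards [hu.ae_hasDerivAt_d1, hv.ae_hasDerivAt_d1] with t h1 h2 using h1.add h2)

theorem d1_add (hu : IsH2 u) (hv : IsH2 v) :
    EqOn (d1 (fun t => u t + v t)) (fun t => d1 u t + d1 v t) (Icc 0 1) := fun _ ht =>
  d1_eq_of_hasDerivWithinAt ht ((hu.hasDerivWithinAt ht).add (hv.hasDerivWithinAt ht))

theorem d2_add (hu : IsH2 u) (hv : IsH2 v) :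
    d2 (fun t => u t + v t) =ᵐ[unitVol] fun t => d2 u t + d2 v t := by
  filter_upwards [hu.ae_hasDerivAt_d1, hv.ae_hasDerivAt_d1, ae_unitVol_mem_Ioo] with t h1 h2 ht
  exact d2_eq_of_hasDerivAt ht (hu.d1_add hv) (h1.add h2)

theorem const_mul (hu : IsH2 u) (c : ℝ) : IsH2 (fun t => c * u t) :=
  isH2_of_ac (v := fun t => c * d1 u t) (w := fun t => c * d2 u t)
    (fun _ ht => (hu.hasDerivWithinAt ht).const_mul c)
    (hu.ac_d1.const_mul c) (hu.memLp_d2.const_mul c)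
    (by filter_upwards [hu.ae_hasDerivAt_d1] with t h1 using h1.const_mul c)

theorem d1_const_mul (hu : IsH2 u) (c : ℝ) :
    EqOn (d1 (fun t => c * u t)) (fun t => c * d1 u t) (Icc 0 1) := fun _ ht =>
  d1_eq_of_hasDerivWithinAt ht ((hu.hasDerivWithinAt ht).const_mul c)

theorem d2_const_mul (hu : IsH2 u) (c : ℝ) :
    d2 (fun t => c * u t) =ᵐ[unitVol] fun t => c * d2 u t := by
  filter_upwards [hu.ae_hasDerivAt_d1, ae_unitVol_mem_Ioo] with t h1 ht
  exact d2_eq_of_hasDerivAt ht (hu.d1_const_mul c) (h1.const_mul c)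

theorem sub (hu : IsH2 u) (hv : IsH2 v) : IsH2 (fun t => u t - v t) :=
  (hu.add (hv.const_mul (-1))).congr fun t _ => by ring

theorem d1_sub (hu : IsH2 u) (hv : IsH2 v) :
    EqOn (d1 (fun t => u t - v t)) (fun t => d1 u t - d1 v t) (Icc 0 1) := fun _ ht =>
  d1_eq_of_hasDerivWithinAt ht ((hu.hasDerivWithinAt ht).sub (hv.hasDerivWithinAt ht))

theorem d2_sub (hu : IsH2 u) (hv : IsH2 v) :
    d2 (fun t => u t - v t) =ᵐ[unitVol] fun t => d2 u t - d2 v t := by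
  filter_upwards [hu.ae_hasDerivAt_d1, hv.ae_hasDerivAt_d1, ae_unitVol_mem_Ioo] with t h1 h2 ht
  exact d2_eq_of_hasDerivAt ht (hu.d1_sub hv) (h1.sub h2)

end IsH2

/-! ### Composition with smooth functions -/

section Comp

variable {m : ℕ}

/-- The `i`-th partial derivative. -/
def pderiv (F : EuclideanSpace ℝ (Fin m) → ℝ) (i : Fin m) (x : EuclideanSpace ℝ (Fin m)) : ℝ :=
  fderiv ℝ F x (EuclideanSpace.single i 1)

theorem contDiff_pderiv {F : EuclideanSpace ℝ (Fin m) → ℝ} (hF : ContDiff ℝ ∞ F) (i : Fin m) :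
    ContDiff ℝ ∞ (pderiv F i) :=
  (hF.fderiv_right (m := ∞) (by simp)).clm_apply contDiff_const

theorem fderiv_apply_eq_sum (F : EuclideanSpace ℝ (Fin m) → ℝ) (x w : EuclideanSpace ℝ (Fin m)) :
    fderiv ℝ F x w = ∑ i, pderiv F i x * w i := by
  conv_lhs => rw [← (EuclideanSpace.basisFun (Fin m) ℝ).sum_repr w]
  simp [pderiv, mul_comm]

theorem hasDerivWithinAt_euclidean {u : ℝ → EuclideanSpace ℝ (Fin m)}
    {a : EuclideanSpace ℝ (Fin m)} {s : Set ℝ} {t : ℝ}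
    (h : ∀ i, HasDerivWithinAt (fun t => u t i) (a i) s t) : HasDerivWithinAt u a s t := by
  have := (hasDerivWithinAt_pi (φ := fun t => (u t).ofLp) (φ' := a.ofLp)).2 h
  exact ((EuclideanSpace.equiv (Fin m) ℝ).symm.toContinuousLinearMap.hasFDerivAt.comp_hasDerivWithinAt
    t this)

theorem hasDerivWithinAt_comp_euclidean {F : EuclideanSpace ℝ (Fin m) → ℝ}
    {u : ℝ → EuclideanSpace ℝ (Fin m)} {a : Fin m → ℝ} {s : Set ℝ} {t : ℝ}
    (hF : DifferentiableAt ℝ F (u t))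
    (h : ∀ i, HasDerivWithinAt (fun t => u t i) (a i) s t) :
    HasDerivWithinAt (fun t => F (u t)) (∑ i, pderiv F i (u t) * a i) s t := by
  have h1 : HasDerivWithinAt u (WithLp.toLp 2 a) s t := hasDerivWithinAt_euclidean h
  have := hF.hasFDerivAt.comp_hasDerivWithinAt t h1
  rwa [fderiv_apply_eq_sum] at this

variable {F : EuclideanSpace ℝ (Fin m) → ℝ} {u : ℝ → EuclideanSpace ℝ (Fin m)}

theorem d1_comp (hF : ContDiff ℝ ∞ F) (hu : ∀ i, IsH2 (fun t => u t i)) :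
    EqOn (d1 (fun t => F (u t)))
      (fun t => ∑ i, pderiv F i (u t) * d1 (fun t => u t i) t) (Icc 0 1) := fun t ht =>
  IsH2.d1_eq_of_hasDerivWithinAt ht (hasDerivWithinAt_comp_euclidean
    (hF.differentiable (by simp) _) fun i => (hu i).hasDerivWithinAt ht)

theorem ac_comp (hF : ContDiff ℝ ∞ F) (hu : ∀ i, IsH2 (fun t => u t i)) :
    AbsolutelyContinuousOnInterval (fun t => F (u t)) 0 1 := by
  apply ContDiffOn.absolutelyContinuousOnInterval
  rw [uIcc_of_le zero_le_one]
  refine (hF.of_le (by norm_cast)).comp_contDiffOn ?_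
  rw [contDiffOn_euclidean]
  intro i
  rw [contDiffOn_one_iff_derivWithin (uniqueDiffOn_Icc zero_lt_one)]
  exact ⟨fun t ht => ((hu i).hasDerivWithinAt ht).differentiableWithinAt, (hu i).continuousOn_d1⟩

theorem continuousOn_euclidean_of_isH2 (hu : ∀ i, IsH2 (fun t => u t i)) :
    ContinuousOn u (Icc 0 1) := fun _ ht =>
  (hasDerivWithinAt_euclidean (a := WithLp.toLp 2 fun i => d1 (fun t => u t i) _)
    fun i => (hu i).hasDerivWithinAt ht).continuousWithinAt

theorem ae_hasDerivAt_d1_comp (hF : ContDiff ℝ ∞ F) (hu : ∀ i, IsH2 (fun t => u t i)) :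
    ∀ᵐ t ∂unitVol, HasDerivAt (fun t => ∑ i, pderiv F i (u t) * d1 (fun t => u t i) t)
      (∑ i, ((∑ j, pderiv (pderiv F i) j (u t) * d1 (fun t => u t j) t) * d1 (fun t => u t i) t
        + pderiv F i (u t) * d2 (fun t => u t i) t)) t := by
  have h : ∀ᵐ t ∂unitVol, ∀ i, HasDerivAt (d1 (fun t => u t i)) (d2 (fun t => u t i) t) t :=
    ae_all_iff.2 fun i => (hu i).ae_hasDerivAt_d1
  filter_upwards [h, ae_unitVol_mem_Ioo] with t h ht
  refine HasDerivAt.fun_sum fun i _ => HasDerivAt.mul ?_ (h i)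
  have h2 := hasDerivWithinAt_comp_euclidean (u := u)
    ((contDiff_pderiv hF i).differentiable (by simp) (u t))
    fun j => (hu j).hasDerivWithinAt (Ioo_subset_Icc_self ht)
  exact h2.hasDerivAt (Icc_mem_nhds ht.1 ht.2)

theorem memLp_continuousOn_mul {c w : ℝ → ℝ} (hc : ContinuousOn c (Icc 0 1))
    (hw : MemLp w 2 unitVol) : MemLp (fun t => c t * w t) 2 unitVol := by
  obtain ⟨C, hC⟩ := isCompact_Icc.exists_bound_of_continuousOn hc
  have h : MemLp c ⊤ unitVol := memLp_top_of_bound (hc.aestronglyMeasurable measurableSet_Icc) C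
    (ae_restrict_of_forall_mem measurableSet_Icc hC)
  exact hw.mul' h

theorem memLp_continuousOn {c : ℝ → ℝ} (hc : ContinuousOn c (Icc 0 1)) : MemLp c 2 unitVol := by
  simpa using memLp_continuousOn_mul hc (memLp_const (1 : ℝ))

/-- The second derivative is D²F(u', u') + DF(u'') almost everywhere: a continuous term plus a
continuous factor times an L² function. -/
theorem isH2_comp (hF : ContDiff ℝ ∞ F) (hu : ∀ i, IsH2 (fun t => u t i)) :
    IsH2 (fun t => F (u t)) := by
  have hc : ∀ {G : EuclideanSpace ℝ (Fin m) → ℝ}, ContDiff ℝ ∞ G →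
      ContinuousOn (fun t => G (u t)) (Icc 0 1) := fun hG =>
    hG.continuous.comp_continuousOn (continuousOn_euclidean_of_isH2 hu)
  refine isH2_of_ac (fun t ht => hasDerivWithinAt_comp_euclidean
    (hF.differentiable (by simp) _) fun i => (hu i).hasDerivWithinAt ht) ?_ ?_
    (ae_hasDerivAt_d1_comp hF hu)
  · exact absolutelyContinuousOnInterval_sum _ fun i =>
      (ac_comp (contDiff_pderiv hF i) hu).mul (hu i).ac_d1
  · refine memLp_finsetSum _ fun i _ => MemLp.add ?_ ?_
    · refine memLp_continuousOn (ContinuousOn.mul (continuousOn_finsetSum _ fun j _ => ?_)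
        (hu i).continuousOn_d1)
      exact (hc (contDiff_pderiv (contDiff_pderiv hF i) j)).mul (hu j).continuousOn_d1
    · exact memLp_continuousOn_mul (hc (contDiff_pderiv hF i)) (hu i).memLp_d2

theorem d2_comp (hF : ContDiff ℝ ∞ F) (hu : ∀ i, IsH2 (fun t => u t i)) :
    d2 (fun t => F (u t)) =ᵐ[unitVol] fun t =>
      ∑ i, ((∑ j, pderiv (pderiv F i) j (u t) * d1 (fun t => u t j) t) * d1 (fun t => u t i) t
        + pderiv F i (u t) * d2 (fun t => u t i) t) := by
  filter_upwards [ae_hasDerivAt_d1_comp hF hu, ae_unitVol_mem_Ioo] with t h ht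
  exact IsH2.d2_eq_of_hasDerivAt ht (d1_comp hF hu) h

end Comp

/-! ### Convergence in `Lᵖ` along a filter -/

section LpTendsto

variable {κ : Type*} {l : Filter κ} {α : Type*} [MeasurableSpace α] {ν : Measure α} {p q r : ℝ≥0∞}

/-- Convergence in `Lᵖ` of real functions along a filter. -/
structure LpTendsto (p : ℝ≥0∞) (w : κ → α → ℝ) (w0 : α → ℝ) (l : Filter κ) (ν : Measure α) :
    Prop where
  meas : ∀ᶠ k in l, AEStronglyMeasurable (w k) ν
  memLp : MemLp w0 p ν
  tendsto : Tendsto (fun k => eLpNorm (fun t => w k t - w0 t) p ν) l (𝓝 0)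

theorem LpTendsto.const {w : α → ℝ} (hw : MemLp w p ν) : LpTendsto p (fun _ : κ => w) w l ν :=
  ⟨Eventually.of_forall fun _ => hw.1, hw, by simpa using tendsto_const_nhds⟩

theorem LpTendsto.congr {w w' : κ → α → ℝ} {w0 w0' : α → ℝ} (h : LpTendsto p w w0 l ν)
    (hw : ∀ᶠ k in l, w' k =ᵐ[ν] w k) (hw0 : w0' =ᵐ[ν] w0) : LpTendsto p w' w0' l ν := by
  refine ⟨?_, h.memLp.ae_eq hw0.symm, h.tendsto.congr' ?_⟩
  · filter_upwards [h.meas, hw] with k h1 h2 using h1.congr h2.symm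
  · filter_upwards [hw] with k hk
    refine eLpNorm_congr_ae ?_
    filter_upwards [hk, hw0] with t h1 h2
    rw [h1, h2]

theorem LpTendsto.add (hp : 1 ≤ p) {f g : κ → α → ℝ} {f0 g0 : α → ℝ} (hf : LpTendsto p f f0 l ν)
    (hg : LpTendsto p g g0 l ν) :
    LpTendsto p (fun k t => f k t + g k t) (fun t => f0 t + g0 t) l ν := by
  refine ⟨?_, hf.memLp.add hg.memLp, ?_⟩
  · filter_upwards [hf.meas, hg.meas] with k h1 h2 using h1.add h2
  · have h0 := hf.tendsto.add hg.tendsto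
    rw [add_zero] at h0
    refine tendsto_of_tendsto_of_tendsto_of_le_of_le' tendsto_const_nhds h0
      (Eventually.of_forall fun _ => zero_le) ?_
    filter_upwards [hf.meas, hg.meas] with k h1 h2
    refine le_trans (le_of_eq ?_) (eLpNorm_add_le (h1.sub hf.memLp.1) (h2.sub hg.memLp.1) hp)
    congr 1
    ext t
    simp only [Pi.add_apply]
    ring

theorem LpTendsto.sum (hp : 1 ≤ p) {ι : Type*} (s : Finset ι) {f : ι → κ → α → ℝ}
    {f0 : ι → α → ℝ} (hf : ∀ i, LpTendsto p (f i) (f0 i) l ν) :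
    LpTendsto p (fun k t => ∑ i ∈ s, f i k t) (fun t => ∑ i ∈ s, f0 i t) l ν := by
  classical
  induction s using Finset.induction_on with
  | empty => simpa using LpTendsto.const (w := fun _ : α => (0 : ℝ)) (MemLp.zero (p := p) (μ := ν))
  | insert i s hi ih =>
    simp only [Finset.sum_insert hi]
    exact (hf i).add hp ih

/-- Write fg - f₀g₀ = (f - f₀)(g - g₀) + f₀(g - g₀) + (f - f₀)g₀ and apply Hölder's inequality to
each term. It is used for L^∞ · L² in L² and for L² · L² in L¹. -/
theorem LpTendsto.mul [p.HolderTriple q r] (hr : 1 ≤ r) {f g : κ → α → ℝ} {f0 g0 : α → ℝ}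
    (hf : LpTendsto p f f0 l ν) (hg : LpTendsto q g g0 l ν) :
    LpTendsto r (fun k t => f k t * g k t) (fun t => f0 t * g0 t) l ν := by
  refine ⟨?_, hg.memLp.mul' hf.memLp, ?_⟩
  · filter_upwards [hf.meas, hg.meas] with k h1 h2 using h1.mul h2
  · set a := fun k => eLpNorm (fun t => f k t - f0 t) p ν
    set b := fun k => eLpNorm (fun t => g k t - g0 t) q ν
    have ha : Tendsto a l (𝓝 0) := hf.tendsto
    have hb : Tendsto b l (𝓝 0) := hg.tendsto
    have h0 : Tendsto (fun k => a k * b k + (eLpNorm f0 p ν * b k + a k * eLpNorm g0 q ν)) l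
        (𝓝 (0 * 0 + (eLpNorm f0 p ν * 0 + 0 * eLpNorm g0 q ν))) :=
      (ENNReal.Tendsto.mul ha (by simp) hb (by simp)).add
        ((ENNReal.Tendsto.const_mul hb (Or.inr hf.memLp.2.ne)).add
          (ENNReal.Tendsto.mul_const ha (Or.inr hg.memLp.2.ne)))
    simp only [mul_zero, zero_mul, add_zero] at h0
    refine tendsto_of_tendsto_of_tendsto_of_le_of_le' tendsto_const_nhds h0
      (Eventually.of_forall fun _ => zero_le) ?_
    filter_upwards [hf.meas, hg.meas] with k h1 h2
    have m1 := h1.sub hf.memLp.1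
    have m2 := h2.sub hg.memLp.1
    have e : (fun t => f k t * g k t - f0 t * g0 t) =
        ((fun t => f k t - f0 t) • (fun t => g k t - g0 t)) +
          ((f0 • fun t => g k t - g0 t) + ((fun t => f k t - f0 t) • g0)) := by
      ext t
      simp only [Pi.add_apply, smul_eq_mul, Pi.mul_apply]
      ring
    rw [e]
    refine (eLpNorm_add_le (m1.smul m2) ((hf.memLp.1.smul m2).add (m1.smul hg.memLp.1)) hr).trans
      (add_le_add (eLpNorm_smul_le_mul_eLpNorm m2 m1)
        ((eLpNorm_add_le (hf.memLp.1.smul m2) (m1.smul hg.memLp.1) hr).trans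
        (add_le_add (eLpNorm_smul_le_mul_eLpNorm m2 hf.memLp.1)
          (eLpNorm_smul_le_mul_eLpNorm hg.memLp.1 m1))))

theorem LpTendsto.two_of_top [IsFiniteMeasure ν] {f : κ → α → ℝ} {f0 : α → ℝ}
    (hf : LpTendsto ⊤ f f0 l ν) : LpTendsto 2 f f0 l ν := by
  simpa using hf.mul (q := 2) (r := 2) one_le_two (LpTendsto.const (memLp_const (1 : ℝ)))

/-- The positive part is 1-Lipschitz, so L¹ convergence passes to the lower integrals of positive
parts, in terms of which the energy is defined. -/
theorem LpTendsto.lintegral_ofReal {f : κ → α → ℝ} {f0 : α → ℝ} (hf : LpTendsto 1 f f0 l ν) :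
    Tendsto (fun k => ∫⁻ t, ENNReal.ofReal (f k t) ∂ν) l (𝓝 (∫⁻ t, ENNReal.ofReal (f0 t) ∂ν)) := by
  have hfin : ∫⁻ t, ENNReal.ofReal (f0 t) ∂ν ≠ ⊤ := by
    refine ne_top_of_le_ne_top hf.memLp.2.ne ?_
    rw [eLpNorm_one_eq_lintegral_enorm]
    exact lintegral_mono fun t => Real.ofReal_le_enorm _
  have key : ∀ a b : ℝ, ENNReal.ofReal a ≤ ENNReal.ofReal b + ‖a - b‖ₑ := fun a b => by
    calc ENNReal.ofReal a = ENNReal.ofReal (b + (a - b)) := by ring_nf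
      _ ≤ ENNReal.ofReal b + ENNReal.ofReal (a - b) := ENNReal.ofReal_add_le
      _ ≤ _ := by gcongr; exact Real.ofReal_le_enorm _
  have ht := hf.tendsto
  simp only [eLpNorm_one_eq_lintegral_enorm] at ht
  rw [ENNReal.tendsto_nhds hfin]
  intro ε hε
  have h1 : ∀ᶠ k in l, ∫⁻ t, ‖f k t - f0 t‖ₑ ∂ν ≤ ε := ht.eventually_le_const hε
  filter_upwards [h1, hf.meas] with k hk hm
  have hm0 := hf.memLp.1
  have m0 : AEMeasurable (fun t => ENNReal.ofReal (f0 t)) ν := hm0.aemeasurable.ennreal_ofReal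
  have m1 : AEMeasurable (fun t => ENNReal.ofReal (f k t)) ν := hm.aemeasurable.ennreal_ofReal
  constructor
  · rw [tsub_le_iff_right]
    calc ∫⁻ t, ENNReal.ofReal (f0 t) ∂ν
        ≤ ∫⁻ t, (ENNReal.ofReal (f k t) + ‖f k t - f0 t‖ₑ) ∂ν :=
          lintegral_mono fun t => by
            have := key (f0 t) (f k t)
            rwa [enorm_sub_rev] at this
      _ = ∫⁻ t, ENNReal.ofReal (f k t) ∂ν + ∫⁻ t, ‖f k t - f0 t‖ₑ ∂ν := lintegral_add_left' m1 _
      _ ≤ _ := by gcongr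
  · calc ∫⁻ t, ENNReal.ofReal (f k t) ∂ν
        ≤ ∫⁻ t, (ENNReal.ofReal (f0 t) + ‖f k t - f0 t‖ₑ) ∂ν :=
          lintegral_mono fun t => key (f k t) (f0 t)
      _ = ∫⁻ t, ENNReal.ofReal (f0 t) ∂ν + ∫⁻ t, ‖f k t - f0 t‖ₑ ∂ν := lintegral_add_left' m0 _
      _ ≤ _ := by gcongr

end LpTendsto

/-! ### Uniform convergence under composition -/

section Uniform

variable {κ : Type*} {l : Filter κ} {Z : Type*} [MetricSpace Z]

/-- Only the limit has to stay in the compact set K: continuity of G at the points of K is uniform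
when one of the two compared points lies in K. So G need only be defined well on a neighbourhood,
such as the target of a chart. -/
theorem tendstoUniformlyOn_comp_compact {T W : Type*} [UniformSpace W] {z : κ → T → Z} {z0 : T → Z}
    {J : Set T} {K Ω : Set Z} {G : Z → W} (hK : IsCompact K) (hΩ : IsOpen Ω) (hKΩ : K ⊆ Ω)
    (hG : ContinuousOn G Ω) (hz : TendstoUniformlyOn z z0 l J) (h0 : MapsTo z0 J K) :
    TendstoUniformlyOn (fun k t => G (z k t)) (fun t => G (z0 t)) l J := by
  intro r hr
  have h1 := hK.uniformContinuousAt_of_continuousAt G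
    (fun a ha => hG.continuousAt (hΩ.mem_nhds (hKΩ ha))) hr
  filter_upwards [hz _ h1] with k hk t ht
  exact hk t ht (h0 ht)

theorem eventually_mapsTo_of_tendstoUniformlyOn {T : Type*} {z : κ → T → Z} {z0 : T → Z}
    {J : Set T} {K Ω : Set Z} (hK : IsCompact K) (hΩ : IsOpen Ω) (hKΩ : K ⊆ Ω)
    (hz : TendstoUniformlyOn z z0 l J) (h0 : MapsTo z0 J K) :
    ∀ᶠ k in l, MapsTo (z k) J Ω := by
  obtain ⟨δ, hδ, h⟩ := hK.exists_thickening_subset_open hΩ hKΩ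
  filter_upwards [Metric.tendstoUniformlyOn_iff.1 hz δ hδ] with k hk t ht
  refine h (Metric.mem_thickening_iff.2 ⟨z0 t, h0 ht, ?_⟩)
  rw [dist_comm]
  exact hk t ht

theorem lpTendsto_top_comp {z : κ → ℝ → Z} {z0 : ℝ → Z} {J : Set ℝ} {K Ω : Set Z} {G : Z → ℝ}
    (hJ : MeasurableSet J) (hK : IsCompact K) (hΩ : IsOpen Ω) (hKΩ : K ⊆ Ω)
    (hG : ContinuousOn G Ω) (hz : TendstoUniformlyOn z z0 l J) (h0 : MapsTo z0 J K)
    (hzc : ∀ᶠ k in l, ContinuousOn (z k) J) (hz0 : ContinuousOn z0 J) :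
    LpTendsto ⊤ (fun k t => G (z k t)) (fun t => G (z0 t)) l (volume.restrict J) := by
  refine ⟨?_, ?_, ?_⟩
  · filter_upwards [hzc, eventually_mapsTo_of_tendstoUniformlyOn hK hΩ hKΩ hz h0] with k h1 h2
    exact (hG.comp h1 h2).aestronglyMeasurable hJ
  · obtain ⟨C, hC⟩ := hK.exists_bound_of_continuousOn (hG.mono hKΩ)
    exact memLp_top_of_bound ((hG.comp hz0 (h0.mono_right hKΩ)).aestronglyMeasurable hJ) C
      (ae_restrict_of_forall_mem hJ fun t ht => hC _ (h0 ht))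
  · have h1 := tendstoUniformlyOn_comp_compact hK hΩ hKΩ hG hz h0
    rw [EMetric.tendstoUniformlyOn_iff] at h1
    rw [ENNReal.tendsto_nhds_zero]
    intro ε hε
    filter_upwards [h1 ε hε] with k hk
    rw [eLpNorm_exponent_top]
    refine essSup_le_of_ae_le _ (ae_restrict_of_forall_mem hJ fun t ht => ?_)
    change ‖G (z k t) - G (z0 t)‖ₑ ≤ ε
    rw [enorm_sub_rev, ← edist_eq_enorm_sub]
    exact (hk t ht).le

end Uniform

/-! ### Convergence in `H²` -/

theorem h2EDist_eq (u v : ℝ → ℝ) : h2EDist u v =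
    eLpNorm (fun t => u t - v t) 2 unitVol + eLpNorm (fun t => d1 u t - d1 v t) 2 unitVol
      + eLpNorm (fun t => d2 u t - d2 v t) 2 unitVol := by
  simp only [h2EDist, Finset.sum_range_succ, Finset.sum_range_zero, zero_add,
    iteratedDerivWithin_zero, iteratedDerivWithin_one, iteratedDerivWithin_two_eq]
  rfl

theorem IsH2.integral_d1 {u : ℝ → ℝ} (hu : IsH2 u) {s t : ℝ} (hs : s ∈ Icc (0 : ℝ) 1)
    (ht : t ∈ Icc (0 : ℝ) 1) : ∫ x in s..t, d1 u x = u t - u s := by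
  have hsub : uIcc s t ⊆ Icc (0 : ℝ) 1 := uIcc_subset_Icc hs ht
  have hac : AbsolutelyContinuousOnInterval u s t := by
    apply ContDiffOn.absolutelyContinuousOnInterval
    refine ContDiffOn.mono ?_ hsub
    rw [contDiffOn_one_iff_derivWithin (uniqueDiffOn_Icc zero_lt_one)]
    exact ⟨fun t ht => (hu.hasDerivWithinAt ht).differentiableWithinAt, hu.continuousOn_d1⟩
  rw [← hac.integral_deriv_eq_sub]
  apply intervalIntegral.integral_congr_ae
  have := ae_unitVol_mem_Ioo
  rw [ae_restrict_iff' measurableSet_Icc] at this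
  filter_upwards [this] with x hx hxt
  have hx' := hsub (uIoc_subset_uIcc hxt)
  exact ((hu.hasDerivWithinAt hx').hasDerivAt
    (Icc_mem_nhds (hx hx').1 (hx hx').2)).deriv.symm

/-- One-dimensional Sobolev inequality. -/
theorem enorm_le_eLpNorm_add_eLpNorm {φ w : ℝ → ℝ} (hφ : ContinuousOn φ (Icc 0 1))
    (hw : AEStronglyMeasurable w unitVol)
    (h : ∀ s ∈ Icc (0 : ℝ) 1, ∀ t ∈ Icc (0 : ℝ) 1, ∫ x in s..t, w x = φ t - φ s)
    {t : ℝ} (ht : t ∈ Icc (0 : ℝ) 1) :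
    ‖φ t‖ₑ ≤ eLpNorm φ 2 unitVol + eLpNorm w 2 unitVol := by
  have hφm : AEStronglyMeasurable φ unitVol := hφ.aestronglyMeasurable measurableSet_Icc
  -- φ t is compared with φ s for every s, and the bound is then averaged over s. As [0,1] has mass
  -- one, the averaging costs no constant and L¹ norms are at most L² norms.
  have h1 : ∀ s ∈ Icc (0 : ℝ) 1, ‖φ t‖ₑ ≤ ‖φ s‖ₑ + ∫⁻ x, ‖w x‖ₑ ∂unitVol := by
    intro s hs
    have e : φ t = φ s + ∫ x in s..t, w x := by rw [h s hs t ht]; ring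
    rw [e]
    refine (enorm_add_le _ _).trans (add_le_add le_rfl ?_)
    rw [intervalIntegral.intervalIntegral_eq_integral_uIoc]
    have : ‖(if s ≤ t then (1 : ℝ) else -1) • ∫ x in uIoc s t, w x‖ₑ
        = ‖∫ x in uIoc s t, w x‖ₑ := by
      split_ifs <;> simp
    rw [this]
    refine (enorm_integral_le_lintegral_enorm _).trans (lintegral_mono_set ?_)
    exact uIoc_subset_uIcc.trans (uIcc_subset_Icc hs ht)
  calc ‖φ t‖ₑ = ∫⁻ _, ‖φ t‖ₑ ∂unitVol := by simp
    _ ≤ ∫⁻ s, (‖φ s‖ₑ + ∫⁻ x, ‖w x‖ₑ ∂unitVol) ∂unitVol :=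
      lintegral_mono_ae (ae_restrict_of_forall_mem measurableSet_Icc h1)
    _ = eLpNorm φ 1 unitVol + eLpNorm w 1 unitVol := by
      rw [lintegral_add_left' hφm.enorm]
      simp [eLpNorm_one_eq_lintegral_enorm]
    _ ≤ _ := add_le_add (eLpNorm_le_eLpNorm_of_exponent_le one_le_two hφm)
      (eLpNorm_le_eLpNorm_of_exponent_le one_le_two hw)

theorem enorm_sub_le_h2EDist {u v : ℝ → ℝ} (hu : IsH2 u) (hv : IsH2 v) {t : ℝ}
    (ht : t ∈ Icc (0 : ℝ) 1) : ‖u t - v t‖ₑ ≤ h2EDist u v := by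
  refine (enorm_le_eLpNorm_add_eLpNorm (φ := fun t => u t - v t) (w := fun t => d1 u t - d1 v t)
    (hu.continuousOn.sub hv.continuousOn)
    ((hu.continuousOn_d1.sub hv.continuousOn_d1).aestronglyMeasurable measurableSet_Icc)
    (fun s hs t ht => ?_) ht).trans ?_
  · have hsub : uIcc s t ⊆ Icc (0 : ℝ) 1 := uIcc_subset_Icc hs ht
    rw [intervalIntegral.integral_sub (hu.continuousOn_d1.mono hsub).intervalIntegrable
      (hv.continuousOn_d1.mono hsub).intervalIntegrable, hu.integral_d1 hs ht, hv.integral_d1 hs ht]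
    ring
  · rw [h2EDist_eq]
    exact le_self_add

theorem enorm_d1_sub_le_h2EDist {u v : ℝ → ℝ} (hu : IsH2 u) (hv : IsH2 v) {t : ℝ}
    (ht : t ∈ Icc (0 : ℝ) 1) : ‖d1 u t - d1 v t‖ₑ ≤ h2EDist u v := by
  refine (enorm_le_eLpNorm_add_eLpNorm (φ := fun t => d1 u t - d1 v t)
    (w := fun t => d2 u t - d2 v t) (hu.continuousOn_d1.sub hv.continuousOn_d1)
    (hu.memLp_d2.1.sub hv.memLp_d2.1) (fun s hs t ht => ?_) ht).trans ?_
  · have hsub : uIcc s t ⊆ uIcc (0 : ℝ) 1 := by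
      rw [uIcc_of_le zero_le_one (α := ℝ)]; exact uIcc_subset_Icc hs ht
    rw [intervalIntegral.integral_sub
      ((intervalIntegrable_of_memLp_two hu.memLp_d2).mono_set hsub)
      ((intervalIntegrable_of_memLp_two hv.memLp_d2).mono_set hsub),
      hu.integral_d2 hs ht, hv.integral_d2 hs ht]
    ring
  · rw [h2EDist_eq, add_assoc]
    exact le_add_self

/-- Convergence of `H²` functions: uniformly together with the first derivatives, and in `L²` for
the second derivatives. -/
structure H2Tendsto {κ : Type*} (u : κ → ℝ → ℝ) (u0 : ℝ → ℝ) (l : Filter κ) : Prop where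
  zero : TendstoUniformlyOn u u0 l (Icc 0 1)
  one : TendstoUniformlyOn (fun k => d1 (u k)) (d1 u0) l (Icc 0 1)
  two : Tendsto (fun k => eLpNorm (fun t => d2 (u k) t - d2 u0 t) 2 unitVol) l (𝓝 0)

section H2Tendsto

variable {κ : Type*} {l : Filter κ} {u v : κ → ℝ → ℝ} {u0 v0 : ℝ → ℝ}

/-- The one-dimensional Sobolev inequality upgrades L² closeness of the function and its derivatives
to uniform closeness of the function and its first derivative. -/
theorem H2Tendsto.of_h2EDist (hu : ∀ k, IsH2 (u k)) (hu0 : IsH2 u0)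
    (h : Tendsto (fun k => h2EDist (u k) u0) l (𝓝 0)) : H2Tendsto u u0 l := by
  refine ⟨?_, ?_, ?_⟩
  · rw [EMetric.tendstoUniformlyOn_iff]
    intro ε hε
    filter_upwards [h.eventually_lt_const hε] with k hk t ht
    rw [edist_comm, edist_eq_enorm_sub]
    exact (enorm_sub_le_h2EDist (hu k) hu0 ht).trans_lt hk
  · rw [EMetric.tendstoUniformlyOn_iff]
    intro ε hε
    filter_upwards [h.eventually_lt_const hε] with k hk t ht
    rw [edist_comm, edist_eq_enorm_sub]
    exact (enorm_d1_sub_le_h2EDist (hu k) hu0 ht).trans_lt hk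
  · refine tendsto_of_tendsto_of_tendsto_of_le_of_le tendsto_const_nhds h (fun _ => zero_le)
      fun k => ?_
    rw [h2EDist_eq]
    exact le_add_self

theorem tendsto_eLpNorm_of_tendstoUniformlyOn (h : TendstoUniformlyOn u u0 l (Icc 0 1)) :
    Tendsto (fun k => eLpNorm (fun t => u k t - u0 t) 2 unitVol) l (𝓝 0) := by
  rw [ENNReal.tendsto_nhds_zero]
  rw [EMetric.tendstoUniformlyOn_iff] at h
  intro ε hε
  filter_upwards [h ε hε] with k hk
  have h1 : ∀ᵐ t ∂unitVol, ‖u k t - u0 t‖ₑ ≤ ε :=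
    ae_restrict_of_forall_mem measurableSet_Icc fun t ht => by
      rw [enorm_sub_rev, ← edist_eq_enorm_sub]
      exact (hk t ht).le
  simpa using eLpNorm_le_of_ae_enorm_bound (p := 2) h1

theorem H2Tendsto.tendsto_h2EDist (h : H2Tendsto u u0 l) :
    Tendsto (fun k => h2EDist (u k) u0) l (𝓝 0) := by
  simp only [h2EDist_eq]
  simpa using ((tendsto_eLpNorm_of_tendstoUniformlyOn h.zero).add
    (tendsto_eLpNorm_of_tendstoUniformlyOn h.one)).add h.two

theorem H2Tendsto.lp_two (h : H2Tendsto u u0 l) (hu : ∀ k, IsH2 (u k)) (hu0 : IsH2 u0) :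
    LpTendsto 2 (fun k => d2 (u k)) (d2 u0) l unitVol :=
  ⟨Eventually.of_forall fun k => (hu k).memLp_d2.1, hu0.memLp_d2, h.two⟩

theorem H2Tendsto.congr (h : H2Tendsto u u0 l) (huv : ∀ᶠ k in l, EqOn (v k) (u k) (Icc 0 1))
    (h0 : EqOn v0 u0 (Icc 0 1)) : H2Tendsto v v0 l := by
  refine ⟨(h.zero.congr ?_).congr_right h0.symm,
    (h.one.congr ?_).congr_right (IsH2.d1_congr h0).symm, h.two.congr' ?_⟩
  · filter_upwards [huv] with k hk using hk.symm
  · filter_upwards [huv] with k hk using (IsH2.d1_congr hk).symm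
  · filter_upwards [huv] with k hk
    refine eLpNorm_congr_ae (ae_restrict_of_forall_mem measurableSet_Icc fun t ht => ?_)
    simp only [IsH2.d2_congr hk ht, IsH2.d2_congr h0 ht]

theorem H2Tendsto.add (h : H2Tendsto u u0 l) (h' : H2Tendsto v v0 l)
    (hu : ∀ k, IsH2 (u k)) (hu0 : IsH2 u0) (hv : ∀ k, IsH2 (v k)) (hv0 : IsH2 v0) :
    H2Tendsto (fun k t => u k t + v k t) (fun t => u0 t + v0 t) l := by
  refine ⟨h.zero.add h'.zero, ?_, ?_⟩
  · refine ((h.one.add h'.one).congr ?_).congr_right (hu0.d1_add hv0).symm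
    exact Eventually.of_forall fun k => ((hu k).d1_add (hv k)).symm
  · exact (((h.lp_two hu hu0).add one_le_two (h'.lp_two hv hv0)).congr
      (Eventually.of_forall fun k => (hu k).d2_add (hv k)) (hu0.d2_add hv0)).tendsto

theorem H2Tendsto.const_mul {c : κ → ℝ} {c0 : ℝ} (hc : Tendsto c l (𝓝 c0)) {w : ℝ → ℝ}
    (hw : IsH2 w) : H2Tendsto (fun k t => c k * w t) (fun t => c0 * w t) l := by
  have key : ∀ {w : ℝ → ℝ}, ContinuousOn w (Icc 0 1) →
      TendstoUniformlyOn (fun k t => c k * w t) (fun t => c0 * w t) l (Icc 0 1) := by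
    intro w hw
    obtain ⟨C, hC⟩ := isCompact_Icc.exists_bound_of_continuousOn hw
    rw [Metric.tendstoUniformlyOn_iff]
    intro ε hε
    have hC' : 0 < |C| + 1 := by positivity
    filter_upwards [Metric.tendsto_nhds.1 hc (ε / (|C| + 1)) (by positivity)] with k hk t ht
    rw [Real.dist_eq, abs_sub_comm, lt_div_iff₀ hC'] at hk
    rw [Real.dist_eq, ← sub_mul, abs_mul]
    have h1 : |w t| ≤ |C| + 1 := (hC t ht).trans ((le_abs_self C).trans (by linarith))
    calc |c0 - c k| * |w t| ≤ |c0 - c k| * (|C| + 1) := by gcongr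
      _ < ε := hk
  refine ⟨key hw.continuousOn, ?_, ?_⟩
  · exact ((key hw.continuousOn_d1).congr
      (Eventually.of_forall fun k => (hw.d1_const_mul (c k)).symm)).congr_right
        (hw.d1_const_mul c0).symm
  · have h1 : ∀ k, eLpNorm (fun t => d2 (fun t => c k * w t) t - d2 (fun t => c0 * w t) t) 2 unitVol
        = ‖c k - c0‖ₑ * eLpNorm (d2 w) 2 unitVol := by
      intro k
      rw [← eLpNorm_const_smul]
      refine eLpNorm_congr_ae ?_
      filter_upwards [hw.d2_const_mul (c k), hw.d2_const_mul c0] with t e1 e2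
      rw [e1, e2, Pi.smul_apply, smul_eq_mul]
      ring
    simp only [h1]
    have h2 : Tendsto (fun k => ‖c k - c0‖ₑ) l (𝓝 0) := by
      simpa [edist_eq_enorm_sub] using tendsto_iff_edist_tendsto_0.1 hc
    simpa using ENNReal.Tendsto.mul_const h2 (Or.inr hw.memLp_d2.2.ne)

theorem H2Tendsto.sub (h : H2Tendsto u u0 l) (h' : H2Tendsto v v0 l)
    (hu : ∀ k, IsH2 (u k)) (hu0 : IsH2 u0) (hv : ∀ k, IsH2 (v k)) (hv0 : IsH2 v0) :
    H2Tendsto (fun k t => u k t - v k t) (fun t => u0 t - v0 t) l := by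
  refine ⟨h.zero.sub h'.zero, ?_, ?_⟩
  · refine ((h.one.sub h'.one).congr ?_).congr_right (hu0.d1_sub hv0).symm
    exact Eventually.of_forall fun k => ((hu k).d1_sub (hv k)).symm
  · have hn : LpTendsto 2 (fun k t => -1 * d2 (v k) t) (fun t => -1 * d2 v0 t) l unitVol :=
      (LpTendsto.const (p := ⊤) (memLp_const (-1 : ℝ))).mul one_le_two (h'.lp_two hv hv0)
    refine (((h.lp_two hu hu0).add one_le_two hn).congr
      (Eventually.of_forall fun k => ?_) ?_).tendsto
    · filter_upwards [(hu k).d2_sub (hv k)] with t ht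
      rw [ht]; ring
    · filter_upwards [hu0.d2_sub hv0] with t ht
      rw [ht]; ring

variable {m : ℕ}

/-- Position and velocity of a curve in Euclidean space. -/
def posVel (u : ℝ → EuclideanSpace ℝ (Fin m)) (t : ℝ) :
    EuclideanSpace ℝ (Fin m) × EuclideanSpace ℝ (Fin m) :=
  (u t, WithLp.toLp 2 fun i => d1 (fun t => u t i) t)

theorem continuousOn_posVel {u : ℝ → EuclideanSpace ℝ (Fin m)} (hu : ∀ i, IsH2 (fun t => u t i)) :
    ContinuousOn (posVel u) (Icc 0 1) := by
  refine (continuousOn_euclidean_of_isH2 hu).prodMk ?_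
  exact (PiLp.continuous_toLp 2 _).comp_continuousOn
    (continuousOn_pi.2 fun i => (hu i).continuousOn_d1)

theorem tendstoUniformlyOn_euclidean {T : Type*} {J : Set T}
    {w : κ → T → EuclideanSpace ℝ (Fin m)} {w0 : T → EuclideanSpace ℝ (Fin m)}
    (h : ∀ i, TendstoUniformlyOn (fun k t => w k t i) (fun t => w0 t i) l J) :
    TendstoUniformlyOn w w0 l J := by
  have h1 : TendstoUniformlyOn (fun k t => (w k t).ofLp) (fun t => (w0 t).ofLp) l J := by
    rw [tendstoUniformlyOn_iff_tendsto, Pi.uniformity]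
    simp only [tendsto_iInf, tendsto_comap_iff]
    intro i
    have := h i
    rw [tendstoUniformlyOn_iff_tendsto] at this
    exact this
  exact (PiLp.uniformContinuous_toLp 2 (fun _ : Fin m => ℝ)).comp_tendstoUniformlyOn h1

theorem tendstoUniformlyOn_posVel {u : κ → ℝ → EuclideanSpace ℝ (Fin m)}
    {u0 : ℝ → EuclideanSpace ℝ (Fin m)}
    (h : ∀ i, H2Tendsto (fun k t => u k t i) (fun t => u0 t i) l) :
    TendstoUniformlyOn (fun k => posVel (u k)) (posVel u0) l (Icc 0 1) :=
  fun r hr => tendsto_diag.eventually (((tendstoUniformlyOn_euclidean fun i => (h i).zero).prodMk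
    (tendstoUniformlyOn_euclidean
      (w := fun k t => WithLp.toLp 2 fun i => d1 (fun t => u k t i) t)
      (w0 := fun t => WithLp.toLp 2 fun i => d1 (fun t => u0 t i) t)
      fun i => (h i).one)) r hr)

/-- The second derivative of F ∘ u is affine in u'' with coefficients continuous in (u, u'). These
coefficients converge uniformly since (u, u') does and its limit has compact image; multiplied by
the L² convergent u'' they converge in L². -/
theorem H2Tendsto.comp {u : κ → ℝ → EuclideanSpace ℝ (Fin m)} {u0 : ℝ → EuclideanSpace ℝ (Fin m)}
    (h : ∀ i, H2Tendsto (fun k t => u k t i) (fun t => u0 t i) l)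
    (hu : ∀ k i, IsH2 (fun t => u k t i)) (hu0 : ∀ i, IsH2 (fun t => u0 t i))
    {F : EuclideanSpace ℝ (Fin m) → ℝ} (hF : ContDiff ℝ ∞ F) :
    H2Tendsto (fun k t => F (u k t)) (fun t => F (u0 t)) l := by
  have hP := fun i => (contDiff_pderiv hF i).continuous
  have hPP := fun i j => (contDiff_pderiv (contDiff_pderiv hF i) j).continuous
  have hz := tendstoUniformlyOn_posVel h
  have hK : IsCompact (posVel u0 '' Icc 0 1) := isCompact_Icc.image_of_continuousOn
    (continuousOn_posVel hu0)
  have hunif : ∀ {G : EuclideanSpace ℝ (Fin m) × EuclideanSpace ℝ (Fin m) → ℝ}, Continuous G →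
      TendstoUniformlyOn (fun k t => G (posVel (u k) t)) (fun t => G (posVel u0 t)) l (Icc 0 1) :=
    fun hG => tendstoUniformlyOn_comp_compact hK isOpen_univ (subset_univ _) hG.continuousOn hz
      (mapsTo_image _ _)
  have hlp : ∀ {G : EuclideanSpace ℝ (Fin m) × EuclideanSpace ℝ (Fin m) → ℝ}, Continuous G →
      LpTendsto ⊤ (fun k t => G (posVel (u k) t)) (fun t => G (posVel u0 t)) l unitVol :=
    fun hG => lpTendsto_top_comp measurableSet_Icc hK isOpen_univ (subset_univ _) hG.continuousOn hz
      (mapsTo_image _ _) (Eventually.of_forall fun k => continuousOn_posVel (hu k))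
      (continuousOn_posVel hu0)
  refine ⟨hunif (G := fun z => F z.1) (hF.continuous.comp continuous_fst), ?_, ?_⟩
  · refine ((hunif (G := fun z => ∑ i, pderiv F i z.1 * z.2 i) ?_).congr
      (Eventually.of_forall fun k => (d1_comp hF (hu k)).symm)).congr_right (d1_comp hF hu0).symm
    fun_prop
  · refine LpTendsto.tendsto (LpTendsto.congr (LpTendsto.sum one_le_two Finset.univ fun i =>
      LpTendsto.add one_le_two ?_ ?_)
      (Eventually.of_forall fun k => d2_comp hF (hu k)) (d2_comp hF hu0))
    · refine (hlp (G := fun z => (∑ j, pderiv (pderiv F i) j z.1 * z.2 j) * z.2 i) ?_).two_of_top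
      have := hPP i
      fun_prop
    · exact (hlp (G := fun z => pderiv F i z.1) (by fun_prop)).mul one_le_two
        ((h i).lp_two (fun k => hu k i) (hu0 i))

end H2Tendsto

/-! ### The topology of the path space -/

section Topology

variable {n : ℕ} {M : Type*} [TopologicalSpace M] [ChartedSpace (EuclideanSpace ℝ (Fin n)) M]

theorem H2Path.isH2_path (γ : H2Path n M) {f : M → ℝ} (hf : ContMDiff (𝓡 n) 𝓘(ℝ, ℝ) ∞ f) :
    IsH2 (fun t => f (γ.path t)) := γ.isH2 f hf

theorem H2Path.continuous_path (γ : H2Path n M) : Continuous γ.path :=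
  γ.curve.continuous.comp continuous_projIcc

theorem H2Path.ext_path {γ η : H2Path n M} (h : EqOn γ.path η.path (Icc 0 1)) : γ = η := by
  obtain ⟨c, hc⟩ := γ
  obtain ⟨c', hc'⟩ := η
  have : c = c' := by
    ext t
    have := h t.2
    simpa [H2Path.path] using this
  subst this
  rfl

theorem h2EDist_self (u : ℝ → ℝ) : h2EDist u u = 0 := by
  simp [h2EDist]

theorem h2EDist_triangle {u v w : ℝ → ℝ} (hu : IsH2 u) (hv : IsH2 v) (hw : IsH2 w) :
    h2EDist u w ≤ h2EDist u v + h2EDist v w := by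
  have key : ∀ {a b c : ℝ → ℝ}, AEStronglyMeasurable a unitVol → AEStronglyMeasurable b unitVol →
      AEStronglyMeasurable c unitVol → eLpNorm (fun t => a t - c t) 2 unitVol ≤
        eLpNorm (fun t => a t - b t) 2 unitVol + eLpNorm (fun t => b t - c t) 2 unitVol := by
    intro a b c ha hb hc
    refine le_trans (le_of_eq ?_) (eLpNorm_add_le (ha.sub hb) (hb.sub hc) one_le_two)
    congr 1
    ext t
    simp
  have m0 : ∀ {a : ℝ → ℝ}, IsH2 a → AEStronglyMeasurable a unitVol :=
    fun h => h.continuousOn.aestronglyMeasurable measurableSet_Icc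
  have m1 : ∀ {a : ℝ → ℝ}, IsH2 a → AEStronglyMeasurable (d1 a) unitVol :=
    fun h => h.continuousOn_d1.aestronglyMeasurable measurableSet_Icc
  simp only [h2EDist_eq]
  refine (add_le_add (add_le_add (key (m0 hu) (m0 hv) (m0 hw)) (key (m1 hu) (m1 hv) (m1 hw)))
    (key hu.memLp_d2.1 hv.memLp_d2.1 hw.memLp_d2.1)).trans (le_of_eq ?_)
  ring

/-- Convergence in the path space is `H²` convergence after composition with smooth functions. -/
theorem tendsto_h2Path_iff {κ : Type*} {l : Filter κ} {Γ : κ → H2Path n M} {γ : H2Path n M} :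
    Tendsto Γ l (𝓝 γ) ↔ ∀ f : M → ℝ, ContMDiff (𝓡 n) 𝓘(ℝ, ℝ) ∞ f →
      H2Tendsto (fun k t => f ((Γ k).path t)) (fun t => f (γ.path t)) l := by
  constructor
  · intro h f hf
    refine H2Tendsto.of_h2EDist (fun k => (Γ k).isH2_path hf) (γ.isH2_path hf) ?_
    rw [ENNReal.tendsto_nhds_zero]
    intro ε hε
    have hU : {η : H2Path n M | h2EDist (fun t => f (η.path t)) (fun t => f (γ.path t)) < ε} ∈
        𝓝 γ := by
      refine IsOpen.mem_nhds (TopologicalSpace.isOpen_generateFrom_of_mem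
        ⟨f, hf, γ, ε, hε, rfl⟩) ?_
      simpa [h2EDist_self] using hε
    filter_upwards [h hU] with k hk using le_of_lt hk
  · intro h
    refine TopologicalSpace.tendsto_nhds_generateFrom_iff.2 ?_
    rintro _ ⟨f, hf, γ', ε, hε, rfl⟩ hγ
    -- The subbasic ball has an arbitrary centre γ'; the triangle inequality recentres it at γ.
    have h1 := (h f hf).tendsto_h2EDist.add_const
      (h2EDist (fun t => f (γ.path t)) (fun t => f (γ'.path t)))
    rw [zero_add] at h1
    filter_upwards [h1.eventually_lt_const hγ] with k hk
    exact (h2EDist_triangle ((Γ k).isH2_path hf) (γ.isH2_path hf) (γ'.isH2_path hf)).trans_lt hk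

theorem H2Path.h2Tendsto (γ : H2Path n M) {f : M → ℝ} (hf : ContMDiff (𝓡 n) 𝓘(ℝ, ℝ) ∞ f) :
    H2Tendsto (fun (η : H2Path n M) t => f (η.path t)) (fun t => f (γ.path t)) (𝓝 γ) :=
  tendsto_h2Path_iff.1 tendsto_id f hf

end Topology

/-! ### Charts cut off by bump functions -/

section Charts

variable {n : ℕ} {M : Type*} [TopologicalSpace M] [ChartedSpace (EuclideanSpace ℝ (Fin n)) M]

/-- The chart at `c` multiplied by a bump function. -/
def cutChart {c : M} (b : SmoothBumpFunction (𝓡 n) c) (x : M) : EuclideanSpace ℝ (Fin n) :=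
  b x • extChartAt (𝓡 n) c x

theorem cutChart_eventuallyEq {c x : M} {b : SmoothBumpFunction (𝓡 n) c} (hb : b =ᶠ[𝓝 x] 1) :
    cutChart b =ᶠ[𝓝 x] extChartAt (𝓡 n) c := by
  filter_upwards [hb] with y hy
  simp [cutChart, hy]

theorem mem_chart_source_of_eventuallyEq_one {c x : M} {b : SmoothBumpFunction (𝓡 n) c}
    (hb : b =ᶠ[𝓝 x] 1) : x ∈ (chartAt (EuclideanSpace ℝ (Fin n)) c).source := by
  refine b.support_subset_source ?_
  have := hb.self_of_nhds
  simp [this]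

variable [IsManifold (𝓡 n) ∞ M] [T2Space M]

/-- Paths are tested only against smooth functions on all of M. Cutting a chart off makes its
coordinates such functions, and so brings coordinates of a path into the scope of the `H²` calculus.
-/
theorem contMDiff_cutChart {c : M} (b : SmoothBumpFunction (𝓡 n) c) :
    ContMDiff (𝓡 n) 𝓘(ℝ, EuclideanSpace ℝ (Fin n)) ∞ (cutChart b) :=
  b.contMDiff_smul contMDiffOn_extChartAt

theorem contMDiff_cutChart_apply {c : M} (b : SmoothBumpFunction (𝓡 n) c) (i : Fin n) :
    ContMDiff (𝓡 n) 𝓘(ℝ, ℝ) ∞ (fun x => cutChart b x i) :=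
  (EuclideanSpace.proj (𝕜 := ℝ) i).contMDiff.comp (contMDiff_cutChart b)

theorem exists_bump_subset {c : M} {s : Set M} (hs : s ∈ 𝓝 c) :
    ∃ b : SmoothBumpFunction (𝓡 n) c, tsupport b ⊆ s := by
  obtain ⟨b, -, hb⟩ := (SmoothBumpFunction.nhds_basis_tsupport (I := 𝓡 n) c).mem_iff.1 hs
  exact ⟨b, hb⟩

/-- A pair of bump functions at `c`, the first one being `1` near the support of the second. -/
theorem exists_nested_bump (c : M) : ∃ b b' : SmoothBumpFunction (𝓡 n) c,
    ∀ x, b' x ≠ 0 → b =ᶠ[𝓝 x] 1 := by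
  obtain ⟨b⟩ : Nonempty (SmoothBumpFunction (𝓡 n) c) := inferInstance
  have h : {x | b =ᶠ[𝓝 x] 1} ∈ 𝓝 c := eventually_eventually_nhds.2 b.eventuallyEq_one
  obtain ⟨b', hb'⟩ := exists_bump_subset (n := n) h
  exact ⟨b, b', fun x hx => hb' (subset_closure hx)⟩

/-- Velocity in the chart at `c` of a curve along which the bump function is locally `1`. -/
def cutVel {c : M} (b : SmoothBumpFunction (𝓡 n) c) (γ : H2Path n M) (t : ℝ) :
    EuclideanSpace ℝ (Fin n) :=
  WithLp.toLp 2 fun i => d1 (fun s => cutChart b (γ.path s) i) t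

theorem isH2_cutChart {c : M} (b : SmoothBumpFunction (𝓡 n) c) (γ : H2Path n M) (i : Fin n) :
    IsH2 (fun s => cutChart b (γ.path s) i) :=
  γ.isH2_path (contMDiff_cutChart_apply b i)

theorem hasDerivWithinAt_extChartAt_path {c : M} {b : SmoothBumpFunction (𝓡 n) c} {γ : H2Path n M}
    {t : ℝ} (ht : t ∈ Icc (0 : ℝ) 1) (hb : b =ᶠ[𝓝 (γ.path t)] 1) :
    HasDerivWithinAt (fun s => extChartAt (𝓡 n) c (γ.path s)) (cutVel b γ t) (Icc 0 1) t := by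
  have h1 : HasDerivWithinAt (fun s => cutChart b (γ.path s)) (cutVel b γ t) (Icc 0 1) t :=
    hasDerivWithinAt_euclidean fun i => (isH2_cutChart b γ i).hasDerivWithinAt ht
  have h2 := (γ.continuous_path.tendsto t).eventually (cutChart_eventuallyEq hb)
  exact h1.congr_of_eventuallyEq (h2.filter_mono nhdsWithin_le_nhds |>.mono fun s hs => hs.symm)
    (h2.self_of_nhds).symm

theorem mdifferentiableWithinAt_path (γ : H2Path n M) {t : ℝ} (ht : t ∈ Icc (0 : ℝ) 1) :
    MDifferentiableWithinAt 𝓘(ℝ, ℝ) (𝓡 n) γ.path (Icc 0 1) t := by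
  obtain ⟨b⟩ : Nonempty (SmoothBumpFunction (𝓡 n) (γ.path t)) := inferInstance
  rw [mdifferentiableWithinAt_iff]
  refine ⟨γ.continuous_path.continuousWithinAt, ?_⟩
  have := (hasDerivWithinAt_extChartAt_path ht b.eventuallyEq_one).differentiableWithinAt
  rw [extChartAt_model_space_eq_id]
  simpa only [PartialEquiv.refl_symm, PartialEquiv.refl_coe, Function.comp_def, id_eq,
    preimage_id_eq, modelWithCornersSelf_coe, range_id, inter_univ] using this

/-- Coordinates of the fibre component of a tangent vector, in the chart at `c`. -/
def velCoord (c : M) (q : TangentBundle (𝓡 n) M) : EuclideanSpace ℝ (Fin n) :=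
  (trivializationAt (EuclideanSpace ℝ (Fin n)) (TangentSpace (𝓡 n)) c q).2

theorem velCoord_eq_mfderiv {c : M} {q : TangentBundle (𝓡 n) M}
    (hq : q.proj ∈ (chartAt (EuclideanSpace ℝ (Fin n)) c).source) :
    velCoord c q = mfderiv (𝓡 n) 𝓘(ℝ, EuclideanSpace ℝ (Fin n)) (extChartAt (𝓡 n) c) q.proj q.2 := by
  have : IsManifold (𝓡 n) 1 M := IsManifold.of_le (n := ∞) (by norm_cast)
  have h1 := congrArg (fun L => L q.2) (TangentBundle.continuousLinearMapAt_trivializationAt hq)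
  refine Eq.trans ?_ h1
  exact (congrFun (Bundle.Trivialization.coe_linearMapAt_of_mem (R := ℝ)
    (trivializationAt (EuclideanSpace ℝ (Fin n)) (TangentSpace (𝓡 n)) c) (by simpa using hq))
      q.2).symm

/-- The jet is defined by a manifold derivative. Read in the trivialization at c it is the ordinary
derivative of the cut-off coordinates, so that continuity and equality of jets can be checked on
real `H²` functions. -/
theorem velCoord_jet {c : M} {b : SmoothBumpFunction (𝓡 n) c} {γ : H2Path n M} {t : ℝ}
    (ht : t ∈ Icc (0 : ℝ) 1) (hb : b =ᶠ[𝓝 (γ.path t)] 1) :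
    velCoord c (jet t γ) = cutVel b γ t := by
  have : IsManifold (𝓡 n) 1 M := IsManifold.of_le (n := ∞) (by norm_cast)
  have hs := mem_chart_source_of_eventuallyEq_one hb
  have hu : UniqueDiffWithinAt ℝ (Icc (0 : ℝ) 1) t := uniqueDiffOn_Icc zero_lt_one t ht
  have h1 := mfderiv_comp_mfderivWithin (I := 𝓘(ℝ, ℝ)) (I' := 𝓡 n)
    (I'' := 𝓘(ℝ, EuclideanSpace ℝ (Fin n))) t
    (mdifferentiableAt_extChartAt (I := 𝓡 n) hs) (mdifferentiableWithinAt_path γ ht)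
    (uniqueMDiffWithinAt_iff_uniqueDiffWithinAt.2 hu)
  rw [velCoord_eq_mfderiv hs]
  have h2 := (hasDerivWithinAt_extChartAt_path ht hb).derivWithin hu
  rw [← h2, ← fderivWithin_derivWithin, ← mfderivWithin_eq_fderivWithin]
  exact (congrArg (fun L => L (1 : ℝ)) h1).symm

theorem tangentBundle_ext {c : M} {p q : TangentBundle (𝓡 n) M}
    (hp : p.proj ∈ (chartAt (EuclideanSpace ℝ (Fin n)) c).source) (h : p.proj = q.proj)
    (hv : velCoord c p = velCoord c q) : p = q := by
  set e := trivializationAt (EuclideanSpace ℝ (Fin n)) (TangentSpace (𝓡 n)) c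
  have h1 : p ∈ e.source := by rw [e.mem_source]; simpa [e] using hp
  have h2 : q ∈ e.source := by rw [e.mem_source, ← h]; simpa [e] using hp
  refine e.toPartialEquiv.injOn h1 h2 (Prod.ext ?_ hv)
  change (e p).1 = (e q).1
  rw [e.coe_fst h1, e.coe_fst h2, h]

theorem continuousAt_velCoord {c : M} {q : TangentBundle (𝓡 n) M}
    (hq : q.proj ∈ (chartAt (EuclideanSpace ℝ (Fin n)) c).source) : ContinuousAt (velCoord c) q := by
  set e := trivializationAt (EuclideanSpace ℝ (Fin n)) (TangentSpace (𝓡 n)) c with he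
  have h1 : q ∈ e.source := by rw [e.mem_source]; simpa [e] using hq
  exact continuous_snd.continuousAt.comp (e.continuousAt h1)

/-- Smooth bumps detect the topology of M: if b is supported in a given neighbourhood of γ(t), is 1
at γ(t), and b ∘ η is within 1 of b ∘ γ at t, then b(η(t)) ≠ 0 and η(t) lies in the neighbourhood.
-/
theorem continuous_eval {t : ℝ} (ht : t ∈ Icc (0 : ℝ) 1) :
    Continuous (fun γ : H2Path n M => γ.path t) := by
  rw [continuous_iff_continuousAt]
  intro γ s hs
  rw [mem_map]
  obtain ⟨b, hb⟩ := exists_bump_subset (n := n) hs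
  have h := (γ.h2Tendsto b.contMDiff).zero
  rw [Metric.tendstoUniformlyOn_iff] at h
  refine (h 1 one_pos).mono fun η hη => ?_
  have h1 := hη t ht
  refine hb (subset_closure fun h0 => ?_)
  rw [b.eq_one, h0] at h1
  simp at h1

theorem tendsto_cutVel {c : M} (b : SmoothBumpFunction (𝓡 n) c) (γ : H2Path n M) {t : ℝ}
    (ht : t ∈ Icc (0 : ℝ) 1) :
    Tendsto (fun η : H2Path n M => cutVel b η t) (𝓝 γ) (𝓝 (cutVel b γ t)) := by
  refine (PiLp.continuous_toLp 2 _).continuousAt.tendsto.comp (tendsto_pi_nhds.2 fun i => ?_)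
  exact (γ.h2Tendsto (contMDiff_cutChart_apply b i)).one.tendsto_at ht

theorem continuous_jet {t : ℝ} (ht : t ∈ Icc (0 : ℝ) 1) :
    Continuous (jet t : H2Path n M → TangentBundle (𝓡 n) M) := by
  rw [continuous_iff_continuousAt]
  intro γ
  rw [FiberBundle.continuousAt_totalSpace]
  refine ⟨(continuous_eval ht).continuousAt, ?_⟩
  obtain ⟨b⟩ : Nonempty (SmoothBumpFunction (𝓡 n) (γ.path t)) := inferInstance
  have h1 : ∀ᶠ η : H2Path n M in 𝓝 γ, b =ᶠ[𝓝 (η.path t)] 1 :=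
    (continuous_eval ht).continuousAt.eventually (eventually_eventually_nhds.2 b.eventuallyEq_one)
  have h2 : ∀ᶠ η : H2Path n M in 𝓝 γ, cutVel b η t = velCoord (γ.path t) (jet t η) := by
    filter_upwards [h1] with η hη using (velCoord_jet ht hη).symm
  have h3 := (tendsto_cutVel b γ ht).congr' h2
  rw [h2.self_of_nhds] at h3
  exact h3

end Charts

/-! ### Covariance of the acceleration form -/

section AccelForm

variable {n : ℕ}

local notation "𝔼" => EuclideanSpace ℝ (Fin n)

/-- The bilinear form with coefficients `h i j y`. -/
def coeffForm (h : Fin n → Fin n → 𝔼 → ℝ) (y v w : 𝔼) : ℝ := ∑ i, ∑ j, h i j y * (v i * w j)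

/-- The derivative in the direction `z` of the bilinear form with coefficients `h i j y`. -/
def coeffFormDeriv (h : Fin n → Fin n → 𝔼 → ℝ) (y z v w : 𝔼) : ℝ :=
  ∑ i, ∑ j, fderiv ℝ (h i j) y z * (v i * w j)

/-- The covector `w ↦ G(a + Γ(v, v), w)`, written with the derivative of the metric `G`. -/
def accelForm (h : Fin n → Fin n → 𝔼 → ℝ) (y v a w : 𝔼) : ℝ :=
  coeffForm h y a w + coeffFormDeriv h y v v w - (1 / 2 : ℝ) * coeffFormDeriv h y w v v

theorem coeffForm_add_left (h : Fin n → Fin n → 𝔼 → ℝ) (y v v' w : 𝔼) :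
    coeffForm h y (v + v') w = coeffForm h y v w + coeffForm h y v' w := by
  simp only [coeffForm, ← Finset.sum_add_distrib]
  refine Finset.sum_congr rfl fun i _ => Finset.sum_congr rfl fun j _ => ?_
  simp only [PiLp.add_apply]
  ring

theorem hasDerivAt_coeffForm {h : Fin n → Fin n → 𝔼 → ℝ} {y : 𝔼}
    (hh : ∀ i j, DifferentiableAt ℝ (h i j) y)
    {x v w : ℝ → 𝔼} {x' v' w' : 𝔼} (hx : HasDerivAt x x' 0) (hv : HasDerivAt v v' 0)
    (hw : HasDerivAt w w' 0) (h0 : x 0 = y) :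
    HasDerivAt (fun s => coeffForm h (x s) (v s) (w s))
      (coeffFormDeriv h y x' (v 0) (w 0) + coeffForm h y v' (w 0) + coeffForm h y (v 0) w') 0 := by
  have hc : ∀ {v : ℝ → 𝔼} {v' : 𝔼}, HasDerivAt v v' 0 → ∀ i,
      HasDerivAt (fun s => v s i) (v' i) 0 := fun hv i =>
    (EuclideanSpace.proj (𝕜 := ℝ) i).hasFDerivAt.comp_hasDerivAt 0 hv
  have h1 : ∀ i j, HasDerivAt (fun s => h i j (x s)) (fderiv ℝ (h i j) y x') 0 := fun i j => by
    have := (hh i j).hasFDerivAt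
    rw [← h0] at this
    rw [← h0]
    exact this.comp_hasDerivAt 0 hx
  have h2 := HasDerivAt.fun_sum (u := Finset.univ) fun (i : Fin n) _ =>
    HasDerivAt.fun_sum (u := Finset.univ) fun (j : Fin n) _ =>
      (h1 i j).mul ((hc hv i).mul (hc hw j))
  refine HasDerivAt.congr_deriv h2 ?_
  simp only [coeffFormDeriv, coeffForm, ← Finset.sum_add_distrib, h0]
  refine Finset.sum_congr rfl fun i _ => Finset.sum_congr rfl fun j _ => ?_
  simp only [Pi.mul_apply]
  ring

theorem hasDerivAt_clm_line {E F : Type*} [NormedAddCommGroup E] [NormedSpace ℝ E]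
    [NormedAddCommGroup F] [NormedSpace ℝ F] {c : E → E →L[ℝ] F} {y z : E}
    (hc : DifferentiableAt ℝ c y) (v : E) :
    HasDerivAt (fun s : ℝ => c (y + s • z) v) (fderiv ℝ c y z v) 0 := by
  have hl : HasDerivAt (fun s : ℝ => y + s • z) z 0 := by
    simpa using ((hasDerivAt_id (0 : ℝ)).smul_const z).const_add y
  have h1 : HasFDerivAt c (fderiv ℝ c y) (y + (0 : ℝ) • z) := by
    simpa using hc.hasFDerivAt
  have h3 : HasDerivAt (fun s : ℝ => c (y + s • z)) (fderiv ℝ c y z) 0 := h1.comp_hasDerivAt 0 hl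
  simpa using h3.clm_apply (hasDerivAt_const (0 : ℝ) v)

/-- The acceleration covector is natural under changes of coordinates. -/
theorem accelForm_comp {g h : Fin n → Fin n → 𝔼 → ℝ} {φ : 𝔼 → 𝔼} {y : 𝔼}
    (hφ : ContDiffAt ℝ 2 φ y) (hg : ∀ i j, DifferentiableAt ℝ (g i j) y)
    (hh : ∀ i j, DifferentiableAt ℝ (h i j) (φ y))
    (hsymm : ∀ v w, coeffForm h (φ y) v w = coeffForm h (φ y) w v)
    (hgh : ∀ᶠ z in 𝓝 y, ∀ v w,
      coeffForm g z v w = coeffForm h (φ z) (fderiv ℝ φ z v) (fderiv ℝ φ z w)) (v a w : 𝔼) :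
    accelForm g y v a w = accelForm h (φ y) (fderiv ℝ φ y v)
      (fderiv ℝ φ y a + fderiv ℝ (fderiv ℝ φ) y v v) (fderiv ℝ φ y w) := by
  have hD : DifferentiableAt ℝ (fderiv ℝ φ) y :=
    (hφ.fderiv_right (m := 1) (by norm_num)).differentiableAt (by norm_num)
  have hφ1 : HasFDerivAt φ (fderiv ℝ φ y) y :=
    (hφ.differentiableAt (by norm_num)).hasFDerivAt
  have hs : ∀ v w, fderiv ℝ (fderiv ℝ φ) y v w = fderiv ℝ (fderiv ℝ φ) y w v :=
    fun v w => (hφ.isSymmSndFDerivAt (by simp)) v w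
  -- The pull-back identity for the metric is differentiated along the line y + s z at s = 0, with
  -- constant vectors v and w.
  have key : ∀ z v w, coeffFormDeriv g y z v w =
      coeffFormDeriv h (φ y) (fderiv ℝ φ y z) (fderiv ℝ φ y v) (fderiv ℝ φ y w)
        + coeffForm h (φ y) (fderiv ℝ (fderiv ℝ φ) y z v) (fderiv ℝ φ y w)
        + coeffForm h (φ y) (fderiv ℝ φ y v) (fderiv ℝ (fderiv ℝ φ) y z w) := by
    intro z v w
    have hl : HasDerivAt (fun s : ℝ => y + s • z) z 0 := by
      simpa using ((hasDerivAt_id (0 : ℝ)).smul_const z).const_add y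
    have h0 : y + (0 : ℝ) • z = y := by simp
    have hv : ∀ v, HasDerivAt (fun s : ℝ => fderiv ℝ φ (y + s • z) v)
        (fderiv ℝ (fderiv ℝ φ) y z v) 0 :=
      hasDerivAt_clm_line hD
    have hx : HasDerivAt (fun s : ℝ => φ (y + s • z)) (fderiv ℝ φ y z) 0 := by
      have h1 : HasFDerivAt φ (fderiv ℝ φ y) (y + (0 : ℝ) • z) := by rw [h0]; exact hφ1
      exact h1.comp_hasDerivAt 0 hl
    have h1 := hasDerivAt_coeffForm hg hl (hasDerivAt_const (0 : ℝ) v)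
      (hasDerivAt_const (0 : ℝ) w) h0
    have h2 := hasDerivAt_coeffForm hh hx (hv v) (hv w) (by rw [h0])
    have h3 : ∀ᶠ s : ℝ in 𝓝 0, coeffForm g (y + s • z) v w = coeffForm h (φ (y + s • z))
        (fderiv ℝ φ (y + s • z) v) (fderiv ℝ φ (y + s • z) w) := by
      have : Tendsto (fun s : ℝ => y + s • z) (𝓝 0) (𝓝 y) := by
        have := hl.continuousAt.tendsto
        rwa [h0] at this
      exact (this.eventually hgh).mono fun s hs => hs v w
    have h4 := (h2.congr_of_eventuallyEq h3).unique h1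
    simp only [h0] at h4
    have h5 : ∀ v w, coeffForm g y 0 w = 0 ∧ coeffForm g y v 0 = 0 := by
      intro v w
      simp [coeffForm]
    rw [(h5 v w).1, (h5 v w).2] at h4
    linarith
  unfold accelForm
  -- Of the terms in D²φ, h(Dφ v, D²φ(v, w)) occurs once with coefficient 1 and twice with
  -- coefficient -1/2, and cancels by symmetry. What remains is h(D²φ(v, v), Dφ w), the correction
  -- to the acceleration.
  rw [key v v w, key w v v, hgh.self_of_nhds a w, hs w v,
    hsymm (fderiv ℝ (fderiv ℝ φ) y v w), coeffForm_add_left]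
  ring

end AccelForm

/-! ### The metric in a chart -/

section Metric

variable {n : ℕ} {M : Type*} [TopologicalSpace M] [ChartedSpace (EuclideanSpace ℝ (Fin n)) M]
  [IsManifold (𝓡 n) ∞ M] [T2Space M]

theorem mfderivWithin_range_eq (c : M) (y : EuclideanSpace ℝ (Fin n)) :
    mfderivWithin 𝓘(ℝ, EuclideanSpace ℝ (Fin n)) (𝓡 n) (extChartAt (𝓡 n) c).symm (range (𝓡 n)) y
      = mfderiv 𝓘(ℝ, EuclideanSpace ℝ (Fin n)) (𝓡 n) (extChartAt (𝓡 n) c).symm y := by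
  rw [(𝓡 n).range_eq_univ, mfderivWithin_univ]

theorem extChartAt_symm_mem_chart_source {c : M} {y : EuclideanSpace ℝ (Fin n)}
    (hy : y ∈ (extChartAt (𝓡 n) c).target) :
    (extChartAt (𝓡 n) c).symm y ∈ (chartAt (EuclideanSpace ℝ (Fin n)) c).source := by
  rw [← extChartAt_source (𝓡 n)]
  exact (extChartAt (𝓡 n) c).map_target hy

theorem velCoord_mfderiv_symm {c : M} {y : EuclideanSpace ℝ (Fin n)}
    (hy : y ∈ (extChartAt (𝓡 n) c).target) (v : EuclideanSpace ℝ (Fin n)) :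
    velCoord c ⟨(extChartAt (𝓡 n) c).symm y,
      mfderiv 𝓘(ℝ, EuclideanSpace ℝ (Fin n)) (𝓡 n) (extChartAt (𝓡 n) c).symm y v⟩ = v := by
  have : IsManifold (𝓡 n) 1 M := IsManifold.of_le (n := ∞) (by norm_cast)
  rw [velCoord_eq_mfderiv (extChartAt_symm_mem_chart_source hy)]
  have h := mfderiv_extChartAt_comp_mfderivWithin_extChartAt_symm (I := 𝓡 n) hy
  rw [mfderivWithin_range_eq] at h
  exact congrArg (fun L => L v) h

theorem mfderiv_symm_velCoord {c : M} {y : EuclideanSpace ℝ (Fin n)}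
    (hy : y ∈ (extChartAt (𝓡 n) c).target) (V : TangentSpace (𝓡 n) ((extChartAt (𝓡 n) c).symm y)) :
    mfderiv 𝓘(ℝ, EuclideanSpace ℝ (Fin n)) (𝓡 n) (extChartAt (𝓡 n) c).symm y
      (velCoord c ⟨(extChartAt (𝓡 n) c).symm y, V⟩) = V := by
  have : IsManifold (𝓡 n) 1 M := IsManifold.of_le (n := ∞) (by norm_cast)
  rw [velCoord_eq_mfderiv (extChartAt_symm_mem_chart_source hy)]
  have h := mfderivWithin_extChartAt_symm_comp_mfderiv_extChartAt (I := 𝓡 n) hy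
  rw [mfderivWithin_range_eq] at h
  exact congrArg (fun L => L V) h

theorem contMDiffOn_coordVec (c : M) (i : Fin n) :
    ContMDiffOn 𝓘(ℝ, EuclideanSpace ℝ (Fin n)) ((𝓡 n).prod 𝓘(ℝ, EuclideanSpace ℝ (Fin n))) ∞
      (fun y => (⟨(extChartAt (𝓡 n) c).symm y, coordVec c y i⟩ : TangentBundle (𝓡 n) M))
      (extChartAt (𝓡 n) c).target := by
  set e := trivializationAt (EuclideanSpace ℝ (Fin n)) (TangentSpace (𝓡 n) (M := M)) c with he
  refine (e.contMDiffOn_iff (IB := 𝓡 n) (fun y hy => ?_)).2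
    ⟨contMDiffOn_extChartAt_symm c, ?_⟩
  · rw [e.mem_source]
    simpa [he] using extChartAt_symm_mem_chart_source hy
  · refine (contMDiffOn_const (c := EuclideanSpace.single i (1 : ℝ))).congr fun y hy => ?_
    exact velCoord_mfderiv_symm hy _

theorem contDiffOn_metricCoeff (g : RMetric n M) (c : M) (i j : Fin n) :
    ContDiffOn ℝ ∞ (fun y => metricCoeff g c y i j) (extChartAt (𝓡 n) c).target := by
  rw [← contMDiffOn_iff_contDiffOn]
  have h := ContMDiffOn.clm_bundle_apply₂ (IB := 𝓡 n) (F₁ := EuclideanSpace ℝ (Fin n))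
    (F₂ := EuclideanSpace ℝ (Fin n)) (F₃ := ℝ) (E₃ := Bundle.Trivial M ℝ)
    (g.contMDiff.comp_contMDiffOn (contMDiffOn_extChartAt_symm c))
    (contMDiffOn_coordVec c i) (contMDiffOn_coordVec c j)
  intro y hy
  have h1 := h y hy
  simp only [Bundle.contMDiffWithinAt_totalSpace] at h1
  exact h1.2

/-- The metric in the chart at `c`, as a bilinear form on the model space. -/
def formAt (g : RMetric n M) (c : M) (y v w : EuclideanSpace ℝ (Fin n)) : ℝ :=
  coeffForm (fun i j y => metricCoeff g c y i j) y v w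

theorem formAt_apply (g : RMetric n M) (c : M) (y v w : EuclideanSpace ℝ (Fin n)) :
    formAt g c y v w = ∑ i, ∑ j, metricCoeff g c y i j * (v i * w j) := rfl

theorem isOpen_target (c : M) : IsOpen (extChartAt (𝓡 n) c).target := isOpen_extChartAt_target c

theorem differentiableAt_metricCoeff (g : RMetric n M) {c : M} {y : EuclideanSpace ℝ (Fin n)}
    (hy : y ∈ (extChartAt (𝓡 n) c).target) (i j : Fin n) :
    DifferentiableAt ℝ (fun y => metricCoeff g c y i j) y :=
  ((contDiffOn_metricCoeff g c i j).contDiffAt ((isOpen_target c).mem_nhds hy)).differentiableAt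
    (by simp)

theorem sum_smul_single (v : EuclideanSpace ℝ (Fin n)) :
    ∑ i, v i • EuclideanSpace.single i (1 : ℝ) = v := by
  simpa using (EuclideanSpace.basisFun (Fin n) ℝ).sum_repr v

theorem formAt_velCoord (g : RMetric n M) {c x : M}
    (hx : x ∈ (chartAt (EuclideanSpace ℝ (Fin n)) c).source) (V W : TangentSpace (𝓡 n) x) :
    formAt g c (extChartAt (𝓡 n) c x) (velCoord c ⟨x, V⟩) (velCoord c ⟨x, W⟩) = g.inner x V W := by
  rw [← extChartAt_source (𝓡 n)] at hx
  obtain ⟨y, hy, rfl⟩ : ∃ y ∈ (extChartAt (𝓡 n) c).target, x = (extChartAt (𝓡 n) c).symm y :=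
    ⟨_, (extChartAt (𝓡 n) c).map_source hx, ((extChartAt (𝓡 n) c).left_inv hx).symm⟩
  rw [(extChartAt (𝓡 n) c).right_inv hy]
  set v := velCoord c ⟨_, V⟩ with hv
  set w := velCoord c ⟨_, W⟩ with hw
  have key : ∀ v : EuclideanSpace ℝ (Fin n), ∑ i, v i • coordVec c y i =
      mfderiv 𝓘(ℝ, EuclideanSpace ℝ (Fin n)) (𝓡 n) (extChartAt (𝓡 n) c).symm y v := by
    intro v
    conv_rhs => rw [← sum_smul_single v]
    exact (map_sum _ _ _).trans (Finset.sum_congr rfl fun i _ => map_smul _ _ _) |>.symm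
  have hV : V = ∑ i, v i • coordVec c y i := by rw [key, hv, mfderiv_symm_velCoord hy]
  have hW : W = ∑ i, w i • coordVec c y i := by rw [key, hw, mfderiv_symm_velCoord hy]
  rw [formAt_apply]
  conv_rhs => rw [hV, hW]
  simp only [map_sum, map_smul, sum_apply, smul_apply,
    smul_eq_mul, Finset.mul_sum, metricCoeff, Matrix.of_apply]
  refine (Finset.sum_comm).trans (Finset.sum_congr rfl fun i _ => Finset.sum_congr rfl fun j _ => ?_)
  ring

theorem exists_velCoord_eq {c x : M}
    (hx : x ∈ (chartAt (EuclideanSpace ℝ (Fin n)) c).source) (v : EuclideanSpace ℝ (Fin n)) :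
    ∃ V : TangentSpace (𝓡 n) x, velCoord c ⟨x, V⟩ = v := by
  rw [← extChartAt_source (𝓡 n)] at hx
  obtain ⟨y, hy, rfl⟩ : ∃ y ∈ (extChartAt (𝓡 n) c).target, x = (extChartAt (𝓡 n) c).symm y :=
    ⟨_, (extChartAt (𝓡 n) c).map_source hx, ((extChartAt (𝓡 n) c).left_inv hx).symm⟩
  exact ⟨_, velCoord_mfderiv_symm hy v⟩

theorem velCoord_smul_zero (c x : M) (hx : x ∈ (chartAt (EuclideanSpace ℝ (Fin n)) c).source) :
    velCoord (n := n) c ⟨x, (0 : TangentSpace (𝓡 n) x)⟩ = 0 := by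
  rw [velCoord_eq_mfderiv hx]
  exact map_zero _

theorem formAt_symm (g : RMetric n M) {c : M} {y : EuclideanSpace ℝ (Fin n)}
    (v w : EuclideanSpace ℝ (Fin n)) : formAt g c y v w = formAt g c y w v := by
  rw [formAt_apply, formAt_apply, Finset.sum_comm]
  refine Finset.sum_congr rfl fun i _ => Finset.sum_congr rfl fun j _ => ?_
  simp only [metricCoeff, Matrix.of_apply]
  rw [g.symm, mul_comm (v j)]

/-- A vector in the kernel of the matrix would represent a nonzero tangent vector of length zero. -/
theorem isUnit_det_metricCoeff (g : RMetric n M) {c : M} {y : EuclideanSpace ℝ (Fin n)}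
    (hy : y ∈ (extChartAt (𝓡 n) c).target) : IsUnit (metricCoeff g c y).det := by
  rw [isUnit_iff_ne_zero]
  intro h0
  obtain ⟨v, hv, hmv⟩ := Matrix.exists_mulVec_eq_zero_iff.2 h0
  have hx := extChartAt_symm_mem_chart_source hy
  obtain ⟨V, hV⟩ := exists_velCoord_eq hx (WithLp.toLp 2 v)
  have h1 := formAt_velCoord g hx V V
  rw [(extChartAt (𝓡 n) c).right_inv hy, hV, formAt_apply] at h1
  have h2 : ∑ i, ∑ j, metricCoeff g c y i j * (v i * v j) = 0 := by
    have : ∀ i, ∑ j, metricCoeff g c y i j * (v i * v j) = v i * (metricCoeff g c y).mulVec v i := by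
      intro i
      simp only [Matrix.mulVec, dotProduct, Finset.mul_sum]
      exact Finset.sum_congr rfl fun j _ => by ring
    simp [this, hmv]
  have h3 : V ≠ 0 := by
    rintro rfl
    rw [velCoord_smul_zero c _ hx] at hV
    exact hv (by simpa using congrArg WithLp.ofLp hV.symm)
  have h4 := g.pos _ V h3
  rw [← h1] at h4
  exact h4.ne' h2

/-- The transition map from the chart at `c` to the chart at `q`. -/
def transition (c q : M) (y : EuclideanSpace ℝ (Fin n)) : EuclideanSpace ℝ (Fin n) :=
  extChartAt (𝓡 n) q ((extChartAt (𝓡 n) c).symm y)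

theorem contDiffAt_transition {c q x : M}
    (hc : x ∈ (chartAt (EuclideanSpace ℝ (Fin n)) c).source)
    (hq : x ∈ (chartAt (EuclideanSpace ℝ (Fin n)) q).source) :
    ContDiffAt ℝ ∞ (transition (n := n) c q) (extChartAt (𝓡 n) c x) := by
  rw [← contMDiffAt_iff_contDiffAt]
  have hx : x ∈ (extChartAt (𝓡 n) c).source := by rwa [extChartAt_source]
  have h1 : ContMDiffAt 𝓘(ℝ, EuclideanSpace ℝ (Fin n)) (𝓡 n) ∞ (extChartAt (𝓡 n) c).symm
      (extChartAt (𝓡 n) c x) :=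
    (contMDiffOn_extChartAt_symm c).contMDiffAt
      ((isOpen_target c).mem_nhds ((extChartAt (𝓡 n) c).map_source hx))
  refine ContMDiffAt.comp (I' := 𝓡 n) _ ?_ h1
  rw [(extChartAt (𝓡 n) c).left_inv hx]
  exact contMDiffAt_extChartAt' hq

theorem velCoord_transition {c q x : M}
    (hc : x ∈ (chartAt (EuclideanSpace ℝ (Fin n)) c).source)
    (hq : x ∈ (chartAt (EuclideanSpace ℝ (Fin n)) q).source) (V : TangentSpace (𝓡 n) x) :
    velCoord q ⟨x, V⟩ =
      fderiv ℝ (transition (n := n) c q) (extChartAt (𝓡 n) c x) (velCoord c ⟨x, V⟩) := by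
  have : IsManifold (𝓡 n) 1 M := IsManifold.of_le (n := ∞) (by norm_cast)
  rw [velCoord_eq_mfderiv (q := ⟨x, V⟩) hc, velCoord_eq_mfderiv (q := ⟨x, V⟩) hq,
    ← mfderiv_eq_fderiv]
  have h1 : MDifferentiableAt 𝓘(ℝ, EuclideanSpace ℝ (Fin n)) 𝓘(ℝ, EuclideanSpace ℝ (Fin n))
      (transition (n := n) c q) (extChartAt (𝓡 n) c x) :=
    ((contDiffAt_transition hc hq).differentiableAt (by simp)).mdifferentiableAt
  have h2 := mfderiv_comp (I' := 𝓘(ℝ, EuclideanSpace ℝ (Fin n))) x h1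
    (mdifferentiableAt_extChartAt (I := 𝓡 n) hc)
  have h3 : transition (n := n) c q ∘ extChartAt (𝓡 n) c =ᶠ[𝓝 x] extChartAt (𝓡 n) q := by
    filter_upwards [(chartAt (EuclideanSpace ℝ (Fin n)) c).open_source.mem_nhds hc] with z hz
    rw [← extChartAt_source (𝓡 n)] at hz
    simp only [Function.comp, transition]
    rw [(extChartAt (𝓡 n) c).left_inv hz]
  have h4 := h3.mfderiv_eq (I := 𝓡 n) (I' := 𝓘(ℝ, EuclideanSpace ℝ (Fin n)))
  exact congrArg (fun L => L V) (h4.symm.trans h2)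

theorem formAt_transition (g : RMetric n M) {c q x : M}
    (hc : x ∈ (chartAt (EuclideanSpace ℝ (Fin n)) c).source)
    (hq : x ∈ (chartAt (EuclideanSpace ℝ (Fin n)) q).source) (v w : EuclideanSpace ℝ (Fin n)) :
    formAt g c (extChartAt (𝓡 n) c x) v w = formAt g q (extChartAt (𝓡 n) q x)
      (fderiv ℝ (transition (n := n) c q) (extChartAt (𝓡 n) c x) v)
      (fderiv ℝ (transition (n := n) c q) (extChartAt (𝓡 n) c x) w) := by
  obtain ⟨V, rfl⟩ := exists_velCoord_eq hc v
  obtain ⟨W, rfl⟩ := exists_velCoord_eq hc w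
  rw [← velCoord_transition hc hq, ← velCoord_transition hc hq, formAt_velCoord g hc,
    formAt_velCoord g hq]

end Metric

/-! ### The energy density in a chart -/

section Density

variable {n : ℕ} {M : Type*} [TopologicalSpace M] [ChartedSpace (EuclideanSpace ℝ (Fin n)) M]
  [IsManifold (𝓡 n) ∞ M] [T2Space M]

/-- The Christoffel symbols in the chart at `c`, at the point with coordinates `y`. -/
def christoffelAt (g : RMetric n M) (c : M) (y : EuclideanSpace ℝ (Fin n)) (k i j : Fin n) : ℝ :=
  (1 / 2 : ℝ) * ∑ l, (metricCoeff g c y)⁻¹ k l *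
    (pderiv (fun y => metricCoeff g c y j l) i y + pderiv (fun y => metricCoeff g c y i l) j y
      - pderiv (fun y => metricCoeff g c y i j) l y)

/-- The covariant acceleration in the chart at `c`. -/
def accelAt (g : RMetric n M) (c : M) (y v a : EuclideanSpace ℝ (Fin n)) :
    EuclideanSpace ℝ (Fin n) :=
  a + WithLp.toLp 2 fun k => ∑ i, ∑ j, christoffelAt g c y k i j * v i * v j

/-- Lowering the index cancels the inverse metric in the Christoffel symbols. The result is a
covector containing only the metric and its first derivatives, to which `accelForm_comp` applies. -/
theorem formAt_accelAt (g : RMetric n M) {c : M} {y : EuclideanSpace ℝ (Fin n)}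
    (hy : y ∈ (extChartAt (𝓡 n) c).target) (v a w : EuclideanSpace ℝ (Fin n)) :
    formAt g c y (accelAt g c y v a) w =
      accelForm (fun i j y => metricCoeff g c y i j) y v a w := by
  set m := metricCoeff g c y with hm
  set P : Fin n → Fin n → Fin n → ℝ := fun i j l => pderiv (fun y => metricCoeff g c y j l) i y
    with hP
  set S : Fin n → ℝ := fun l => ∑ i, ∑ j, (1 / 2 : ℝ) * (P i j l + P j i l - P l i j) * v i * v j
    with hS
  have hΓ : (fun k => ∑ i, ∑ j, christoffelAt g c y k i j * v i * v j) = m⁻¹.mulVec S := by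
    ext k
    simp only [Matrix.mulVec, dotProduct, hS, Finset.mul_sum, christoffelAt, Finset.sum_mul]
    conv_rhs => rw [Finset.sum_comm]
    refine Finset.sum_congr rfl fun i _ => ?_
    conv_rhs => rw [Finset.sum_comm]
    refine Finset.sum_congr rfl fun j _ => Finset.sum_congr rfl fun l _ => ?_
    simp only [hP]
    ring
  have hsymm : m.transpose = m := by
    ext i j
    simp only [hm, metricCoeff, Matrix.transpose_apply, Matrix.of_apply]
    exact g.symm _ _ _
  have h1 : m.mulVec (m⁻¹.mulVec S) = S := by
    rw [Matrix.mulVec_mulVec, Matrix.mul_nonsing_inv _ (isUnit_det_metricCoeff g hy),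
      Matrix.one_mulVec]
  have h2 : formAt g c y (WithLp.toLp 2 (m⁻¹.mulVec S)) w = ∑ l, S l * w l := by
    rw [formAt_apply, Finset.sum_comm]
    refine Finset.sum_congr rfl fun l _ => ?_
    conv_rhs => rw [← h1]
    rw [Matrix.mulVec, dotProduct, Finset.sum_mul]
    refine Finset.sum_congr rfl fun k _ => ?_
    have : metricCoeff g c y k l = m l k := congrFun (congrFun hsymm l) k
    rw [this]
    ring
  have hd : ∀ i j z, fderiv ℝ (fun y => metricCoeff g c y i j) y z = ∑ k, P k i j * z k :=
    fun i j z => fderiv_apply_eq_sum _ _ _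
  rw [accelAt, hΓ, formAt, coeffForm_add_left]
  change _ + formAt g c y _ w = _
  rw [h2, accelForm, add_sub_assoc]
  congr 1
  have hA : ∑ l, ∑ i, ∑ j, P i j l * v i * v j * w l = coeffFormDeriv
      (fun i j y => metricCoeff g c y i j) y v v w := by
    simp only [coeffFormDeriv, hd, Finset.sum_mul]
    conv_rhs => rw [Finset.sum_comm]
    refine Finset.sum_congr rfl fun l _ => ?_
    rw [Finset.sum_comm]
    exact Finset.sum_congr rfl fun i _ => Finset.sum_congr rfl fun j _ => by ring
  -- Since v_i v_j is symmetric, the first two Christoffel terms contribute equally, which turns the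
  -- factor 1/2 into 1 for the derivative in the direction v.
  have hB : ∑ l, ∑ i, ∑ j, P j i l * v i * v j * w l = ∑ l, ∑ i, ∑ j, P i j l * v i * v j * w l := by
    refine Finset.sum_congr rfl fun l _ => ?_
    rw [Finset.sum_comm]
    exact Finset.sum_congr rfl fun i _ => Finset.sum_congr rfl fun j _ => by ring
  have hC : ∑ l, ∑ i, ∑ j, P l i j * v i * v j * w l = coeffFormDeriv
      (fun i j y => metricCoeff g c y i j) y w v v := by
    simp only [coeffFormDeriv, hd, Finset.sum_mul]
    rw [Finset.sum_comm]
    refine Finset.sum_congr rfl fun i _ => ?_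
    rw [Finset.sum_comm]
    exact Finset.sum_congr rfl fun i _ => Finset.sum_congr rfl fun j _ => by ring
  have hL : ∑ l, S l * w l = 1 / 2 * ∑ l, ∑ i, ∑ j, P i j l * v i * v j * w l
      + 1 / 2 * ∑ l, ∑ i, ∑ j, P j i l * v i * v j * w l
      - 1 / 2 * ∑ l, ∑ i, ∑ j, P l i j * v i * v j * w l := by
    simp only [hS, Finset.sum_mul, Finset.mul_sum, ← Finset.sum_add_distrib,
      ← Finset.sum_sub_distrib]
    exact Finset.sum_congr rfl fun l _ => Finset.sum_congr rfl fun i _ =>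
      Finset.sum_congr rfl fun j _ => by ring
  rw [hL, hB, hC, hA]
  ring

/-- The energy density in the chart at `c`. -/
def densityAt (g : RMetric n M) (c : M) (y v a : EuclideanSpace ℝ (Fin n)) : ℝ :=
  formAt g c y (accelAt g c y v a) (accelAt g c y v a)

/-- The energy density does not depend on the chart. -/
theorem densityAt_transition (g : RMetric n M) {c q x : M}
    (hc : x ∈ (chartAt (EuclideanSpace ℝ (Fin n)) c).source)
    (hq : x ∈ (chartAt (EuclideanSpace ℝ (Fin n)) q).source) (v a : EuclideanSpace ℝ (Fin n)) :
    densityAt g c (extChartAt (𝓡 n) c x) v a = densityAt g q (extChartAt (𝓡 n) q x)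
      (fderiv ℝ (transition (n := n) c q) (extChartAt (𝓡 n) c x) v)
      (fderiv ℝ (transition (n := n) c q) (extChartAt (𝓡 n) c x) a +
        fderiv ℝ (fderiv ℝ (transition (n := n) c q)) (extChartAt (𝓡 n) c x) v v) := by
  set y := extChartAt (𝓡 n) c x with hy
  set φ := transition (n := n) c q with hφ
  have hxc : x ∈ (extChartAt (𝓡 n) c).source := by rwa [extChartAt_source]
  have hxq : x ∈ (extChartAt (𝓡 n) q).source := by rwa [extChartAt_source]
  have hyt : y ∈ (extChartAt (𝓡 n) c).target := (extChartAt (𝓡 n) c).map_source hxc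
  have hφy : φ y = extChartAt (𝓡 n) q x := by
    rw [hφ, transition, hy, (extChartAt (𝓡 n) c).left_inv hxc]
  have hqt : φ y ∈ (extChartAt (𝓡 n) q).target := by
    rw [hφy]; exact (extChartAt (𝓡 n) q).map_source hxq
  rw [← hφy]
  have hev : ∀ᶠ z in 𝓝 y, ∀ v w, coeffForm (fun i j y => metricCoeff g c y i j) z v w =
      coeffForm (fun i j y => metricCoeff g q y i j) (φ z) (fderiv ℝ φ z v) (fderiv ℝ φ z w) := by
    have h1 : ∀ᶠ z in 𝓝 y, (extChartAt (𝓡 n) c).symm z ∈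
        (chartAt (EuclideanSpace ℝ (Fin n)) q).source := by
      have h2 : ContinuousAt (extChartAt (𝓡 n) c).symm y := continuousAt_extChartAt_symm'' hyt
      refine h2.eventually ((chartAt (EuclideanSpace ℝ (Fin n)) q).open_source.mem_nhds ?_)
      rwa [hy, (extChartAt (𝓡 n) c).left_inv hxc]
    filter_upwards [h1, (isOpen_target c).mem_nhds hyt] with z hz hzt v w
    have h3 := formAt_transition g (extChartAt_symm_mem_chart_source hzt) hz v w
    rw [(extChartAt (𝓡 n) c).right_inv hzt] at h3
    exact h3
  have key : ∀ w, formAt g q (φ y) (accelAt g q (φ y) (fderiv ℝ φ y v)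
      (fderiv ℝ φ y a + fderiv ℝ (fderiv ℝ φ) y v v)) (fderiv ℝ φ y w) =
      formAt g q (φ y) (fderiv ℝ φ y (accelAt g c y v a)) (fderiv ℝ φ y w) := by
    intro w
    rw [formAt_accelAt g hqt, ← accelForm_comp
      ((contDiffAt_transition hc hq).of_le (by norm_cast)) (differentiableAt_metricCoeff g hyt)
      (differentiableAt_metricCoeff g hqt) (formAt_symm g) hev, ← formAt_accelAt g hyt]
    exact hev.self_of_nhds _ _
  have hsurj : ∀ e, ∃ w, fderiv ℝ φ y w = e := by
    intro e
    obtain ⟨V, rfl⟩ := exists_velCoord_eq hq e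
    exact ⟨_, (velCoord_transition hc hq V).symm⟩
  -- Let A be the acceleration in the chart at c and A' the one in the chart at q. By `key`, A' and
  -- Dφ A have equal pairings with the range of Dφ, which contains both of them. Pairing with A',
  -- then with Dφ A, gives G(A', A') = G(Dφ A, Dφ A).
  obtain ⟨w, hw⟩ := hsurj (accelAt g q (φ y) (fderiv ℝ φ y v)
      (fderiv ℝ φ y a + fderiv ℝ (fderiv ℝ φ) y v v))
  have h1 := key w
  have h2 := key (accelAt g c y v a)
  rw [hw] at h1
  unfold densityAt
  rw [h1, formAt_symm g (fderiv ℝ φ y (accelAt g c y v a)), h2]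
  exact hev.self_of_nhds _ _

/-- Acceleration in the chart at `c` of a curve along which the bump function is locally `1`. -/
def cutAcc {c : M} (b : SmoothBumpFunction (𝓡 n) c) (γ : H2Path n M) (t : ℝ) :
    EuclideanSpace ℝ (Fin n) :=
  WithLp.toLp 2 fun i => d2 (fun s => cutChart b (γ.path s) i) t

theorem hasDerivAt_clm_comp {E F : Type*} [NormedAddCommGroup E] [NormedSpace ℝ E]
    [NormedAddCommGroup F] [NormedSpace ℝ F] {c : E → E →L[ℝ] F} {x v : ℝ → E} {x' v' : E} {t : ℝ}
    (hc : DifferentiableAt ℝ c (x t)) (hx : HasDerivAt x x' t) (hv : HasDerivAt v v' t) :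
    HasDerivAt (fun s : ℝ => c (x s) (v s)) (c (x t) v' + fderiv ℝ c (x t) x' (v t)) t := by
  have h3 : HasDerivAt (fun s : ℝ => c (x s)) (fderiv ℝ c (x t) x') t :=
    hc.hasFDerivAt.comp_hasDerivAt t hx
  rw [add_comm]
  exact h3.clm_apply hv

theorem hasDerivAt_euclidean {u : ℝ → EuclideanSpace ℝ (Fin n)} {a : EuclideanSpace ℝ (Fin n)}
    {t : ℝ} (h : ∀ i, HasDerivAt (fun t => u t i) (a i) t) : HasDerivAt u a t := by
  rw [← hasDerivWithinAt_univ]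
  exact hasDerivWithinAt_euclidean fun i => (h i).hasDerivWithinAt

/-- `covAccel` uses the chart at γ(t), which changes with t. Near t the coordinates in it are φ ∘ x,
where x are the coordinates in the fixed chart at c and φ is the transition map. The chain rule
gives (φ ∘ x)'' = Dφ(x'') + D²φ(x', x'), exactly the transformation under which the density is
invariant. -/
theorem covAccel_density (g : RMetric n M) {c : M} {b : SmoothBumpFunction (𝓡 n) c}
    {γ : H2Path n M} {t : ℝ} (ht : t ∈ Ioo (0 : ℝ) 1) (hb : b =ᶠ[𝓝 (γ.path t)] 1)
    (h : ∀ i, HasDerivAt (d1 fun s => cutChart b (γ.path s) i)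
      (d2 (fun s => cutChart b (γ.path s) i) t) t) :
    g.inner (γ.path t) (covAccel g γ t) (covAccel g γ t) =
      densityAt g c (cutChart b (γ.path t)) (cutVel b γ t) (cutAcc b γ t) := by
  have hc := mem_chart_source_of_eventuallyEq_one hb
  have hq := mem_chart_source (EuclideanSpace ℝ (Fin n)) (γ.path t)
  set q := γ.path t with hqdef
  set u : ℝ → EuclideanSpace ℝ (Fin n) := fun s => extChartAt (𝓡 n) q (γ.path s) with hu
  set x : ℝ → EuclideanSpace ℝ (Fin n) := fun s => cutChart b (γ.path s) with hx
  set φ := transition (n := n) c q with hφ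
  have hxt : x t = extChartAt (𝓡 n) c q := (cutChart_eventuallyEq hb).self_of_nhds
  have hφt : ContDiffAt ℝ ∞ φ (x t) := by rw [hxt]; exact contDiffAt_transition hc hq
  have hcont := γ.continuous_path.tendsto t
  have hux : ∀ᶠ s in 𝓝 t, u s = φ (x s) := by
    filter_upwards [hcont.eventually (cutChart_eventuallyEq hb),
      hcont.eventually ((chartAt (EuclideanSpace ℝ (Fin n)) c).open_source.mem_nhds hc)]
      with s h1 h2
    rw [← extChartAt_source (𝓡 n)] at h2
    simp only [hu, hx, hφ, transition, h1]
    rw [(extChartAt (𝓡 n) c).left_inv h2]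
  have hx1 : ∀ s ∈ Ioo (0 : ℝ) 1, HasDerivAt x (cutVel b γ s) s := fun s hs =>
    hasDerivAt_euclidean fun i => ((isH2_cutChart b γ i).hasDerivWithinAt
      (Ioo_subset_Icc_self hs)).hasDerivAt (Icc_mem_nhds hs.1 hs.2)
  have hx2 : HasDerivAt (cutVel b γ) (cutAcc b γ t) t := hasDerivAt_euclidean h
  have hxc : ContinuousAt x t := (hx1 t ht).continuousAt
  have hφs : ∀ᶠ s in 𝓝 t, DifferentiableAt ℝ φ (x s) := by
    have h1 : ∀ᶠ z in 𝓝 (x t), ContDiffAt ℝ 1 φ z :=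
      (hφt.of_le (m := 1) (by norm_cast)).eventually (by simp)
    exact (hxc.eventually h1).mono fun s hs => hs.differentiableAt (by simp)
  have hu1 : ∀ᶠ s in 𝓝 t, HasDerivAt u (fderiv ℝ φ (x s) (cutVel b γ s)) s := by
    filter_upwards [hφs, hux.eventually_nhds, Ioo_mem_nhds ht.1 ht.2] with s h1 h2 h3
    exact (h1.hasFDerivAt.comp_hasDerivAt s (hx1 s h3)).congr_of_eventuallyEq h2
  have hn := Icc_mem_nhds ht.1 ht.2
  have e1 : derivWithin u (Icc 0 1) t = fderiv ℝ φ (x t) (cutVel b γ t) := by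
    rw [derivWithin_of_mem_nhds hn, hu1.self_of_nhds.deriv]
  have e2 : iteratedDerivWithin 2 u (Icc 0 1) t = fderiv ℝ φ (x t) (cutAcc b γ t)
      + fderiv ℝ (fderiv ℝ φ) (x t) (cutVel b γ t) (cutVel b γ t) := by
    rw [show (2 : ℕ) = 1 + 1 from rfl, iteratedDerivWithin_succ, iteratedDerivWithin_one,
      derivWithin_of_mem_nhds hn]
    have hD : DifferentiableAt ℝ (fderiv ℝ φ) (x t) :=
      (hφt.fderiv_right (m := 1) (by norm_cast)).differentiableAt (by norm_num)
    have h1 := hasDerivAt_clm_comp hD (hx1 t ht) hx2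
    refine (h1.congr_of_eventuallyEq ?_).deriv
    filter_upwards [hu1, Ioo_mem_nhds ht.1 ht.2] with s h1 h2
    rw [derivWithin_of_mem_nhds (Icc_mem_nhds h2.1 h2.2), h1.deriv]
  change _ = densityAt g c (x t) _ _
  rw [hxt, densityAt_transition g hc hq, ← hxt, ← e1, ← e2]
  -- In its own chart the fibre coordinate of a tangent vector at q is the vector itself.
  have hv : ∀ V : TangentSpace (𝓡 n) q, velCoord q ⟨q, V⟩ = V := by
    intro V
    have : IsManifold (𝓡 n) 1 M := IsManifold.of_le (n := ∞) (by norm_cast)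
    rw [velCoord_eq_mfderiv (q := ⟨q, V⟩) hq]
    exact congrArg (fun L => L V) (mfderiv_extChartAt_self (I := 𝓡 n) (x := q))
  have h3 := formAt_velCoord g hq (covAccel g γ t) (covAccel g γ t)
  rw [hv] at h3
  rw [← h3]
  rfl

/-! ### Continuity of the energy -/

theorem continuousOn_metricCoeff (g : RMetric n M) (c : M) (i j : Fin n) :
    ContinuousOn (fun y => metricCoeff g c y i j) (extChartAt (𝓡 n) c).target :=
  (contDiffOn_metricCoeff g c i j).continuousOn

theorem continuousOn_pderiv_metricCoeff (g : RMetric n M) (c : M) (i j k : Fin n) :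
    ContinuousOn (pderiv (fun y => metricCoeff g c y i j) k) (extChartAt (𝓡 n) c).target :=
  ((contDiffOn_metricCoeff g c i j).continuousOn_fderiv_of_isOpen (isOpen_target c)
    (by norm_cast)).clm_apply continuousOn_const

theorem continuousOn_metricCoeff_inv (g : RMetric n M) (c : M) (i j : Fin n) :
    ContinuousOn (fun y => (metricCoeff g c y)⁻¹ i j) (extChartAt (𝓡 n) c).target := by
  have hm : ContinuousOn (fun y => metricCoeff g c y) (extChartAt (𝓡 n) c).target :=
    continuousOn_pi.2 fun i => continuousOn_pi.2 fun j => continuousOn_metricCoeff g c i j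
  have hdet : ContinuousOn (fun y => (metricCoeff g c y).det) (extChartAt (𝓡 n) c).target :=
    (Continuous.matrix_det continuous_id).comp_continuousOn hm
  have hadj : ContinuousOn (fun y => (metricCoeff g c y).adjugate i j)
      (extChartAt (𝓡 n) c).target :=
    ((Continuous.matrix_adjugate continuous_id).matrix_elem i j).comp_continuousOn hm
  refine ((hdet.inv₀ fun y hy => (isUnit_det_metricCoeff g hy).ne_zero).mul hadj).congr
    fun y hy => ?_
  simp [Matrix.inv_def]

theorem continuousOn_christoffelAt (g : RMetric n M) (c : M) (k i j : Fin n) :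
    ContinuousOn (fun y => christoffelAt g c y k i j) (extChartAt (𝓡 n) c).target := by
  unfold christoffelAt
  refine continuousOn_const.mul (continuousOn_finsetSum _ fun l _ => ?_)
  exact (continuousOn_metricCoeff_inv g c k l).mul
    (((continuousOn_pderiv_metricCoeff g c j l i).add
      (continuousOn_pderiv_metricCoeff g c i l j)).sub (continuousOn_pderiv_metricCoeff g c i j l))

/-- The energy density along a path. -/
def pathDensity (g : RMetric n M) (γ : H2Path n M) (t : ℝ) : ℝ :=
  g.inner (γ.path t) (covAccel g γ t) (covAccel g γ t)

theorem ae_pathDensity_eq (g : RMetric n M) {c : M} (b : SmoothBumpFunction (𝓡 n) c)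
    (γ : H2Path n M) : ∀ᵐ t ∂unitVol, b =ᶠ[𝓝 (γ.path t)] 1 → pathDensity g γ t =
      densityAt g c (cutChart b (γ.path t)) (cutVel b γ t) (cutAcc b γ t) := by
  have h : ∀ᵐ t ∂unitVol, ∀ i, HasDerivAt (d1 fun s => cutChart b (γ.path s) i)
      (d2 (fun s => cutChart b (γ.path s) i) t) t :=
    ae_all_iff.2 fun i => (isH2_cutChart b γ i).ae_hasDerivAt_d1
  filter_upwards [h, ae_unitVol_mem_Ioo] with t h1 ht hb using covAccel_density g ht hb h1

/-- Near every time, the energy density depends continuously on the path in `L¹`. -/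
theorem exists_nhds_tendsto_density (g : RMetric n M) (γ : H2Path n M) (t : ℝ) :
    ∃ S ∈ 𝓝 t, MeasurableSet S ∧ ∀ J ⊆ S ∩ Icc 0 1, MeasurableSet J →
      Tendsto (fun η : H2Path n M => ∫⁻ s in J, ENNReal.ofReal (pathDensity g η s)) (𝓝 γ)
        (𝓝 (∫⁻ s in J, ENNReal.ofReal (pathDensity g γ s))) := by
  set c := γ.path t with hc
  -- The bump b' selects the times: where b' ∘ γ is at least 1/2, every path close enough to γ has
  -- b' nonzero, so b is 1 near it. There the chart at c computes the density of all these paths at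
  -- once.
  obtain ⟨b, b', hbb'⟩ := exists_nested_bump (n := n) c
  have hcont : Continuous fun s => b' (γ.path s) := b'.continuous.comp γ.continuous_path
  refine ⟨{s | 1 / 2 ≤ b' (γ.path s)}, ?_, (isClosed_le continuous_const hcont).measurableSet, ?_⟩
  · have h1 : (1 / 2 : ℝ) < b' (γ.path t) := by rw [← hc, b'.eq_one]; norm_num
    filter_upwards [hcont.continuousAt.eventually (lt_mem_nhds h1)] with s hs using le_of_lt hs
  intro J hJ hJm
  have hJ1 : J ⊆ Icc 0 1 := hJ.trans inter_subset_right
  set ν : Measure ℝ := volume.restrict J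
  have : IsFiniteMeasure ν := ⟨by
    rw [Measure.restrict_apply_univ]
    exact (measure_mono hJ1).trans_lt (by simp)⟩
  have hνu : ν ≤ unitVol := Measure.restrict_mono_set _ hJ1
  set u : H2Path n M → ℝ → EuclideanSpace ℝ (Fin n) := fun η s => cutChart b (η.path s) with hu
  have hz := (tendstoUniformlyOn_posVel (u := u) (u0 := u γ) (l := 𝓝 γ)
    fun i => γ.h2Tendsto (contMDiff_cutChart_apply b i)).mono hJ1
  have hzc : ∀ η : H2Path n M, ContinuousOn (posVel (u η)) (Icc 0 1) := fun η =>
    continuousOn_posVel fun i => isH2_cutChart b η i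
  set K0 := {s | 1 / 2 ≤ b' (γ.path s)} ∩ Icc (0 : ℝ) 1 with hK0
  have hK0c : IsCompact K0 := isCompact_Icc.inter_left (isClosed_le continuous_const hcont)
  have hK : IsCompact (posVel (u γ) '' K0) :=
    hK0c.image_of_continuousOn ((hzc γ).mono inter_subset_right)
  set Ω : Set (EuclideanSpace ℝ (Fin n) × EuclideanSpace ℝ (Fin n)) :=
    (extChartAt (𝓡 n) c).target ×ˢ univ with hΩ
  have hΩo : IsOpen Ω := (isOpen_target c).prod isOpen_univ
  have hKΩ : posVel (u γ) '' K0 ⊆ Ω := by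
    rintro _ ⟨s, hs, rfl⟩
    refine ⟨?_, mem_univ _⟩
    have h1 := hbb' (γ.path s) (by have := hs.1; simp only [mem_ofPred_eq] at this; linarith)
    have h2 := mem_chart_source_of_eventuallyEq_one h1
    rw [← extChartAt_source (𝓡 n)] at h2
    change cutChart b (γ.path s) ∈ _
    rw [(cutChart_eventuallyEq h1).self_of_nhds]
    exact (extChartAt (𝓡 n) c).map_source h2
  have hlp : ∀ {G : EuclideanSpace ℝ (Fin n) × EuclideanSpace ℝ (Fin n) → ℝ}, ContinuousOn G Ω →
      LpTendsto ⊤ (fun η s => G (posVel (u η) s)) (fun s => G (posVel (u γ) s)) (𝓝 γ) ν :=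
    fun hG => lpTendsto_top_comp hJm hK hΩo hKΩ hG hz ((mapsTo_image _ _).mono_left hJ)
      (Eventually.of_forall fun η => (hzc η).mono hJ1) ((hzc γ).mono hJ1)
  have hfst : ∀ {f : EuclideanSpace ℝ (Fin n) → ℝ}, ContinuousOn f (extChartAt (𝓡 n) c).target →
      ContinuousOn (fun z : EuclideanSpace ℝ (Fin n) × EuclideanSpace ℝ (Fin n) => f z.1) Ω :=
    fun hf => hf.comp continuousOn_fst fun z hz => hz.1
  have hacc : ∀ k, LpTendsto 2 (fun (η : H2Path n M) s => cutAcc b η s k)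
      (fun s => cutAcc b γ s k) (𝓝 γ) ν := fun k => by
    have h1 := (γ.h2Tendsto (contMDiff_cutChart_apply b k)).lp_two
      (fun η => isH2_cutChart b η k) (isH2_cutChart b γ k)
    refine ⟨h1.meas.mono fun η h => h.mono_measure hνu, h1.memLp.mono_measure hνu, ?_⟩
    exact tendsto_of_tendsto_of_tendsto_of_le_of_le tendsto_const_nhds h1.tendsto
      (fun _ => zero_le) fun η => eLpNorm_mono_measure _ hνu
  have hA : ∀ k, LpTendsto 2
      (fun (η : H2Path n M) s => accelAt g c (u η s) (cutVel b η s) (cutAcc b η s) k)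
      (fun s => accelAt g c (u γ s) (cutVel b γ s) (cutAcc b γ s) k) (𝓝 γ) ν := fun k => by
    refine (hacc k).add one_le_two (LpTendsto.two_of_top (hlp
      (G := fun z => ∑ i, ∑ j, christoffelAt g c z.1 k i j * z.2 i * z.2 j) ?_))
    refine continuousOn_finsetSum _ fun i _ => continuousOn_finsetSum _ fun j _ => ?_
    have hp : ∀ i : Fin n, ContinuousOn
        (fun z : EuclideanSpace ℝ (Fin n) × EuclideanSpace ℝ (Fin n) => z.2 i) Ω := fun i =>
      ((EuclideanSpace.proj (𝕜 := ℝ) i).continuous.comp continuous_snd).continuousOn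
    exact ((hfst (continuousOn_christoffelAt g c k i j)).mul (hp i)).mul (hp j)
  -- The density is a sum of products of a metric coefficient, convergent in L^∞, and two components
  -- of the acceleration, convergent in L².
  have hD : LpTendsto 1
      (fun (η : H2Path n M) s => densityAt g c (u η s) (cutVel b η s) (cutAcc b η s))
      (fun s => densityAt g c (u γ s) (cutVel b γ s) (cutAcc b γ s)) (𝓝 γ) ν := by
    unfold densityAt
    simp only [formAt_apply]
    refine LpTendsto.sum le_rfl _ fun i => LpTendsto.sum le_rfl _ fun j => ?_
    exact (hlp (hfst (continuousOn_metricCoeff g c i j))).mul le_rfl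
      ((hA i).mul le_rfl (hA j))
  refine (hD.congr ?_ ?_).lintegral_ofReal
  · have h1 := (γ.h2Tendsto b'.contMDiff).zero
    rw [Metric.tendstoUniformlyOn_iff] at h1
    filter_upwards [h1 (1 / 2) (by norm_num)] with η hη
    have h2 : ∀ᵐ s ∂ν, s ∈ J := ae_restrict_mem hJm
    filter_upwards [h2, ae_mono hνu (ae_pathDensity_eq g b η)] with s hs h3
    refine h3 (hbb' _ fun h0 => ?_)
    have h4 := hη s (hJ1 hs)
    rw [h0, Real.dist_eq, sub_zero] at h4
    have h5 := (hJ hs).1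
    simp only [mem_ofPred_eq] at h5
    linarith [le_abs_self (b' (γ.path s))]
  · have h2 : ∀ᵐ s ∂ν, s ∈ J := ae_restrict_mem hJm
    filter_upwards [h2, ae_mono hνu (ae_pathDensity_eq g b γ)] with s hs h3
    refine h3 (hbb' _ ?_)
    have h5 := (hJ hs).1
    simp only [mem_ofPred_eq] at h5
    linarith

/-- Compactness of [0,1] passes from local in time to global. The local property asks for
convergence of the integral over every measurable subset J, not just over S, so that it survives
finite unions: J is cut into J ∩ S and J \ S. -/
theorem continuous_energy (g : RMetric n M) : Continuous (energy g : H2Path n M → ℝ≥0∞) := by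
  rw [continuous_iff_continuousAt]
  intro γ
  obtain ⟨S, hS, -, h⟩ := isCompact_Icc.induction_on (s := Icc (0 : ℝ) 1)
    (p := fun s => ∃ S, s ⊆ S ∧ MeasurableSet S ∧ ∀ J ⊆ S ∩ Icc 0 1, MeasurableSet J →
      Tendsto (fun η : H2Path n M => ∫⁻ s in J, ENNReal.ofReal (pathDensity g η s)) (𝓝 γ)
        (𝓝 (∫⁻ s in J, ENNReal.ofReal (pathDensity g γ s))))
    ⟨∅, subset_rfl, MeasurableSet.empty, fun J hJ _ => by
      have : J = ∅ := subset_empty_iff.1 (hJ.trans inter_subset_left)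
      subst this
      simp⟩
    (fun s t hst ⟨S, hS, h⟩ => ⟨S, hst.trans hS, h⟩)
    (fun s t ⟨S, hS, hSm, h⟩ ⟨T, hT, hTm, h'⟩ => by
      refine ⟨S ∪ T, union_subset_union hS hT, hSm.union hTm, fun J hJ hJm => ?_⟩
      have h1 := h (J ∩ S) (fun x hx => ⟨hx.2, (hJ hx.1).2⟩) (hJm.inter hSm)
      have h2 := h' (J \ S) (fun x hx => ⟨(hJ hx.1).1.resolve_left hx.2, (hJ hx.1).2⟩)
        (hJm.diff hSm)
      have h3 := h1.add h2
      simpa only [lintegral_inter_add_sdiff _ J hSm] using h3)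
    (fun t _ => by
      obtain ⟨S, hS, hSm, h⟩ := exists_nhds_tendsto_density g γ t
      exact ⟨S, mem_nhdsWithin_of_mem_nhds hS, S, subset_rfl, hSm, h⟩)
  exact h (Icc 0 1) (subset_inter hS subset_rfl) measurableSet_Icc

end Density

/-! ### Changing the jet of a path at one end -/

section Perturb

variable {n : ℕ} {M : Type*} [TopologicalSpace M] [ChartedSpace (EuclideanSpace ℝ (Fin n)) M]
  [IsManifold (𝓡 n) ∞ M] [T2Space M]

theorem continuousOn_of_smooth {σ : ℝ → M} {s : Set ℝ}
    (h : ∀ f : M → ℝ, ContMDiff (𝓡 n) 𝓘(ℝ, ℝ) ∞ f → ContinuousOn (fun t => f (σ t)) s) :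
    ContinuousOn σ s := by
  intro t ht U hU
  rw [mem_map]
  obtain ⟨b, hb⟩ := exists_bump_subset (n := n) hU
  have h1 := h b b.contMDiff t ht
  have h2 : (1 / 2 : ℝ) < b (σ t) := by rw [b.eq_one]; norm_num
  filter_upwards [h1.eventually (lt_mem_nhds h2)] with s hs
  refine hb (subset_closure fun h0 => ?_)
  rw [h0] at hs
  norm_num at hs

/-- A map of the interval whose compositions with smooth functions are `H²` is an `H²` path. -/
def H2Path.ofFun (σ : ℝ → M)
    (h : ∀ f : M → ℝ, ContMDiff (𝓡 n) 𝓘(ℝ, ℝ) ∞ f → IsH2 (fun t => f (σ t))) : H2Path n M where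
  curve := ⟨fun t => σ t, continuousOn_iff_continuous_domRestrict.1
    (continuousOn_of_smooth (n := n) fun f hf => (h f hf).continuousOn)⟩
  isH2 f hf := (h f hf).congr fun t ht => by
    simp only [projIcc_of_mem zero_le_one ht]; rfl

theorem H2Path.ofFun_path {σ : ℝ → M}
    {h : ∀ f : M → ℝ, ContMDiff (𝓡 n) 𝓘(ℝ, ℝ) ∞ f → IsH2 (fun t => f (σ t))} {t : ℝ}
    (ht : t ∈ Icc (0 : ℝ) 1) : (H2Path.ofFun (n := n) σ h).path t = σ t := by
  simp only [H2Path.path, projIcc_of_mem zero_le_one ht]; rfl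

theorem cutVel_congr {c : M} {b : SmoothBumpFunction (𝓡 n) c} {γ η : H2Path n M} {t : ℝ}
    (ht : t ∈ Icc (0 : ℝ) 1) (h : γ.path =ᶠ[𝓝[Icc 0 1] t] η.path) :
    cutVel b γ t = cutVel b η t := by
  unfold cutVel
  congr 1
  ext i
  have h1 : (fun s => cutChart b (γ.path s) i) =ᶠ[𝓝[Icc 0 1] t]
      fun s => cutChart b (η.path s) i := h.mono fun s hs => by simp only [hs]
  exact h1.derivWithin_eq (h1.self_of_nhdsWithin ht)

theorem jet_congr {γ η : H2Path n M} {t : ℝ} (ht : t ∈ Icc (0 : ℝ) 1)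
    (h : γ.path =ᶠ[𝓝[Icc 0 1] t] η.path) : jet t γ = jet t η := by
  obtain ⟨b⟩ : Nonempty (SmoothBumpFunction (𝓡 n) (γ.path t)) := inferInstance
  have h0 : γ.path t = η.path t := h.self_of_nhdsWithin ht
  refine tangentBundle_ext (c := γ.path t) (mem_chart_source _ _) h0 ?_
  rw [velCoord_jet ht b.eventuallyEq_one, velCoord_jet (b := b) ht (h0 ▸ b.eventuallyEq_one),
    cutVel_congr ht h]

/-- A smooth function read in a chart and cut off to the whole model space. -/
def readChart {c : M} (b : SmoothBumpFunction (𝓡 n) c) (f : M → ℝ) (z : EuclideanSpace ℝ (Fin n)) :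
    ℝ := b.toContDiffBump z * f ((extChartAt (𝓡 n) c).symm z)

theorem closedBall_subset_target {c : M} (b : SmoothBumpFunction (𝓡 n) c) :
    Metric.closedBall (extChartAt (𝓡 n) c c) b.rOut ⊆ (extChartAt (𝓡 n) c).target := by
  have := b.closedBall_subset
  rwa [(𝓡 n).range_eq_univ, inter_univ] at this

theorem mem_target_of_dist_lt {c : M} {b : SmoothBumpFunction (𝓡 n) c}
    {z : EuclideanSpace ℝ (Fin n)} (hz : dist z (extChartAt (𝓡 n) c c) < b.rIn) :
    z ∈ (extChartAt (𝓡 n) c).target :=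
  closedBall_subset_target b (Metric.mem_closedBall.2 (hz.le.trans b.rIn_lt_rOut.le))

/-- The support of the bump is a closed ball inside the target of the chart, so the product, which
vanishes outside this ball, is smooth on the whole model space. -/
theorem contDiff_readChart {c : M} (b : SmoothBumpFunction (𝓡 n) c) {f : M → ℝ}
    (hf : ContMDiff (𝓡 n) 𝓘(ℝ, ℝ) ∞ f) : ContDiff ℝ ∞ (readChart b f) := by
  rw [contDiff_iff_contDiffAt]
  intro z
  by_cases hz : z ∈ (extChartAt (𝓡 n) c).target
  · have h1 : ContMDiffAt 𝓘(ℝ, EuclideanSpace ℝ (Fin n)) 𝓘(ℝ, ℝ) ∞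
        (f ∘ (extChartAt (𝓡 n) c).symm) z :=
      (hf.contMDiffAt (x := (extChartAt (𝓡 n) c).symm z)).comp z
        ((contMDiffOn_extChartAt_symm c).contMDiffAt ((isOpen_target c).mem_nhds hz))
    exact b.toContDiffBump.contDiff.contDiffAt.mul (contMDiffAt_iff_contDiffAt.1 h1)
  · have h1 : z ∉ tsupport b.toContDiffBump := by
      rw [b.toContDiffBump.tsupport_eq]
      exact fun h => hz (closedBall_subset_target b h)
    have h2 : readChart b f =ᶠ[𝓝 z] fun _ => 0 := by
      filter_upwards [(isClosed_tsupport _).isOpen_compl.mem_nhds h1] with w hw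
      rw [readChart, image_eq_zero_of_notMem_tsupport hw, zero_mul]
    exact contDiffAt_const.congr_of_eventuallyEq h2

theorem readChart_eq {c : M} {b : SmoothBumpFunction (𝓡 n) c} {f : M → ℝ}
    {z : EuclideanSpace ℝ (Fin n)} (hz : dist z (extChartAt (𝓡 n) c c) < b.rIn) :
    readChart b f z = f ((extChartAt (𝓡 n) c).symm z) := by
  rw [readChart, b.toContDiffBump.one_of_mem_closedBall (Metric.mem_closedBall.2 hz.le), one_mul]

variable {c : M} (b : SmoothBumpFunction (𝓡 n) c) {s : ℝ} (χ : ContDiffBump s)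

/-- Position shift needed at time `s`. -/
def posShift (s : ℝ) (p : TangentBundle (𝓡 n) M) (ζ : H2Path n M) : EuclideanSpace ℝ (Fin n) :=
  extChartAt (𝓡 n) c p.proj - cutChart b (ζ.path s)

/-- Velocity shift needed at time `s`. -/
def velShift (s : ℝ) (p : TangentBundle (𝓡 n) M) (ζ : H2Path n M) : EuclideanSpace ℝ (Fin n) :=
  velCoord c p - cutVel b ζ s

/-- Coordinates of the path `ζ` after its jet at time `s` has been changed to `p`. -/
def shiftCoord (p : TangentBundle (𝓡 n) M) (ζ : H2Path n M) (t : ℝ) : EuclideanSpace ℝ (Fin n) :=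
  cutChart b (ζ.path t) + χ t • (posShift b s p ζ + (t - s) • velShift b s p ζ)

/-- Near the time `s`, both `ζ` and the shifted curve stay in the region of the chart where the
bump function is `1`. -/
structure Shiftable (p : TangentBundle (𝓡 n) M) (ζ : H2Path n M) : Prop where
  proj_mem : p.proj ∈ (chartAt (EuclideanSpace ℝ (Fin n)) c).source
  path_mem : ∀ t ∈ Icc (0 : ℝ) 1, χ t ≠ 0 →
    ζ.path t ∈ (chartAt (EuclideanSpace ℝ (Fin n)) c).source
  dist_path : ∀ t ∈ Icc (0 : ℝ) 1, χ t ≠ 0 →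
    dist (extChartAt (𝓡 n) c (ζ.path t)) (extChartAt (𝓡 n) c c) < b.rIn
  dist_shift : ∀ t ∈ Icc (0 : ℝ) 1, χ t ≠ 0 →
    dist (shiftCoord b χ p ζ t) (extChartAt (𝓡 n) c c) < b.rIn

open Classical in
/-- The shifted curve. -/
def shiftFun (p : TangentBundle (𝓡 n) M) (ζ : H2Path n M) (t : ℝ) : M :=
  if χ t = 0 then ζ.path t else (extChartAt (𝓡 n) c).symm (shiftCoord b χ p ζ t)

variable {b χ} {p : TangentBundle (𝓡 n) M} {ζ : H2Path n M}

theorem Shiftable.eventuallyEq_one (h : Shiftable b χ p ζ) {t : ℝ} (ht : t ∈ Icc (0 : ℝ) 1)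
    (h0 : χ t ≠ 0) : b =ᶠ[𝓝 (ζ.path t)] 1 :=
  b.eventuallyEq_one_of_dist_lt (h.path_mem t ht h0) (h.dist_path t ht h0)

theorem Shiftable.cutChart_eq (h : Shiftable b χ p ζ) {t : ℝ} (ht : t ∈ Icc (0 : ℝ) 1)
    (h0 : χ t ≠ 0) : cutChart b (ζ.path t) = extChartAt (𝓡 n) c (ζ.path t) :=
  (cutChart_eventuallyEq (h.eventuallyEq_one ht h0)).self_of_nhds

/-- Compositions of the shifted curve with smooth functions. -/
theorem Shiftable.comp_shiftFun (h : Shiftable b χ p ζ) (f : M → ℝ) {t : ℝ}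
    (ht : t ∈ Icc (0 : ℝ) 1) : f (shiftFun b χ p ζ t) = f (ζ.path t) +
      (readChart b f (shiftCoord b χ p ζ t) - readChart b f (cutChart b (ζ.path t))) := by
  -- Where χ vanishes the shifted coordinates equal the original ones and the bracket is zero. Hence
  -- one formula holds on all of [0,1], and regularity and continuity need no gluing at the edge of
  -- the support of χ.
  by_cases h0 : χ t = 0
  · simp [shiftFun, shiftCoord, h0]
  · rw [shiftFun, if_neg h0, readChart_eq (h.dist_shift t ht h0), h.cutChart_eq ht h0,
      readChart_eq (h.dist_path t ht h0), (extChartAt (𝓡 n) c).left_inv]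
    · ring
    · rw [extChartAt_source]; exact h.path_mem t ht h0

theorem isH2_bump (χ : ContDiffBump s) : IsH2 (fun t => χ t) :=
  isH2_of_contDiff χ.contDiff fun _ _ => rfl

theorem isH2_bump_mul (χ : ContDiffBump s) : IsH2 (fun t => χ t * (t - s)) :=
  isH2_of_contDiff (χ.contDiff.mul (contDiff_id.sub contDiff_const)) fun _ _ => rfl

theorem shiftCoord_apply (p : TangentBundle (𝓡 n) M) (ζ : H2Path n M) (t : ℝ) (i : Fin n) :
    shiftCoord b χ p ζ t i = cutChart b (ζ.path t) i + (posShift b s p ζ i * χ t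
      + velShift b s p ζ i * (χ t * (t - s))) := by
  simp [shiftCoord]
  ring

theorem isH2_shiftCoord (p : TangentBundle (𝓡 n) M) (ζ : H2Path n M) (i : Fin n) :
    IsH2 (fun t => shiftCoord b χ p ζ t i) := by
  simp only [shiftCoord_apply]
  exact (isH2_cutChart b ζ i).add (((isH2_bump χ).const_mul _).add ((isH2_bump_mul χ).const_mul _))

theorem Shiftable.isH2 (h : Shiftable b χ p ζ) {f : M → ℝ} (hf : ContMDiff (𝓡 n) 𝓘(ℝ, ℝ) ∞ f) :
    IsH2 (fun t => f (shiftFun b χ p ζ t)) :=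
  ((ζ.isH2_path hf).add ((isH2_comp (contDiff_readChart b hf) (isH2_shiftCoord p ζ)).sub
    (isH2_comp (contDiff_readChart b hf) (isH2_cutChart b ζ)))).congr
      fun _ ht => h.comp_shiftFun f ht

variable (b χ) in
open Classical in
/-- The path `ζ` with its jet at time `s` changed to `p`. -/
def shiftPath (p : TangentBundle (𝓡 n) M) (ζ : H2Path n M) : H2Path n M :=
  if h : Shiftable b χ p ζ then H2Path.ofFun (shiftFun b χ p ζ) fun _ hf => h.isH2 hf else ζ

theorem Shiftable.shiftPath_path (h : Shiftable b χ p ζ) {t : ℝ} (ht : t ∈ Icc (0 : ℝ) 1) :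
    (shiftPath b χ p ζ).path t = shiftFun b χ p ζ t := by
  rw [shiftPath, dif_pos h, H2Path.ofFun_path ht]

theorem Shiftable.shiftPath_of_ne (h : Shiftable b χ p ζ) {t : ℝ} (ht : t ∈ Icc (0 : ℝ) 1)
    (h0 : χ t ≠ 0) : (shiftPath b χ p ζ).path t ∈ (chartAt (EuclideanSpace ℝ (Fin n)) c).source ∧
      extChartAt (𝓡 n) c ((shiftPath b χ p ζ).path t) = shiftCoord b χ p ζ t := by
  have hz := mem_target_of_dist_lt (h.dist_shift t ht h0)
  rw [h.shiftPath_path ht, shiftFun, if_neg h0]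
  exact ⟨extChartAt_symm_mem_chart_source hz, (extChartAt (𝓡 n) c).right_inv hz⟩

theorem bump_self (χ : ContDiffBump s) : χ s = 1 :=
  χ.one_of_mem_closedBall (Metric.mem_closedBall_self χ.rIn_pos.le)

theorem bump_self_ne_zero (χ : ContDiffBump s) : χ s ≠ 0 := by
  rw [bump_self]; exact one_ne_zero

/-- Near s the bump χ is 1, so the coordinates of ζ have been increased by the affine function
`posShift` + (t - s) `velShift`, which corrects value and slope at s to those of p. -/
theorem Shiftable.jet_shiftPath (h : Shiftable b χ p ζ) (hs : s ∈ Icc (0 : ℝ) 1) :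
    jet s (shiftPath b χ p ζ) = p := by
  set γ := shiftPath b χ p ζ with hγ
  have hχ := bump_self_ne_zero χ
  have hmem := (h.shiftPath_of_ne hs hχ)
  have hps : p.proj ∈ (extChartAt (𝓡 n) c).source := by rw [extChartAt_source]; exact h.proj_mem
  have hγs : γ.path s ∈ (extChartAt (𝓡 n) c).source := by rw [extChartAt_source]; exact hmem.1
  have hs0 : shiftCoord b χ p ζ s = extChartAt (𝓡 n) c p.proj := by
    simp [shiftCoord, posShift, bump_self]
  have hproj : γ.path s = p.proj :=
    (extChartAt (𝓡 n) c).injOn hγs hps (hmem.2.trans hs0)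
  refine tangentBundle_ext (c := c) hmem.1 hproj ?_
  have hb : b =ᶠ[𝓝 (γ.path s)] 1 := b.eventuallyEq_one_of_dist_lt hmem.1 (by
    rw [hmem.2]; exact h.dist_shift s hs hχ)
  rw [velCoord_jet hs hb]
  have hnz : ∀ᶠ t in 𝓝 s, χ t = 1 := χ.eventuallyEq_one
  have hev : ∀ i, (fun t => cutChart b (γ.path t) i) =ᶠ[𝓝[Icc 0 1] s]
      fun t => cutChart b (ζ.path t) i + (posShift b s p ζ i + velShift b s p ζ i * (t - s)) := by
    intro i
    filter_upwards [self_mem_nhdsWithin, nhdsWithin_le_nhds hnz,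
      nhdsWithin_le_nhds ((γ.continuous_path.tendsto s).eventually (cutChart_eventuallyEq hb))]
      with t ht h1 h2
    have h1' : χ t ≠ 0 := by rw [h1]; exact one_ne_zero
    rw [h2, (h.shiftPath_of_ne ht h1').2, shiftCoord_apply, h1]
    ring
  ext i
  have hd : HasDerivWithinAt (fun t => cutChart b (ζ.path t) i + (posShift b s p ζ i
      + velShift b s p ζ i * (t - s))) (cutVel b ζ s i + velShift b s p ζ i) (Icc 0 1) s := by
    refine ((isH2_cutChart b ζ i).hasDerivWithinAt hs).add ?_
    have h1 : HasDerivAt (fun t : ℝ => posShift b s p ζ i + velShift b s p ζ i * (t - s))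
        (velShift b s p ζ i) s := by
      simpa using (((hasDerivAt_id s).sub_const s).const_mul (velShift b s p ζ i)).const_add
        (posShift b s p ζ i)
    exact h1.hasDerivWithinAt
  have h2 : cutVel b γ s i = cutVel b ζ s i + velShift b s p ζ i :=
    IsH2.d1_eq_of_hasDerivWithinAt hs
      (hd.congr_of_eventuallyEq (hev i) ((hev i).self_of_nhdsWithin hs))
  rw [h2]
  simp [velShift]

theorem jet_shiftPath_of_far {s' : ℝ} (hs' : s' ∈ Icc (0 : ℝ) 1) (hfar : χ.rOut < dist s' s) :
    jet s' (shiftPath b χ p ζ) = jet s' ζ := by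
  by_cases h : Shiftable b χ p ζ
  · refine jet_congr hs' ?_
    have h1 : ∀ᶠ t in 𝓝 s', χ.rOut < dist t s :=
      (continuous_id.dist continuous_const).continuousAt.eventually (lt_mem_nhds hfar)
    filter_upwards [self_mem_nhdsWithin, nhdsWithin_le_nhds h1] with t ht h2
    rw [h.shiftPath_path ht, shiftFun, if_pos (χ.zero_of_le_dist h2.le)]
  · rw [shiftPath, dif_neg h]

/-- Both shifts vanish when the required jet is the one already present. This gives T γ₀ = η in
`exists_jet_transport`. -/
theorem shiftPath_self {η : H2Path n M} (hs : s ∈ Icc (0 : ℝ) 1) :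
    shiftPath b χ (jet s η) η = η := by
  by_cases h : Shiftable b χ (jet s η) η
  · have hχ := bump_self_ne_zero χ
    have h1 : posShift b s (jet s η) η = 0 := by
      rw [posShift, h.cutChart_eq hs hχ]
      exact sub_self _
    have h2 : velShift b s (jet s η) η = 0 := by
      rw [velShift, velCoord_jet hs (h.eventuallyEq_one hs hχ), sub_self]
    refine H2Path.ext_path fun t ht => ?_
    rw [h.shiftPath_path ht, shiftFun]
    split_ifs with h0
    · rfl
    · rw [shiftCoord, h1, h2, smul_zero, add_zero, smul_zero, add_zero, h.cutChart_eq ht h0,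
        (extChartAt (𝓡 n) c).left_inv]
      rw [extChartAt_source]; exact h.path_mem t ht h0
  · rw [shiftPath, dif_neg h]

theorem continuousAt_posShift (hs : s ∈ Icc (0 : ℝ) 1)
    (hp : p.proj ∈ (chartAt (EuclideanSpace ℝ (Fin n)) c).source) :
    ContinuousAt (fun z : TangentBundle (𝓡 n) M × H2Path n M => posShift b s z.1 z.2) (p, ζ) := by
  refine ContinuousAt.sub ?_ ?_
  · have h1 : ContinuousAt (extChartAt (𝓡 n) c) p.proj := continuousAt_extChartAt' (by
      rwa [extChartAt_source])
    exact ContinuousAt.comp (x := (p, ζ)) (g := extChartAt (𝓡 n) c)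
      (f := fun z : TangentBundle (𝓡 n) M × H2Path n M => z.1.proj) h1
      ((FiberBundle.continuous_proj _ _).comp continuous_fst).continuousAt
  · exact ((contMDiff_cutChart b).continuous.comp
      ((continuous_eval hs).comp continuous_snd)).continuousAt

theorem continuousAt_velShift (hs : s ∈ Icc (0 : ℝ) 1)
    (hp : p.proj ∈ (chartAt (EuclideanSpace ℝ (Fin n)) c).source) :
    ContinuousAt (fun z : TangentBundle (𝓡 n) M × H2Path n M => velShift b s z.1 z.2) (p, ζ) := by
  refine ContinuousAt.sub ?_ ?_
  · exact ContinuousAt.comp (x := (p, ζ)) (g := velCoord c)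
      (f := fun z : TangentBundle (𝓡 n) M × H2Path n M => z.1) (continuousAt_velCoord hp)
      continuous_fst.continuousAt
  · exact (tendsto_cutVel b ζ hs).comp (continuous_snd.tendsto (p, ζ))

/-- By `Shiftable.comp_shiftFun`, a smooth f along the shifted path is a combination of smooth
functions of coordinates, and these depend on (p, ζ) through ζ and through scalars multiplying fixed
functions of time. `Shiftable` is required near (p, ζ) because `shiftPath` returns ζ unchanged
elsewhere. -/
theorem continuousAt_shiftPath (hs : s ∈ Icc (0 : ℝ) 1)
    (h : ∀ᶠ z : TangentBundle (𝓡 n) M × H2Path n M in 𝓝 (p, ζ), Shiftable b χ z.1 z.2) :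
    ContinuousAt (fun z : TangentBundle (𝓡 n) M × H2Path n M => shiftPath b χ z.1 z.2) (p, ζ) := by
  refine tendsto_h2Path_iff.2 fun f hf => ?_
  have h0 : Shiftable b χ p ζ := h.self_of_nhds
  have hsnd : Tendsto (fun z : TangentBundle (𝓡 n) M × H2Path n M => z.2) (𝓝 (p, ζ)) (𝓝 ζ) :=
    continuous_snd.tendsto (p, ζ)
  have t1 : ∀ i, H2Tendsto (fun (z : TangentBundle (𝓡 n) M × H2Path n M) t =>
      cutChart b (z.2.path t) i) (fun t => cutChart b (ζ.path t) i) (𝓝 (p, ζ)) := fun i =>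
    tendsto_h2Path_iff.1 hsnd _ (contMDiff_cutChart_apply b i)
  have cpos : ∀ i, Tendsto (fun z : TangentBundle (𝓡 n) M × H2Path n M => posShift b s z.1 z.2 i)
      (𝓝 (p, ζ)) (𝓝 (posShift b s p ζ i)) := fun i =>
    ((EuclideanSpace.proj (𝕜 := ℝ) i).continuous.tendsto _).comp
      (continuousAt_posShift (ζ := ζ) hs h0.proj_mem)
  have cvel : ∀ i, Tendsto (fun z : TangentBundle (𝓡 n) M × H2Path n M => velShift b s z.1 z.2 i)
      (𝓝 (p, ζ)) (𝓝 (velShift b s p ζ i)) := fun i =>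
    ((EuclideanSpace.proj (𝕜 := ℝ) i).continuous.tendsto _).comp
      (continuousAt_velShift (ζ := ζ) hs h0.proj_mem)
  have t2 : ∀ i, H2Tendsto (fun (z : TangentBundle (𝓡 n) M × H2Path n M) t =>
      shiftCoord b χ z.1 z.2 t i) (fun t => shiftCoord b χ p ζ t i) (𝓝 (p, ζ)) := by
    intro i
    simp only [shiftCoord_apply]
    exact (t1 i).add ((H2Tendsto.const_mul (cpos i) (isH2_bump χ)).add
      (H2Tendsto.const_mul (cvel i) (isH2_bump_mul χ)) (fun _ => (isH2_bump χ).const_mul _)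
      ((isH2_bump χ).const_mul _) (fun _ => (isH2_bump_mul χ).const_mul _)
      ((isH2_bump_mul χ).const_mul _)) (fun z => isH2_cutChart b z.2 i) (isH2_cutChart b ζ i)
      (fun _ => ((isH2_bump χ).const_mul _).add ((isH2_bump_mul χ).const_mul _))
      (((isH2_bump χ).const_mul _).add ((isH2_bump_mul χ).const_mul _))
  have hF := contDiff_readChart b hf
  have i1 := fun z : TangentBundle (𝓡 n) M × H2Path n M => isH2_comp hF (isH2_shiftCoord (χ := χ) (b := b) z.1 z.2)
  have i2 := fun z : TangentBundle (𝓡 n) M × H2Path n M => isH2_comp hF (isH2_cutChart b z.2)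
  have t3 := (tendsto_h2Path_iff.1 hsnd f hf).add
    ((H2Tendsto.comp t2 (fun z i => isH2_shiftCoord z.1 z.2 i) (isH2_shiftCoord p ζ) hF).sub
      (H2Tendsto.comp t1 (fun z i => isH2_cutChart b z.2 i) (isH2_cutChart b ζ) hF)
      i1 (i1 (p, ζ)) i2 (i2 (p, ζ)))
    (fun z => z.2.isH2_path hf) (ζ.isH2_path hf) (fun z => (i1 z).sub (i2 z))
    ((i1 (p, ζ)).sub (i2 (p, ζ)))
  refine t3.congr ?_ fun t ht => ?_
  · filter_upwards [h] with z hz t ht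
    simp only [hz.shiftPath_path ht, hz.comp_shiftFun f ht]
  · simp only [h0.shiftPath_path ht, h0.comp_shiftFun f ht]

/-- Local existence of a continuous operation changing the jet of a path at the time `s`. -/
theorem exists_eventually_shiftable (η : H2Path n M) (hs : s ∈ Icc (0 : ℝ) 1) :
    ∃ (b : SmoothBumpFunction (𝓡 n) (η.path s)) (χ : ContDiffBump s), χ.rOut < 1 ∧
      ∀ᶠ z : TangentBundle (𝓡 n) M × H2Path n M in 𝓝 (jet s η, η), Shiftable b χ z.1 z.2 := by
  set c := η.path s with hc
  obtain ⟨b⟩ : Nonempty (SmoothBumpFunction (𝓡 n) c) := inferInstance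
  have hr : 0 < b.rIn / 2 := half_pos b.rIn_pos
  have hU : {x | x ∈ (chartAt (EuclideanSpace ℝ (Fin n)) c).source ∧
      dist (extChartAt (𝓡 n) c x) (extChartAt (𝓡 n) c c) < b.rIn / 2} ∈ 𝓝 c := by
    filter_upwards [chart_source_mem_nhds (EuclideanSpace ℝ (Fin n)) c,
      (continuousAt_extChartAt (I := 𝓡 n) c).eventually (Metric.ball_mem_nhds _ hr)] with x h1 h2
    exact ⟨h1, h2⟩
  obtain ⟨b', hb'⟩ := exists_bump_subset (n := n) hU
  have hcont : Continuous fun t => b' (η.path t) := b'.continuous.comp η.continuous_path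
  have h1 : (1 / 2 : ℝ) < b' (η.path s) := by rw [← hc, b'.eq_one]; norm_num
  obtain ⟨δ, hδ, hδb⟩ := Metric.eventually_nhds_iff.1 (hcont.continuousAt.eventually (lt_mem_nhds h1))
  -- The bound δ keeps η in the good part of the chart while χ is nonzero; the bound 1/2 makes the
  -- support radius less than 1, so the opposite end of the interval is not affected.
  set r := min δ (1 / 2) with hrdef
  have hr0 : 0 < r := lt_min hδ (by norm_num)
  refine ⟨b, ⟨r / 2, r, half_pos hr0, half_lt_self hr0⟩, ?_, ?_⟩
  · exact (min_le_right _ _).trans_lt (by norm_num)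
  set χ : ContDiffBump s := ⟨r / 2, r, half_pos hr0, half_lt_self hr0⟩ with hχ
  have hsupp : ∀ t, χ t ≠ 0 → dist t s < r := by
    intro t ht
    by_contra hlt
    exact ht (χ.zero_of_le_dist (not_lt.1 hlt))
  have hb1 : b =ᶠ[𝓝 (η.path s)] 1 := b.eventuallyEq_one
  have hpos0 : posShift b s (jet s η) η = 0 := by
    rw [posShift, (cutChart_eventuallyEq hb1).self_of_nhds]
    exact sub_self _
  have hvel0 : velShift b s (jet s η) η = 0 := by
    rw [velShift, velCoord_jet hs hb1, sub_self]
  have hproj : (jet s η).proj ∈ (chartAt (EuclideanSpace ℝ (Fin n)) c).source :=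
    mem_chart_source _ _
  have e1 := (continuousAt_posShift (b := b) (ζ := η) hs hproj).tendsto
  have e2 := (continuousAt_velShift (b := b) (ζ := η) hs hproj).tendsto
  simp only [hpos0] at e1
  simp only [hvel0] at e2
  have hsnd : Tendsto (fun z : TangentBundle (𝓡 n) M × H2Path n M => z.2) (𝓝 (jet s η, η)) (𝓝 η) :=
    continuous_snd.tendsto _
  have e3 := Metric.tendstoUniformlyOn_iff.1 (tendsto_h2Path_iff.1 hsnd b' b'.contMDiff).zero
    (1 / 2) (by norm_num)
  have e4 : ∀ᶠ z : TangentBundle (𝓡 n) M × H2Path n M in 𝓝 (jet s η, η),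
      z.1.proj ∈ (chartAt (EuclideanSpace ℝ (Fin n)) c).source :=
    ((FiberBundle.continuous_proj (EuclideanSpace ℝ (Fin n)) (TangentSpace (𝓡 n))).comp
      continuous_fst).continuousAt.eventually
      ((chartAt (EuclideanSpace ℝ (Fin n)) c).open_source.mem_nhds hproj)
  -- Each shift gets a quarter of the radius. As |t - s| ≤ 1, the total displacement is below `b.rIn
  -- / 2`, and the path itself stays within `b.rIn / 2` of the centre.
  have hr4 : 0 < b.rIn / 4 := by have := b.rIn_pos; linarith
  filter_upwards [e1.eventually (Metric.ball_mem_nhds _ hr4),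
    e2.eventually (Metric.ball_mem_nhds _ hr4), e3, e4] with z h1 h2 h3 h4
  rw [dist_zero_right] at h1 h2
  have hz : ∀ t ∈ Icc (0 : ℝ) 1, χ t ≠ 0 → z.2.path t ∈ {x | x ∈
      (chartAt (EuclideanSpace ℝ (Fin n)) c).source ∧
      dist (extChartAt (𝓡 n) c x) (extChartAt (𝓡 n) c c) < b.rIn / 2} := by
    intro t ht h0
    refine hb' (subset_closure fun h5 => ?_)
    have h6 := h3 t ht
    have h7 := hδb ((hsupp t h0).trans_le (min_le_left _ _))
    rw [h5, Real.dist_eq, sub_zero] at h6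
    linarith [le_abs_self (b' (η.path t))]
  refine ⟨h4, fun t ht h0 => (hz t ht h0).1, fun t ht h0 => ?_, fun t ht h0 => ?_⟩
  · exact (hz t ht h0).2.trans (half_lt_self b.rIn_pos)
  · have hzt := hz t ht h0
    have hbt : b =ᶠ[𝓝 (z.2.path t)] 1 :=
      b.eventuallyEq_one_of_dist_lt hzt.1 (hzt.2.trans (half_lt_self b.rIn_pos))
    have h5 : cutChart b (z.2.path t) = extChartAt (𝓡 n) c (z.2.path t) :=
      (cutChart_eventuallyEq hbt).self_of_nhds
    have h6 : ‖χ t • (posShift b s z.1 z.2 + (t - s) • velShift b s z.1 z.2)‖ < b.rIn / 2 := by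
      have ht1 : |t - s| ≤ 1 := by
        rw [abs_le]; constructor <;> linarith [ht.1, ht.2, hs.1, hs.2]
      have hχ1 : |χ t| ≤ 1 := by rw [abs_of_nonneg χ.nonneg]; exact χ.le_one
      calc _ = |χ t| * ‖posShift b s z.1 z.2 + (t - s) • velShift b s z.1 z.2‖ := norm_smul _ _
        _ ≤ 1 * (‖posShift b s z.1 z.2‖ + |t - s| * ‖velShift b s z.1 z.2‖) := by
          refine mul_le_mul hχ1 ((norm_add_le _ _).trans ?_) (norm_nonneg _) zero_le_one
          rw [norm_smul, Real.norm_eq_abs]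
        _ ≤ ‖posShift b s z.1 z.2‖ + ‖velShift b s z.1 z.2‖ := by
          rw [one_mul]
          gcongr
          exact mul_le_of_le_one_left (norm_nonneg _) ht1
        _ < _ := by linarith
    rw [shiftCoord, h5]
    calc dist _ _ ≤ dist (extChartAt (𝓡 n) c (z.2.path t) + _) (extChartAt (𝓡 n) c (z.2.path t))
          + dist (extChartAt (𝓡 n) c (z.2.path t)) (extChartAt (𝓡 n) c c) := dist_triangle _ _ _
      _ < b.rIn / 2 + b.rIn / 2 := by
        refine add_lt_add ?_ hzt.2
        rw [dist_eq_norm, add_sub_cancel_left]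
        exact h6
      _ = b.rIn := by ring

end Perturb

/-! ### Optimal measures are supported on cubic splines -/

section Support

variable {n : ℕ} {M : Type*} [TopologicalSpace M] [ChartedSpace (EuclideanSpace ℝ (Fin n)) M]
  [IsManifold (𝓡 n) ∞ M] [T2Space M]

/-- Both corrections are applied to the fixed path η, and γ enters only through its end jets: the
jet at 0 is corrected first, then the jet at 1, which leaves the first untouched since the bump is
supported away from 0. -/
theorem exists_jet_transport {γ₀ η : H2Path n M} (h0 : jet 0 η = jet 0 γ₀)
    (h1 : jet 1 η = jet 1 γ₀) : ∃ T : H2Path n M → H2Path n M, T γ₀ = η ∧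
      ∀ᶠ γ in 𝓝 γ₀, ContinuousAt T γ ∧ jet 0 (T γ) = jet 0 γ ∧ jet 1 (T γ) = jet 1 γ := by
  have hm0 : (0 : ℝ) ∈ Icc (0 : ℝ) 1 := left_mem_Icc.2 zero_le_one
  have hm1 : (1 : ℝ) ∈ Icc (0 : ℝ) 1 := right_mem_Icc.2 zero_le_one
  obtain ⟨b0, χ0, hr0, e0⟩ := exists_eventually_shiftable η hm0
  obtain ⟨b1, χ1, hr1, e1⟩ := exists_eventually_shiftable η hm1
  set S : H2Path n M → H2Path n M := fun γ => shiftPath b0 χ0 (jet 0 γ) η with hS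
  set T : H2Path n M → H2Path n M := fun γ => shiftPath b1 χ1 (jet 1 γ) (S γ) with hT
  have hSγ : S γ₀ = η := by simp only [hS, ← h0, shiftPath_self hm0]
  have hTγ : T γ₀ = η := by simp only [hT, hSγ, ← h1, shiftPath_self hm1]
  have hc0 : Continuous fun γ : H2Path n M => (jet 0 γ, η) :=
    (continuous_jet hm0).prodMk continuous_const
  have f0 : ∀ᶠ γ in 𝓝 γ₀, ∀ᶠ z in 𝓝 (jet 0 γ, η), Shiftable b0 χ0 z.1 z.2 := by
    rw [h0] at e0
    exact (hc0.tendsto γ₀).eventually (eventually_eventually_nhds.2 e0)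
  have cS : ∀ᶠ γ in 𝓝 γ₀, ContinuousAt S γ := f0.mono fun γ hγ =>
    ContinuousAt.comp (f := fun γ : H2Path n M => (jet 0 γ, η)) (x := γ)
      (continuousAt_shiftPath hm0 hγ) hc0.continuousAt
  have cjS : ∀ᶠ γ in 𝓝 γ₀, ContinuousAt (fun γ : H2Path n M => (jet 1 γ, S γ)) γ :=
    cS.mono fun γ hγ => (continuous_jet hm1).continuousAt.prodMk hγ
  have f1 : ∀ᶠ γ in 𝓝 γ₀, ∀ᶠ z in 𝓝 (jet 1 γ, S γ), Shiftable b1 χ1 z.1 z.2 := by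
    have e1' : ∀ᶠ z in 𝓝 (jet 1 γ₀, S γ₀), Shiftable b1 χ1 z.1 z.2 := by rwa [hSγ, ← h1]
    exact cjS.self_of_nhds.tendsto.eventually (eventually_eventually_nhds.2 e1')
  refine ⟨T, hTγ, ?_⟩
  filter_upwards [f0, f1, cjS] with γ g0 g1 gc
  refine ⟨ContinuousAt.comp (f := fun γ : H2Path n M => (jet 1 γ, S γ)) (x := γ)
    (continuousAt_shiftPath hm1 g1) gc, ?_, g1.self_of_nhds.jet_shiftPath hm1⟩
  have : jet 0 (T γ) = jet 0 (S γ) := jet_shiftPath_of_far hm0 (by simpa using hr1)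
  rw [this]
  exact g0.self_of_nhds.jet_shiftPath hm0

theorem mem_support_map {X Y : Type*} [TopologicalSpace X] [MeasurableSpace X] [BorelSpace X]
    [TopologicalSpace Y] [MeasurableSpace Y] [BorelSpace Y] {μ : Measure X} {f : X → Y}
    (hf : Continuous f) {x : X} (hx : x ∈ μ.support) : f x ∈ (μ.map f).support := by
  rw [Measure.mem_support_iff_forall] at hx ⊢
  intro V hV
  obtain ⟨W, hWV, hW, hxW⟩ := mem_nhds_iff.1 hV
  refine lt_of_lt_of_le ?_ (measure_mono hWV)
  rw [Measure.map_apply hf.measurable hW.measurableSet]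
  exact hx _ ((hW.preimage hf).mem_nhds hxW)

open Classical in
-- A better competitor for one path of the support improves a whole neighbourhood, which has
-- positive mass; transporting this mass by T contradicts optimality.
theorem IsOptimal.isCubicSpline {g : RMetric n M} {ρ₀ ρ₁ : Measure (TangentBundle (𝓡 n) M)}
    {μ : Measure (H2Path n M)} (h : IsOptimal g ρ₀ ρ₁ μ) {γ₀ : H2Path n M}
    (hγ : γ₀ ∈ μ.support) : IsCubicSpline g γ₀ := by
  intro η h0 h1
  by_contra! hlt
  have hm0 : (0 : ℝ) ∈ Icc (0 : ℝ) 1 := left_mem_Icc.2 zero_le_one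
  have hm1 : (1 : ℝ) ∈ Icc (0 : ℝ) 1 := right_mem_Icc.2 zero_le_one
  obtain ⟨T, hT, hev⟩ := exists_jet_transport h0 h1
  have hE : ∀ᶠ γ in 𝓝 γ₀, energy g (T γ) < energy g γ := by
    refine Tendsto.eventually_lt ((continuous_energy g).continuousAt.comp hev.self_of_nhds.1)
      (continuous_energy g).continuousAt ?_
    simpa [hT] using hlt
  obtain ⟨U, hU, hUo, hγU⟩ := eventually_nhds_iff.1 (hev.and hE)
  have hS : Measurable (U.piecewise T id) :=
    ContinuousOn.measurable_piecewise (fun γ hγ => (hU γ hγ).1.1.continuousWithinAt)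
      continuousOn_id hUo.measurableSet
  have := h.admissible.prob
  have hjet : ∀ t, t ∈ Icc (0 : ℝ) 1 → (∀ γ ∈ U, jet t (T γ) = jet t γ) →
      (μ.map (U.piecewise T id)).map (jet t) = μ.map (jet t) := by
    intro t ht hj
    rw [Measure.map_map (continuous_jet ht).measurable hS]
    congr 1
    ext1 γ
    by_cases hγ : γ ∈ U
    · simp [hγ, hj γ hγ]
    · simp [hγ]
  have hadm : IsAdmissible ρ₀ ρ₁ (μ.map (U.piecewise T id)) :=
    ⟨Measure.isProbabilityMeasure_map hS.aemeasurable,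
      (hjet 0 hm0 fun γ hγ => (hU γ hγ).1.2.1).trans h.admissible.marginal_zero,
      (hjet 1 hm1 fun γ hγ => (hU γ hγ).1.2.2).trans h.admissible.marginal_one⟩
  have hcost : cost g (μ.map (U.piecewise T id)) = ∫⁻ γ, energy g (U.piecewise T id γ) ∂μ :=
    lintegral_map (continuous_energy g).measurable hS
  have hle := h.le _ hadm
  have hpt : ∀ γ, energy g (U.piecewise T id γ) ≤ energy g γ := by
    intro γ
    by_cases hγ : γ ∈ U
    · simpa [hγ] using (hU γ hγ).2.le
    · simp [hγ]
  have hfin : ∫⁻ γ, energy g (U.piecewise T id γ) ∂μ ≠ ⊤ :=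
    ne_top_of_le_ne_top h.finite (lintegral_mono hpt)
  have hpos : μ U ≠ 0 := ((Measure.mem_support_iff_forall γ₀).1 hγ U (hUo.mem_nhds hγU)).ne'
  -- Strictness needs the smaller integral to be finite; this is where the finite cost of μ enters.
  have := lintegral_strict_mono_of_ae_le_of_ae_lt_on (continuous_energy g).measurable.aemeasurable
    hfin (ae_of_all _ hpt) hpos (ae_of_all _ fun γ hγ => by simpa [hγ] using (hU γ hγ).2)
  rw [← hcost] at this
  exact absurd hle (not_le.2 this)

theorem IsOptimal.mem_support {g : RMetric n M} {ρ₀ ρ₁ : Measure (TangentBundle (𝓡 n) M)}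
    {μ : Measure (H2Path n M)} (h : IsOptimal g ρ₀ ρ₁ μ) {γ : H2Path n M} (hγ : γ ∈ μ.support) :
    IsCubicSpline g γ ∧ jet 0 γ ∈ ρ₀.support ∧ jet 1 γ ∈ ρ₁.support := by
  refine ⟨h.isCubicSpline hγ, ?_, ?_⟩
  · rw [← h.admissible.marginal_zero]
    exact mem_support_map (continuous_jet (left_mem_Icc.2 zero_le_one)) hγ
  · rw [← h.admissible.marginal_one]
    exact mem_support_map (continuous_jet (right_mem_Icc.2 zero_le_one)) hγ

end Support

/-! ### The scalar Hermite problem -/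

section Scalar

theorem integral_unitVol (f : ℝ → ℝ) : ∫ t, f t ∂unitVol = ∫ t in (0 : ℝ)..1, f t := by
  rw [intervalIntegral.integral_of_le zero_le_one, ← integral_Icc_eq_integral_Ioc]

variable {u : ℝ → ℝ}

/-- Integration by parts. Together with `IsH2.integral_d2_unitVol` it shows that the moments of u''
against 1 and t depend only on the end data. -/
theorem IsH2.integral_id_mul_d2 (hu : IsH2 u) :
    ∫ t, t * d2 u t ∂unitVol = d1 u 1 - (u 1 - u 0) := by
  have hid : AbsolutelyContinuousOnInterval (fun t : ℝ => t) 0 1 :=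
    ContDiffOn.absolutelyContinuousOnInterval contDiff_id.contDiffOn
  have h1 := hid.integral_mul_deriv_eq_deriv_mul hu.ac_d1
  simp only [deriv_id'', one_mul, zero_mul, sub_zero] at h1
  rw [hu.integral_d1 (left_mem_Icc.2 zero_le_one) (right_mem_Icc.2 zero_le_one),
    ← integral_unitVol] at h1
  rw [← h1]
  refine integral_congr_ae ?_
  filter_upwards [hu.ae_hasDerivAt_d1] with t ht
  rw [ht.deriv]

theorem IsH2.integral_d2_unitVol (hu : IsH2 u) : ∫ t, d2 u t ∂unitVol = d1 u 1 - d1 u 0 := by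
  rw [integral_unitVol, hu.integral_d2 (left_mem_Icc.2 zero_le_one) (right_mem_Icc.2 zero_le_one)]

/-- The second derivative of the scalar Hermite cubic with end values `x, y` and slopes `v, w`. -/
def hermiteAcc (x v y w t : ℝ) : ℝ :=
  2 * (3 * (y - x) - 2 * v - w) + 6 * (2 * (x - y) + v + w) * t

theorem continuous_hermiteAcc (x v y w : ℝ) : Continuous (hermiteAcc x v y w) := by
  unfold hermiteAcc
  fun_prop

theorem integral_affine_sq (a b : ℝ) : ∫ t, (a + b * t) ^ 2 ∂unitVol = a ^ 2 + a * b + b ^ 2 / 3 := by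
  rw [integral_unitVol]
  have h : ∀ t ∈ uIcc (0 : ℝ) 1, HasDerivAt (fun t => a ^ 2 * t + a * b * t ^ 2 + b ^ 2 / 3 * t ^ 3)
      ((a + b * t) ^ 2) t := by
    intro t _
    have := (((hasDerivAt_id t).const_mul (a ^ 2)).add ((hasDerivAt_pow 2 t).const_mul (a * b))).add
      ((hasDerivAt_pow 3 t).const_mul (b ^ 2 / 3))
    refine this.congr_deriv ?_
    push_cast
    ring
  rw [intervalIntegral.integral_eq_sub_of_hasDerivAt h
    (Continuous.intervalIntegrable (by fun_prop) _ _)]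
  ring

/-- `hermiteAcc` is affine in t, so in the expansion of the square the cross term involves only the
two moments of u'' fixed by the end data. The remaining constant is the one-dimensional `cph`. -/
theorem IsH2.integral_d2_sq (hu : IsH2 u) : ∫ t, d2 u t ^ 2 ∂unitVol =
    (12 * (u 0 - u 1) ^ 2 + 4 * (d1 u 0 ^ 2 + d1 u 1 ^ 2 + d1 u 0 * d1 u 1
      + 3 * ((d1 u 0 + d1 u 1) * (u 0 - u 1)))) +
    ∫ t, (d2 u t - hermiteAcc (u 0) (d1 u 0) (u 1) (d1 u 1) t) ^ 2 ∂unitVol := by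
  set a := 2 * (3 * (u 1 - u 0) - 2 * d1 u 0 - d1 u 1) with ha
  set b := 6 * (2 * (u 0 - u 1) + d1 u 0 + d1 u 1) with hb
  have e : ∀ t, (d2 u t - hermiteAcc (u 0) (d1 u 0) (u 1) (d1 u 1) t) ^ 2 =
      d2 u t ^ 2 + (-(2 * a)) * d2 u t + (-(2 * b)) * (t * d2 u t) + (a + b * t) ^ 2 := fun t => by
    rw [hermiteAcc, ← ha, ← hb]; ring
  have i1 : Integrable (fun t => d2 u t ^ 2) unitVol := hu.memLp_d2.integrable_sq
  have i2 : Integrable (fun t => (-(2 * a)) * d2 u t) unitVol :=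
    (hu.memLp_d2.integrable (by norm_num)).const_mul _
  have i3 : Integrable (fun t => (-(2 * b)) * (t * d2 u t)) unitVol :=
    ((memLp_continuousOn_mul continuousOn_id hu.memLp_d2).integrable (by norm_num)).const_mul _
  have i4 : Integrable (fun t => (a + b * t) ^ 2) unitVol :=
    (memLp_continuousOn (by fun_prop)).integrable_sq
  have i12 : Integrable (fun t => d2 u t ^ 2 + (-(2 * a)) * d2 u t) unitVol := i1.add i2
  have i123 : Integrable (fun t => d2 u t ^ 2 + (-(2 * a)) * d2 u t + (-(2 * b)) * (t * d2 u t))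
    unitVol := i12.add i3
  simp only [e]
  rw [integral_add i123 i4, integral_add i12 i3, integral_add i1 i2,
    integral_const_mul, integral_const_mul, hu.integral_id_mul_d2, hu.integral_d2_unitVol,
    integral_affine_sq]
  simp only [ha, hb]
  ring

/-- An `H²` function whose second derivative is that of the Hermite cubic is this cubic. -/
theorem IsH2.eq_hermite (hu : IsH2 u)
    (h : d2 u =ᵐ[unitVol] hermiteAcc (u 0) (d1 u 0) (u 1) (d1 u 1)) {t : ℝ}
    (ht : t ∈ Icc (0 : ℝ) 1) :
    u t = u 0 + t * d1 u 0 + t ^ 2 * (3 * (u 1 - u 0) - 2 * d1 u 0 - d1 u 1)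
      + t ^ 3 * (2 * (u 0 - u 1) + d1 u 0 + d1 u 1) := by
  have h0 : (0 : ℝ) ∈ Icc (0 : ℝ) 1 := left_mem_Icc.2 zero_le_one
  set a := 3 * (u 1 - u 0) - 2 * d1 u 0 - d1 u 1 with ha
  set b := 2 * (u 0 - u 1) + d1 u 0 + d1 u 1 with hb
  have e1 : ∀ t ∈ Icc (0 : ℝ) 1, d1 u t = d1 u 0 + 2 * a * t + 3 * b * t ^ 2 := by
    intro t ht
    have h1 := hu.integral_d2 h0 ht
    have h2 : ∫ x in (0 : ℝ)..t, d2 u x = ∫ x in (0 : ℝ)..t, (2 * a + 6 * b * x) := by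
      refine intervalIntegral.integral_congr_ae ?_
      have h3 := (ae_restrict_iff' measurableSet_Icc).1 h
      filter_upwards [h3] with x hx hxt
      rw [uIoc_of_le ht.1] at hxt
      exact hx ⟨hxt.1.le, hxt.2.trans ht.2⟩
    have h3 : ∫ x in (0 : ℝ)..t, (2 * a + 6 * b * x) = 2 * a * t + 3 * b * t ^ 2 := by
      rw [intervalIntegral.integral_eq_sub_of_hasDerivAt
        (f := fun x => 2 * a * x + 3 * b * x ^ 2) _ (Continuous.intervalIntegrable (by fun_prop) _ _)]
      · ring
      · intro x _
        refine (((hasDerivAt_id x).const_mul (2 * a)).add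
          ((hasDerivAt_pow 2 x).const_mul (3 * b))).congr_deriv ?_
        push_cast
        ring
    linarith
  have h1 := hu.integral_d1 h0 ht
  have h2 : ∫ x in (0 : ℝ)..t, d1 u x = ∫ x in (0 : ℝ)..t, (d1 u 0 + 2 * a * x + 3 * b * x ^ 2) :=
    intervalIntegral.integral_congr fun x hx => by
      rw [uIcc_of_le ht.1] at hx
      exact e1 x ⟨hx.1, hx.2.trans ht.2⟩
  have h3 : ∫ x in (0 : ℝ)..t, (d1 u 0 + 2 * a * x + 3 * b * x ^ 2) =
      d1 u 0 * t + a * t ^ 2 + b * t ^ 3 := by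
    rw [intervalIntegral.integral_eq_sub_of_hasDerivAt
      (f := fun x => d1 u 0 * x + a * x ^ 2 + b * x ^ 3) _
      (Continuous.intervalIntegrable (by fun_prop) _ _)]
    · ring
    · intro x _
      refine ((((hasDerivAt_id x).const_mul (d1 u 0)).add ((hasDerivAt_pow 2 x).const_mul a)).add
        ((hasDerivAt_pow 3 x).const_mul b)).congr_deriv ?_
      push_cast
      ring
  linarith

end Scalar

/-! ### Paths in Euclidean space -/

section EuclideanPaths

variable {d : ℕ}

local notation "𝔼" => EuclideanSpace ℝ (Fin d)

theorem H2Path.isH2_apply (γ : H2Path d 𝔼) (i : Fin d) : IsH2 (fun t => γ.path t i) :=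
  γ.isH2_path (f := fun x => x i)
    (contMDiff_iff_contDiff.2 (EuclideanSpace.proj (𝕜 := ℝ) i).contDiff)

/-- The velocity of a path in Euclidean space. -/
def vel (γ : H2Path d 𝔼) (t : ℝ) : 𝔼 := WithLp.toLp 2 fun i => d1 (fun s => γ.path s i) t

theorem hasDerivWithinAt_path (γ : H2Path d 𝔼) {t : ℝ} (ht : t ∈ Icc (0 : ℝ) 1) :
    HasDerivWithinAt γ.path (vel γ t) (Icc 0 1) t :=
  hasDerivWithinAt_euclidean fun i => (γ.isH2_apply i).hasDerivWithinAt ht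

theorem toPhase_jet (γ : H2Path d 𝔼) {t : ℝ} (ht : t ∈ Icc (0 : ℝ) 1) :
    toPhase (jet t γ) = (γ.path t, vel γ t) := by
  refine Prod.ext rfl ?_
  have h := (hasDerivWithinAt_path γ ht).derivWithin (uniqueDiffOn_Icc zero_lt_one t ht)
  have h2 : mfderivWithin 𝓘(ℝ, ℝ) (𝓡 d) γ.path (Icc 0 1) t (1 : ℝ) =
      fderivWithin ℝ γ.path (Icc 0 1) t 1 := by rw [mfderivWithin_eq_fderivWithin]; rfl
  exact h2.trans h

theorem toPhase_injective : Function.Injective (toPhase (d := d)) := by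
  rintro ⟨x, v⟩ ⟨y, w⟩ h
  obtain ⟨rfl, h2⟩ := Prod.mk.inj h
  congr

theorem coordVec_euclidean (p y : 𝔼) (i : Fin d) :
    coordVec p y i = (EuclideanSpace.single i (1 : ℝ) : 𝔼) := by
  have h1 : ((extChartAt (𝓡 d) p).symm : 𝔼 → 𝔼) = id := by rw [extChartAt_model_space_eq_id]; rfl
  have h2 : mfderiv 𝓘(ℝ, 𝔼) (𝓡 d) (extChartAt (𝓡 d) p).symm y =
      fderiv ℝ (extChartAt (𝓡 d) p).symm y := mfderiv_eq_fderiv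
  exact congrArg (fun L : 𝔼 →L[ℝ] 𝔼 => L (EuclideanSpace.single i 1))
    (h2.trans ((by rw [h1, fderiv_id]) : _ = ContinuousLinearMap.id ℝ 𝔼))

theorem euclideanMetric_inner (x : 𝔼) (v w : TangentSpace (𝓡 d) x) :
    (euclideanMetric d).inner x v w = inner ℝ (show 𝔼 from v) (show 𝔼 from w) := rfl

theorem christoffel_euclidean (p : 𝔼) (k i j : Fin d) :
    christoffel (euclideanMetric d) p k i j = 0 := by
  have h : ∀ i j l, metricDeriv (euclideanMetric d) p i j l = 0 := by
    intro i j l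
    have : (fun y => metricCoeff (euclideanMetric d) p y j l) = fun _ =>
        inner ℝ (EuclideanSpace.single j (1 : ℝ) : 𝔼) (EuclideanSpace.single l (1 : ℝ) : 𝔼) := by
      ext y
      simp only [metricCoeff, Matrix.of_apply]
      rw [euclideanMetric_inner, coordVec_euclidean, coordVec_euclidean]
    rw [metricDeriv, this]
    simp
  simp [christoffel, h]

theorem covAccel_euclidean (γ : H2Path d 𝔼) {t : ℝ} (ht : t ∈ Ioo (0 : ℝ) 1)
    (h : ∀ i, HasDerivAt (d1 fun s => γ.path s i) (d2 (fun s => γ.path s i) t) t) :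
    covAccel (euclideanMetric d) γ t =
      (WithLp.toLp 2 fun i => d2 (fun s => γ.path s i) t : 𝔼) := by
  have hn := Icc_mem_nhds ht.1 ht.2
  have h1 : iteratedDerivWithin 2 γ.path (Icc 0 1) t =
      (WithLp.toLp 2 fun i => d2 (fun s => γ.path s i) t : 𝔼) := by
    rw [show (2 : ℕ) = 1 + 1 from rfl, iteratedDerivWithin_succ, iteratedDerivWithin_one,
      derivWithin_of_mem_nhds hn]
    have hv : HasDerivAt (vel γ) (WithLp.toLp 2 fun i => d2 (fun s => γ.path s i) t : 𝔼) t :=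
      hasDerivAt_euclidean h
    refine (hv.congr_of_eventuallyEq ?_).deriv
    filter_upwards [hn] with s hs
    exact (hasDerivWithinAt_path γ hs).derivWithin (uniqueDiffOn_Icc zero_lt_one s hs)
  unfold covAccel
  simp only [extChartAt_model_space_eq_id, PartialEquiv.refl_coe, id_eq, christoffel_euclidean,
    zero_mul, Finset.sum_const_zero]
  rw [h1]
  exact (add_zero _ : (_ : 𝔼) + 0 = _)

theorem energy_euclidean (γ : H2Path d 𝔼) : energy (euclideanMetric d) γ =
    ENNReal.ofReal (∑ i, ∫ t, d2 (fun s => γ.path s i) t ^ 2 ∂unitVol) := by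
  have hint : ∀ i, Integrable (fun t => d2 (fun s => γ.path s i) t ^ 2) unitVol := fun i =>
    (γ.isH2_apply i).memLp_d2.integrable_sq
  rw [← integral_finsetSum _ fun i _ => hint i, ofReal_integral_eq_lintegral_ofReal
    (integrable_finsetSum _ fun i _ => hint i)
    (ae_of_all _ fun t => Finset.sum_nonneg fun i _ => sq_nonneg _)]
  refine lintegral_congr_ae ?_
  have h : ∀ᵐ t ∂unitVol, ∀ i, HasDerivAt (d1 fun s => γ.path s i) (d2 (fun s => γ.path s i) t) t :=
    ae_all_iff.2 fun i => (γ.isH2_apply i).ae_hasDerivAt_d1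
  filter_upwards [h, ae_unitVol_mem_Ioo] with t h1 h2
  rw [covAccel_euclidean γ h2 h1]
  change ENNReal.ofReal (inner ℝ (WithLp.toLp 2 fun i => d2 (fun s => γ.path s i) t : 𝔼)
    (WithLp.toLp 2 fun i => d2 (fun s => γ.path s i) t : 𝔼)) = _
  rw [PiLp.inner_apply]
  simp [pow_two]

theorem cph_eq_sum (p q : Phase d) : cph p q = ∑ i, (12 * (p.1 i - q.1 i) ^ 2 +
    4 * (p.2 i ^ 2 + q.2 i ^ 2 + p.2 i * q.2 i + 3 * ((p.2 i + q.2 i) * (p.1 i - q.1 i)))) := by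
  simp only [cph, EuclideanSpace.real_norm_sq_eq, PiLp.inner_apply, Finset.sum_add_distrib,
    ← Finset.mul_sum]
  simp [mul_comm]

/-- The defect of a path from being the Hermite cubic. -/
def defect (γ : H2Path d 𝔼) (i : Fin d) : ℝ :=
  ∫ t, (d2 (fun s => γ.path s i) t -
    hermiteAcc (γ.path 0 i) (vel γ 0 i) (γ.path 1 i) (vel γ 1 i) t) ^ 2 ∂unitVol

theorem defect_nonneg (γ : H2Path d 𝔼) (i : Fin d) : 0 ≤ defect γ i :=
  integral_nonneg fun _ => sq_nonneg _

theorem energy_eq_cph_add (γ : H2Path d 𝔼) : energy (euclideanMetric d) γ =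
    ENNReal.ofReal (cph (toPhase (jet 0 γ)) (toPhase (jet 1 γ)) + ∑ i, defect γ i) := by
  rw [energy_euclidean, toPhase_jet γ (left_mem_Icc.2 zero_le_one),
    toPhase_jet γ (right_mem_Icc.2 zero_le_one), cph_eq_sum, ← Finset.sum_add_distrib]
  congr 1
  exact Finset.sum_congr rfl fun i _ => (γ.isH2_apply i).integral_d2_sq

theorem cph_nonneg (p q : Phase d) : 0 ≤ cph p q := by
  rw [cph_eq_sum]
  refine Finset.sum_nonneg fun i _ => ?_
  -- Each summand equals 12 (y - x - (v + w)/2)² + (w - v)².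
  nlinarith [sq_nonneg (q.1 i - p.1 i - (p.2 i + q.2 i) / 2), sq_nonneg (q.2 i - p.2 i)]

theorem hermite_apply (p q : Phase d) (t : ℝ) (i : Fin d) : hermite p q t i =
    p.1 i + t * p.2 i + t ^ 2 * (3 * (q.1 i - p.1 i) - 2 * p.2 i - q.2 i)
      + t ^ 3 * (2 * (p.1 i - q.1 i) + p.2 i + q.2 i) := by
  simp only [hermite, PiLp.add_apply, PiLp.sub_apply, PiLp.smul_apply, smul_eq_mul]

theorem hermitePath_path (p q : TangentBundle (𝓡 d) 𝔼) {t : ℝ} (ht : t ∈ Icc (0 : ℝ) 1) :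
    (hermitePath p q).path t = hermite (toPhase p) (toPhase q) t := by
  simp only [H2Path.path, projIcc_of_mem zero_le_one ht]; rfl

theorem d1_hermitePath (p q : TangentBundle (𝓡 d) 𝔼) (i : Fin d) {t : ℝ} (ht : t ∈ Icc (0 : ℝ) 1) :
    d1 (fun s => (hermitePath p q).path s i) t = (toPhase p).2 i
      + 2 * t * (3 * ((toPhase q).1 i - (toPhase p).1 i) - 2 * (toPhase p).2 i - (toPhase q).2 i)
      + 3 * t ^ 2 * (2 * ((toPhase p).1 i - (toPhase q).1 i) + (toPhase p).2 i + (toPhase q).2 i) := by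
  refine (IsH2.d1_congr (v := fun t => (toPhase p).1 i + t * (toPhase p).2 i
    + t ^ 2 * (3 * ((toPhase q).1 i - (toPhase p).1 i) - 2 * (toPhase p).2 i - (toPhase q).2 i)
    + t ^ 3 * (2 * ((toPhase p).1 i - (toPhase q).1 i) + (toPhase p).2 i + (toPhase q).2 i))
    (fun s hs => by simp only [hermitePath_path p q hs, hermite_apply]) ht).trans ?_
  refine IsH2.d1_eq_of_hasDerivWithinAt ht (HasDerivAt.hasDerivWithinAt ?_)
  refine (((((hasDerivAt_id t).mul_const _).const_add _).add
    ((hasDerivAt_pow 2 t).mul_const _)).add ((hasDerivAt_pow 3 t).mul_const _)).congr_deriv ?_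
  push_cast
  ring

theorem d2_hermitePath (p q : TangentBundle (𝓡 d) 𝔼) (i : Fin d) {t : ℝ} (ht : t ∈ Ioo (0 : ℝ) 1) :
    d2 (fun s => (hermitePath p q).path s i) t =
      hermiteAcc ((toPhase p).1 i) ((toPhase p).2 i) ((toPhase q).1 i) ((toPhase q).2 i) t := by
  refine IsH2.d2_eq_of_hasDerivAt ht (fun s hs => d1_hermitePath p q i hs) ?_
  have h1 := ((hasDerivAt_id t).const_mul 2).mul_const
    (3 * ((toPhase q).1 i - (toPhase p).1 i) - 2 * (toPhase p).2 i - (toPhase q).2 i)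
  have h2 := ((hasDerivAt_pow 2 t).const_mul 3).mul_const
    (2 * ((toPhase p).1 i - (toPhase q).1 i) + (toPhase p).2 i + (toPhase q).2 i)
  refine ((h1.const_add ((toPhase p).2 i)).add h2).congr_deriv ?_
  rw [hermiteAcc]
  push_cast
  ring

theorem jet_zero_hermitePath (p q : TangentBundle (𝓡 d) 𝔼) : jet 0 (hermitePath p q) = p := by
  have h0 : (0 : ℝ) ∈ Icc (0 : ℝ) 1 := left_mem_Icc.2 zero_le_one
  apply toPhase_injective
  rw [toPhase_jet _ h0]
  refine Prod.ext ?_ ?_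
  · simp [hermitePath_path p q h0, hermite]
  · ext i
    simp [vel, d1_hermitePath p q i h0]

theorem jet_one_hermitePath (p q : TangentBundle (𝓡 d) 𝔼) : jet 1 (hermitePath p q) = q := by
  have h0 : (1 : ℝ) ∈ Icc (0 : ℝ) 1 := right_mem_Icc.2 zero_le_one
  apply toPhase_injective
  rw [toPhase_jet _ h0]
  refine Prod.ext ?_ ?_
  · ext i
    simp only [hermitePath_path p q h0, hermite_apply]
    ring
  · ext i
    simp only [vel, d1_hermitePath p q i h0]
    ring

theorem defect_hermitePath (p q : TangentBundle (𝓡 d) 𝔼) (i : Fin d) :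
    defect (hermitePath p q) i = 0 := by
  rw [defect, integral_eq_zero_of_ae]
  filter_upwards [ae_unitVol_mem_Ioo] with t ht
  have h1 := toPhase_jet (hermitePath p q) (left_mem_Icc.2 zero_le_one)
  have h2 := toPhase_jet (hermitePath p q) (right_mem_Icc.2 zero_le_one)
  rw [jet_zero_hermitePath] at h1
  rw [jet_one_hermitePath] at h2
  rw [d2_hermitePath p q i ht, h1, h2]
  simp

theorem energy_hermitePath (p q : TangentBundle (𝓡 d) 𝔼) :
    energy (euclideanMetric d) (hermitePath p q) = ENNReal.ofReal (cph (toPhase p) (toPhase q)) := by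
  rw [energy_eq_cph_add, jet_zero_hermitePath, jet_one_hermitePath]
  simp [defect_hermitePath]

theorem ofReal_cph_le_energy (γ : H2Path d 𝔼) :
    ENNReal.ofReal (cph (toPhase (jet 0 γ)) (toPhase (jet 1 γ))) ≤ energy (euclideanMetric d) γ := by
  rw [energy_eq_cph_add]
  exact ENNReal.ofReal_le_ofReal
    (le_add_of_nonneg_right (Finset.sum_nonneg fun i _ => defect_nonneg γ i))

theorem eq_hermitePath_of_energy_le (γ : H2Path d 𝔼) (h : energy (euclideanMetric d) γ ≤
    ENNReal.ofReal (cph (toPhase (jet 0 γ)) (toPhase (jet 1 γ)))) :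
    γ = hermitePath (jet 0 γ) (jet 1 γ) := by
  rw [energy_eq_cph_add, ENNReal.ofReal_le_ofReal_iff (cph_nonneg _ _)] at h
  have h0 : ∑ i, defect γ i = 0 :=
    le_antisymm (by linarith) (Finset.sum_nonneg fun i _ => defect_nonneg γ i)
  rw [Finset.sum_eq_zero_iff_of_nonneg fun i _ => defect_nonneg γ i] at h0
  refine H2Path.ext_path fun t ht => ?_
  ext i
  have h1 := h0 i (Finset.mem_univ i)
  have hm : MemLp (fun t => d2 (fun s => γ.path s i) t -
      hermiteAcc (γ.path 0 i) (vel γ 0 i) (γ.path 1 i) (vel γ 1 i) t) 2 unitVol :=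
    (γ.isH2_apply i).memLp_d2.sub (memLp_continuousOn (continuous_hermiteAcc _ _ _ _).continuousOn)
  rw [defect, integral_eq_zero_iff_of_nonneg (fun _ => sq_nonneg _) hm.integrable_sq] at h1
  have h2 : d2 (fun s => γ.path s i) =ᵐ[unitVol]
      hermiteAcc (γ.path 0 i) (vel γ 0 i) (γ.path 1 i) (vel γ 1 i) := by
    filter_upwards [h1] with s hs
    exact sub_eq_zero.1 (pow_eq_zero_iff two_ne_zero |>.1 hs)
  rw [hermitePath_path _ _ ht, hermite_apply, toPhase_jet γ (left_mem_Icc.2 zero_le_one),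
    toPhase_jet γ (right_mem_Icc.2 zero_le_one)]
  exact (γ.isH2_apply i).eq_hermite h2 ht

theorem isCubicSpline_iff (γ : H2Path d 𝔼) :
    IsCubicSpline (euclideanMetric d) γ ↔ γ = hermitePath (jet 0 γ) (jet 1 γ) := by
  constructor
  · intro h
    apply eq_hermitePath_of_energy_le
    rw [← energy_hermitePath]
    exact h _ (jet_zero_hermitePath _ _) (jet_one_hermitePath _ _)
  · intro h η h0 h1
    rw [h, energy_hermitePath, ← h0, ← h1]
    exact ofReal_cph_le_energy η

/-! ### The twist condition -/

/-- The derivative of the cost in its first variable. -/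
def cphDeriv (p q : Phase d) : Phase d →L[ℝ] ℝ :=
  (innerSL ℝ ((24 : ℝ) • (p.1 - q.1) + (12 : ℝ) • (p.2 + q.2))).comp
      (ContinuousLinearMap.fst ℝ 𝔼 𝔼) +
    (innerSL ℝ ((8 : ℝ) • p.2 + (4 : ℝ) • q.2 + (12 : ℝ) • (p.1 - q.1))).comp
      (ContinuousLinearMap.snd ℝ 𝔼 𝔼)

theorem hasFDerivAt_cph (p q : Phase d) : HasFDerivAt (fun p' => cph p' q) (cphDeriv p q) p := by
  have h1 : HasFDerivAt (fun p' : Phase d => p'.1) (ContinuousLinearMap.fst ℝ 𝔼 𝔼) p :=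
    hasFDerivAt_fst
  have h2 : HasFDerivAt (fun p' : Phase d => p'.2) (ContinuousLinearMap.snd ℝ 𝔼 𝔼) p :=
    hasFDerivAt_snd
  have h := ((h1.sub_const q.1).norm_sq.const_mul 12).add
    (((h2.norm_sq.add_const (‖q.2‖ ^ 2)).add (h2.inner ℝ (hasFDerivAt_const q.2 p))).add
      (((h2.add_const q.2).inner ℝ (h1.sub_const q.1)).const_mul 3) |>.const_mul 4)
  refine h.congr_fderiv ?_
  ext z <;>
  · simp [cphDeriv, inner_add_left, inner_sub_right, real_inner_comm]
    ring

theorem twistCondition_cph : TwistCondition (d := d) cph := by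
  refine ⟨fun q p => (hasFDerivAt_cph p q).differentiableAt, fun p q r h => ?_⟩
  simp only [(hasFDerivAt_cph p _).fderiv] at h
  have e1 : (24 : ℝ) • (p.1 - q.1) + (12 : ℝ) • (p.2 + q.2) =
      (24 : ℝ) • (p.1 - r.1) + (12 : ℝ) • (p.2 + r.2) := by
    refine ext_inner_right ℝ fun z => ?_
    have := congrArg (fun L => L (z, 0)) h
    simpa [cphDeriv, inner_add_left, inner_sub_left, inner_smul_left] using this
  have e2 : (8 : ℝ) • p.2 + (4 : ℝ) • q.2 + (12 : ℝ) • (p.1 - q.1) =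
      (8 : ℝ) • p.2 + (4 : ℝ) • r.2 + (12 : ℝ) • (p.1 - r.1) := by
    refine ext_inner_right ℝ fun z => ?_
    have := congrArg (fun L => L (0, z)) h
    simpa [cphDeriv, inner_add_left, inner_sub_left, inner_smul_left] using this
  -- The gradient is affine in q = (y, w), with linear part (-24 y + 12 w, -12 y + 4 w); its
  -- coefficient matrix has determinant 48, so the two equations determine y and w.
  refine Prod.ext ?_ ?_ <;> ext i
  all_goals
    have f1 := congrArg (fun z : 𝔼 => z i) e1
    have f2 := congrArg (fun z : 𝔼 => z i) e2
    simp only [PiLp.add_apply, PiLp.sub_apply, PiLp.smul_apply, smul_eq_mul] at f1 f2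
    linarith

/-! ### Phase space as a topological space -/

/-- The tangent bundle of `ℝ^d` is homeomorphic to `ℝ^d × ℝ^d`. -/
def phaseHomeo (d : ℕ) : TangentBundle (𝓡 d) (EuclideanSpace ℝ (Fin d)) ≃ₜ Phase d :=
  tangentBundleModelSpaceHomeomorph (𝓡 d)

theorem continuous_toPhase : Continuous (toPhase (d := d)) := (phaseHomeo d).continuous

theorem isH2_pow (k : ℕ) : IsH2 (fun t => t ^ k) :=
  isH2_of_contDiff (contDiff_id.pow k) fun _ _ => rfl

/-- Each coordinate is a combination of the fixed functions 1, t, t², t³ with coefficients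
continuous in the end data. -/
theorem continuous_hermitePath : Continuous
    (fun z : TangentBundle (𝓡 d) 𝔼 × TangentBundle (𝓡 d) 𝔼 => hermitePath z.1 z.2) := by
  rw [continuous_iff_continuousAt]
  intro z₀
  have hcoef : ∀ {F : Phase d → Phase d → ℝ}, Continuous (fun z : Phase d × Phase d => F z.1 z.2) →
      Tendsto (fun z : TangentBundle (𝓡 d) 𝔼 × TangentBundle (𝓡 d) 𝔼 =>
        F (toPhase z.1) (toPhase z.2)) (𝓝 z₀) (𝓝 (F (toPhase z₀.1) (toPhase z₀.2))) := fun hF =>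
    (hF.comp ((continuous_toPhase.comp continuous_fst).prodMk
      (continuous_toPhase.comp continuous_snd))).tendsto z₀
  have key : ∀ i, H2Tendsto (fun (z : TangentBundle (𝓡 d) 𝔼 × TangentBundle (𝓡 d) 𝔼) t =>
      (hermitePath z.1 z.2).path t i) (fun t => (hermitePath z₀.1 z₀.2).path t i) (𝓝 z₀) := by
    intro i
    have t0 := H2Tendsto.const_mul (hcoef (F := fun p _ => p.1 i) (by fun_prop)) (isH2_pow 0)
    have t1 := H2Tendsto.const_mul (hcoef (F := fun p _ => p.2 i) (by fun_prop)) (isH2_pow 1)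
    have t2 := H2Tendsto.const_mul (hcoef (F := fun p q => 3 * (q.1 i - p.1 i) - 2 * p.2 i - q.2 i)
      (by fun_prop)) (isH2_pow 2)
    have t3 := H2Tendsto.const_mul (hcoef (F := fun p q => 2 * (p.1 i - q.1 i) + p.2 i + q.2 i)
      (by fun_prop)) (isH2_pow 3)
    have hp := fun (k : ℕ) (c : ℝ) => (isH2_pow k).const_mul c
    have := ((t0.add t1 (fun _ => hp 0 _) (hp 0 _) (fun _ => hp 1 _) (hp 1 _)).add t2
      (fun _ => (hp 0 _).add (hp 1 _)) ((hp 0 _).add (hp 1 _)) (fun _ => hp 2 _) (hp 2 _)).add t3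
      (fun _ => ((hp 0 _).add (hp 1 _)).add (hp 2 _)) (((hp 0 _).add (hp 1 _)).add (hp 2 _))
      (fun _ => hp 3 _) (hp 3 _)
    refine this.congr (Eventually.of_forall fun z t ht => ?_) fun t ht => ?_
    · simp only [hermitePath_path _ _ ht, hermite_apply]
      ring
    · simp only [hermitePath_path _ _ ht, hermite_apply]
      ring
  exact tendsto_h2Path_iff.2 fun f hf => H2Tendsto.comp key (fun z i =>
    (hermitePath z.1 z.2).isH2_apply i) (fun i => (hermitePath z₀.1 z₀.2).isH2_apply i)
    (contMDiff_iff_contDiff.1 hf)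

end EuclideanPaths

/-! ### Optimal plans -/

section Plans

variable {X Y : Type*} [MeasurableSpace X] [MeasurableSpace Y]

/-- Transport plans between two measures. -/
structure IsPlan (μ : Measure X) (ν : Measure Y) (θ : Measure (X × Y)) : Prop where
  prob : IsProbabilityMeasure θ
  map_fst : θ.map Prod.fst = μ
  map_snd : θ.map Prod.snd = ν

/-- Plans of finite cost that minimize the cost among all plans with the same marginals. -/
structure IsOptimalPlan (c : X × Y → ℝ≥0∞) (μ : Measure X) (ν : Measure Y) (θ : Measure (X × Y)) :
    Prop extends IsPlan μ ν θ where
  finite : ∫⁻ z, c z ∂θ ≠ ⊤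
  le : ∀ θ' : Measure (X × Y), IsPlan μ ν θ' → ∫⁻ z, c z ∂θ ≤ ∫⁻ z, c z ∂θ'

variable {c : X × Y → ℝ≥0∞} {μ : Measure X} {ν : Measure Y} {θ : Measure (X × Y)}

/-- The pairs of points for which exchanging the targets lowers the cost. -/
def exchangeSet (c : X × Y → ℝ≥0∞) : Set ((X × Y) × (X × Y)) :=
  {w | c (w.1.1, w.2.2) + c (w.2.1, w.1.2) < c w.1 + c w.2}

theorem measurableSet_exchangeSet (hc : Measurable c) : MeasurableSet (exchangeSet c) :=
  measurableSet_lt (by fun_prop) (by fun_prop)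

theorem swap_preimage_exchangeSet (c : X × Y → ℝ≥0∞) :
    Prod.swap ⁻¹' exchangeSet c = exchangeSet c := by
  ext w
  simp only [exchangeSet, mem_preimage, mem_ofPred_eq, Prod.fst_swap, Prod.snd_swap]
  rw [add_comm (c (w.2.1, w.1.2)), add_comm (c w.2)]

open Classical in
-- Draw two independent points of θ and, whenever exchanging the targets is profitable, give the
-- first source the second target. The profitable set S is invariant under swapping the two points,
-- so the law of the first point after the exchange is still a plan; it is strictly cheaper if S has
-- positive measure.
theorem IsOptimalPlan.measure_exchangeSet (h : IsOptimalPlan c μ ν θ) (hc : Measurable c) :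
    (θ.prod θ) (exchangeSet c) = 0 := by
  have := h.prob
  by_contra hS
  have hSm := measurableSet_exchangeSet hc
  set S := exchangeSet c with hSdef
  have hsw : MeasurePreserving (Prod.swap : (X × Y) × (X × Y) → _) (θ.prod θ) (θ.prod θ) :=
    ⟨measurable_swap, Measure.prod_swap⟩
  have hfst : MeasurePreserving (Prod.fst : (X × Y) × (X × Y) → _) (θ.prod θ) θ :=
    measurePreserving_fst
  have hswS : ∀ f : (X × Y) × (X × Y) → ℝ≥0∞, Measurable f →
      ∫⁻ w in S, f w.swap ∂θ.prod θ = ∫⁻ w in S, f w ∂θ.prod θ := by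
    intro f hf
    have := hsw.setLIntegral_comp_preimage hSm hf
    rwa [hSdef, swap_preimage_exchangeSet] at this
  set T : (X × Y) × (X × Y) → X × Y := S.piecewise (fun w => (w.1.1, w.2.2)) Prod.fst with hT
  have hTm : Measurable T := Measurable.piecewise hSm (by fun_prop) (by fun_prop)
  have hplan : IsPlan μ ν ((θ.prod θ).map T) := by
    refine ⟨Measure.isProbabilityMeasure_map hTm.aemeasurable, ?_, ?_⟩
    · have hm : (θ.prod θ).map (Prod.fst ∘ Prod.fst) = μ := by
        rw [← Measure.map_map measurable_fst measurable_fst, hfst.map_eq, h.map_fst]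
      rw [Measure.map_map measurable_fst hTm, ← hm]
      congr 1
      ext1 w
      by_cases hw : w ∈ S <;> simp [hT, hw]
    · ext B hB
      have hfB : MeasurableSet {w : (X × Y) × (X × Y) | w.1.2 ∈ B} :=
        (measurable_snd.comp measurable_fst) hB
      -- Inside S the second coordinate of T is that of the other point. Swapping the points there,
      -- which preserves S and θ ⊗ θ, restores the original second marginal.
      have hpre : T ⁻¹' (Prod.snd ⁻¹' B) = (S ∩ Prod.swap ⁻¹' {w | w.1.2 ∈ B}) ∪
          ({w | w.1.2 ∈ B} \ S) := by
        ext w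
        by_cases hw : w ∈ S <;> simp [hT, hw]
      rw [Measure.map_apply measurable_snd hB, Measure.map_apply hTm (measurable_snd hB), hpre,
        measure_union (disjoint_sdiff_right.mono_left inter_subset_left) (hfB.diff hSm),
        hSdef, ← swap_preimage_exchangeSet c, ← preimage_inter,
        hsw.measure_preimage ((measurableSet_exchangeSet hc).inter hfB).nullMeasurableSet,
        swap_preimage_exchangeSet c, inter_comm, measure_inter_add_sdiff _ hSm, ← h.map_snd,
        Measure.map_apply measurable_snd hB, ← hfst.measure_preimage
          (measurable_snd hB).nullMeasurableSet]
      rfl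
  have hle := h.le _ hplan
  have hsplit : ∀ f : (X × Y) × (X × Y) → ℝ≥0∞, ∫⁻ w, f w ∂θ.prod θ =
      (∫⁻ w in S, f w ∂θ.prod θ) + ∫⁻ w in Sᶜ, f w ∂θ.prod θ := fun f =>
    (lintegral_add_compl f hSm).symm
  have e1 : ∫⁻ z, c z ∂(θ.prod θ).map T = (∫⁻ w in S, c (w.1.1, w.2.2) ∂θ.prod θ) +
      ∫⁻ w in Sᶜ, c w.1 ∂θ.prod θ := by
    rw [lintegral_map hc hTm, hsplit]
    congr 1
    · exact setLIntegral_congr_fun hSm fun w hw => by simp [hT, hw]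
    · exact setLIntegral_congr_fun hSm.compl fun w hw => by simp [hT, notMem_of_mem_compl hw]
  have e2 : ∫⁻ z, c z ∂θ = (∫⁻ w in S, c w.1 ∂θ.prod θ) + ∫⁻ w in Sᶜ, c w.1 ∂θ.prod θ := by
    rw [← hsplit (fun w => c w.1), ← hfst.lintegral_comp hc]
  have hfin := h.finite
  rw [e1, e2] at hle
  rw [e2] at hfin
  have hfin1 := (ENNReal.add_ne_top.1 hfin).1
  rw [ENNReal.add_le_add_iff_right (ENNReal.add_ne_top.1 hfin).2] at hle
  -- By swap invariance the two terms on each side of the exchange inequality have equal integrals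
  -- over S, so integrating that inequality doubles the comparison of costs contained in `hle`.
  have e3 : ∫⁻ w in S, c w.2 ∂θ.prod θ = ∫⁻ w in S, c w.1 ∂θ.prod θ :=
    hswS (fun w => c w.1) (by fun_prop)
  have e4 : ∫⁻ w in S, c (w.2.1, w.1.2) ∂θ.prod θ = ∫⁻ w in S, c (w.1.1, w.2.2) ∂θ.prod θ :=
    hswS (fun w => c (w.1.1, w.2.2)) (by fun_prop)
  have hJ : ∫⁻ w in S, (c w.1 + c w.2) ∂θ.prod θ =
      (∫⁻ w in S, c w.1 ∂θ.prod θ) + ∫⁻ w in S, c w.1 ∂θ.prod θ := by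
    rw [lintegral_add_left (by fun_prop), e3]
  have hI : ∫⁻ w in S, (c (w.1.1, w.2.2) + c (w.2.1, w.1.2)) ∂θ.prod θ =
      (∫⁻ w in S, c (w.1.1, w.2.2) ∂θ.prod θ) + ∫⁻ w in S, c (w.1.1, w.2.2) ∂θ.prod θ := by
    rw [lintegral_add_left (by fun_prop), e4]
  have hlt : ∫⁻ w in S, (c (w.1.1, w.2.2) + c (w.2.1, w.1.2)) ∂θ.prod θ <
      ∫⁻ w in S, (c w.1 + c w.2) ∂θ.prod θ := by
    refine setLIntegral_strict_mono hSm hS (by fun_prop) ?_ (ae_of_all _ fun w hw => hw)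
    refine ne_top_of_le_ne_top ?_ (setLIntegral_mono (g := fun w => c w.1 + c w.2) (by fun_prop)
      fun w hw => show _ ≤ c w.1 + c w.2 from le_of_lt hw)
    rw [hJ]
    exact ENNReal.add_ne_top.2 ⟨hfin1, hfin1⟩
  rw [hI, hJ] at hlt
  exact absurd (add_le_add hle hle) (not_le.2 hlt)

theorem half_smul_add_half_smul (m : Measure X) :
    (2⁻¹ : ℝ≥0∞) • m + (2⁻¹ : ℝ≥0∞) • m = m := by
  rw [← add_smul, ENNReal.inv_two_add_inv_two, one_smul]

theorem IsOptimalPlan.average {θ' : Measure (X × Y)} (h : IsOptimalPlan c μ ν θ)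
    (h' : IsOptimalPlan c μ ν θ') :
    IsOptimalPlan c μ ν ((2⁻¹ : ℝ≥0∞) • θ + (2⁻¹ : ℝ≥0∞) • θ') := by
  have hp := h.prob
  have hp' := h'.prob
  have heq : ∫⁻ z, c z ∂θ' = ∫⁻ z, c z ∂θ :=
    le_antisymm (h'.le _ h.toIsPlan) (h.le _ h'.toIsPlan)
  have hcost : ∫⁻ z, c z ∂((2⁻¹ : ℝ≥0∞) • θ + (2⁻¹ : ℝ≥0∞) • θ') = ∫⁻ z, c z ∂θ := by
    rw [lintegral_add_measure, lintegral_smul_measure, lintegral_smul_measure, heq, smul_eq_mul,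
      ← add_mul, ENNReal.inv_two_add_inv_two, one_mul]
  refine ⟨⟨⟨?_⟩, ?_, ?_⟩, hcost ▸ h.finite, fun θ'' h'' => hcost ▸ h.le _ h''⟩
  · simp [ENNReal.inv_two_add_inv_two]
  · rw [Measure.map_add _ _ measurable_fst, Measure.map_smul, Measure.map_smul, h.map_fst, h'.map_fst,
      half_smul_add_half_smul]
  · rw [Measure.map_add _ _ measurable_snd, Measure.map_smul, Measure.map_smul, h.map_snd, h'.map_snd,
      half_smul_add_half_smul]

/-- A plan carried by the graph of a map is the image of its first marginal. -/
theorem IsPlan.eq_map_of_ae (h : IsPlan μ ν θ) {φ : X → Y} (hφ : Measurable φ)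
    (hae : ∀ᵐ z ∂θ, z.2 = φ z.1) : θ = μ.map (fun x => (x, φ x)) := by
  rw [← h.map_fst, Measure.map_map (by fun_prop) measurable_fst]
  conv_lhs => rw [← Measure.map_id (μ := θ)]
  exact Measure.map_congr (hae.mono fun z hz => Prod.ext rfl hz)

end Plans

/-! ### Existence of optimal plans -/

section Existence

variable {X Y : Type*} [TopologicalSpace X] [PolishSpace X] [MeasurableSpace X] [BorelSpace X]
  [TopologicalSpace Y] [PolishSpace Y] [MeasurableSpace Y] [BorelSpace Y]

/-- The integral of c is the supremum over k of the integrals of the bounded continuous truncations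
min(c, k), each of which is weakly continuous. -/
theorem lowerSemicontinuous_lintegral {Z : Type*} [TopologicalSpace Z] [MeasurableSpace Z]
    [OpensMeasurableSpace Z] {c : Z → NNReal} (hc : Continuous c) :
    LowerSemicontinuous (fun θ : ProbabilityMeasure Z => ∫⁻ z, c z ∂(θ : Measure Z)) := by
  let f : ℕ → BoundedContinuousFunction Z NNReal := fun k =>
    BoundedContinuousFunction.mkOfBound ⟨fun z => min (c z) k, hc.min continuous_const⟩ k
      fun x y => by
        rw [NNReal.dist_eq]
        exact abs_sub_le_of_nonneg_of_le (NNReal.coe_nonneg _) (by simp) (NNReal.coe_nonneg _)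
          (by simp)
  have hf : ∀ k z, f k z = min (c z) k := fun _ _ => rfl
  have h1 : (fun θ : ProbabilityMeasure Z => ∫⁻ z, c z ∂(θ : Measure Z)) =
      fun θ : ProbabilityMeasure Z => ⨆ k, ∫⁻ z, (f k z : ℝ≥0∞) ∂(θ : Measure Z) := by
    ext θ
    rw [← lintegral_iSup (fun k => (f k).continuous.measurable.coe_nnreal_ennreal)
      fun i j hij z => ENNReal.coe_le_coe.2 (by
        rw [hf, hf]; exact min_le_min_left _ (by exact_mod_cast hij))]
    refine lintegral_congr fun z => le_antisymm ?_ (iSup_le fun k => ?_)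
    · obtain ⟨k, hk⟩ := exists_nat_ge (c z)
      exact le_iSup_of_le k (by rw [hf, min_eq_left hk])
    · rw [hf]
      exact ENNReal.coe_le_coe.2 (min_le_left _ _)
  rw [h1]
  refine lowerSemicontinuous_iSup fun k => Continuous.lowerSemicontinuous ?_
  rw [continuous_iff_continuousAt]
  exact fun θ => (ProbabilityMeasure.tendsto_iff_forall_lintegral_tendsto.1 tendsto_id) (f k)

/-- On Polish spaces the marginals are tight, hence so is the set of plans; being weakly closed it
is compact by Prokhorov's theorem, and the lower semicontinuous cost attains its minimum on it. -/
theorem exists_isOptimalPlan {c : X × Y → NNReal} (hc : Continuous c) {μ : Measure X}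
    {ν : Measure Y} [IsProbabilityMeasure μ] [IsProbabilityMeasure ν]
    (h : ∃ θ, IsPlan μ ν θ ∧ ∫⁻ z, c z ∂θ ≠ ⊤) :
    ∃ θ, IsOptimalPlan (fun z => (c z : ℝ≥0∞)) μ ν θ := by
  obtain ⟨θ₀, h₀, hfin⟩ := h
  let μ' : ProbabilityMeasure X := ⟨μ, inferInstance⟩
  let ν' : ProbabilityMeasure Y := ⟨ν, inferInstance⟩
  let K : Set (ProbabilityMeasure (X × Y)) := {θ | IsPlan μ ν (θ : Measure (X × Y))}
  have hKc : IsClosed K := by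
    have e : K = (fun θ : ProbabilityMeasure (X × Y) =>
          θ.map continuous_fst.measurable.aemeasurable) ⁻¹' {μ'} ∩
        (fun θ : ProbabilityMeasure (X × Y) =>
          θ.map continuous_snd.measurable.aemeasurable) ⁻¹' {ν'} := by
      ext θ
      exact ⟨fun h => ⟨Subtype.ext h.map_fst, Subtype.ext h.map_snd⟩,
        fun h => ⟨θ.2, congrArg Subtype.val h.1, congrArg Subtype.val h.2⟩⟩
    rw [e]
    exact (isClosed_singleton.preimage (ProbabilityMeasure.continuous_map continuous_fst)).inter
      (isClosed_singleton.preimage (ProbabilityMeasure.continuous_map continuous_snd))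
  have hK : IsCompact K := by
    rw [← hKc.closure_eq]
    apply isCompact_closure_of_isTightMeasureSet
    refine IsTightMeasureSet.prodMk ?_ ?_
    · refine (isTightMeasureSet_singleton (μ := μ)).subset ?_
      rintro _ ⟨_, ⟨θ, hθ, rfl⟩, rfl⟩
      exact hθ.map_fst
    · refine (isTightMeasureSet_singleton (μ := ν)).subset ?_
      rintro _ ⟨_, ⟨θ, hθ, rfl⟩, rfl⟩
      exact hθ.map_snd
  obtain ⟨θ, hθ, hmin⟩ := LowerSemicontinuousOn.exists_isMinOn (s := K) ⟨⟨θ₀, h₀.prob⟩, h₀⟩ hK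
    ((lowerSemicontinuous_lintegral hc).lowerSemicontinuousOn K)
  have hle : ∀ θ' : Measure (X × Y), IsPlan μ ν θ' →
      ∫⁻ z, c z ∂(θ : Measure (X × Y)) ≤ ∫⁻ z, c z ∂θ' := fun θ' h' =>
    hmin (show (⟨θ', h'.prob⟩ : ProbabilityMeasure (X × Y)) ∈ K from h')
  exact ⟨θ, hθ, ne_top_of_le_ne_top hfin (hle θ₀ h₀), hle⟩

end Existence

/-! ### Monotone sets and optimal maps for the quadratic cost -/

section Monotone

variable {F : Type*} [NormedAddCommGroup F] [InnerProductSpace ℝ F]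

/-- Monotone subsets of `F × F`. -/
def MonotoneSet (Γ : Set (F × F)) : Prop :=
  ∀ z ∈ Γ, ∀ w ∈ Γ, 0 ≤ inner ℝ (z.1 - w.1) (z.2 - w.2)

/-- Minty's transform: in the expansion of |Δx + Δy|² the cross term is nonnegative by monotonicity.
-/
theorem MonotoneSet.norm_fst_sub_le {Γ : Set (F × F)} (h : MonotoneSet Γ) {z w : F × F}
    (hz : z ∈ Γ) (hw : w ∈ Γ) : ‖z.1 - w.1‖ ≤ ‖(z.1 + z.2) - (w.1 + w.2)‖ := by
  have h1 := h z hz w hw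
  have h2 : (z.1 + z.2) - (w.1 + w.2) = (z.1 - w.1) + (z.2 - w.2) := by abel
  rw [h2]
  refine le_of_sq_le_sq ?_ (norm_nonneg _)
  rw [norm_add_sq_real]
  nlinarith [sq_nonneg ‖z.2 - w.2‖]

open Classical in
-- On a monotone set x is a 1-Lipschitz function of x + y. The extension to the whole space may have
-- a larger constant, which is harmless: only Lipschitz continuity is used, for differentiability
-- almost everywhere.
theorem MonotoneSet.exists_resolvent [FiniteDimensional ℝ F] {Γ : Set (F × F)}
    (h : MonotoneSet Γ) : ∃ (K : NNReal) (R : F → F), LipschitzWith K R ∧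
      ∀ z ∈ Γ, R (z.1 + z.2) = z.1 := by
  let R₀ : F → F := fun u => if hu : ∃ z ∈ Γ, z.1 + z.2 = u then hu.choose.1 else 0
  have hR₀ : ∀ z ∈ Γ, R₀ (z.1 + z.2) = z.1 := by
    intro z hz
    have hu : ∃ w ∈ Γ, w.1 + w.2 = z.1 + z.2 := ⟨z, hz, rfl⟩
    have h1 := h.norm_fst_sub_le hu.choose_spec.1 hz
    rw [hu.choose_spec.2, sub_self, norm_zero] at h1
    simp only [R₀, dif_pos hu]
    exact sub_eq_zero.1 (norm_le_zero_iff.1 h1)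
  have hlip : LipschitzOnWith 1 R₀ ((fun z : F × F => z.1 + z.2) '' Γ) := by
    refine LipschitzOnWith.of_dist_le_mul ?_
    rintro _ ⟨z, hz, rfl⟩ _ ⟨w, hw, rfl⟩
    simp only [hR₀ z hz, hR₀ w hw, NNReal.coe_one, one_mul, dist_eq_norm]
    exact h.norm_fst_sub_le hz hw
  obtain ⟨R, hR, heq⟩ := hlip.extend_finite_dimension
  exact ⟨_, R, hR, fun z hz => by rw [← heq ⟨z, hz, rfl⟩, hR₀ z hz]⟩

/-- The fibrewise segments of a set. -/
def segmentHull (Γ : Set (F × F)) : Set (F × F) :=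
  {z | ∃ y y' : F, (z.1, y) ∈ Γ ∧ (z.1, y') ∈ Γ ∧ ∃ t ∈ Icc (0 : ℝ) 1, z.2 = y + t • (y' - y)}

/-- The pairing is affine in each of the two segment parameters, so it is a convex combination of
the four nonnegative pairings of the end points. Over a multivalued point x the resolvent is thus
equal to x on a whole segment. -/
theorem MonotoneSet.segmentHull {Γ : Set (F × F)} (h : MonotoneSet Γ) :
    MonotoneSet (segmentHull Γ) := by
  rintro ⟨x, _⟩ ⟨y, y', hy, hy', t, ht, rfl⟩ ⟨x₁, _⟩ ⟨y₁, y₁', hy₁, hy₁', t₁, ht₁, rfl⟩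
  have h1 := h _ hy _ hy₁
  have h2 := h _ hy _ hy₁'
  have h3 := h _ hy' _ hy₁
  have h4 := h _ hy' _ hy₁'
  simp only [inner_sub_right] at h1 h2 h3 h4
  simp only [inner_sub_right, inner_add_right, inner_smul_right]
  set a := inner ℝ (x - x₁) y
  set a' := inner ℝ (x - x₁) y'
  set b := inner ℝ (x - x₁) y₁
  set b' := inner ℝ (x - x₁) y₁'
  have s0 : 0 ≤ 1 - t := by linarith [ht.2]
  have s1 : 0 ≤ 1 - t₁ := by linarith [ht₁.2]
  have e : a + t * (a' - a) - (b + t₁ * (b' - b)) = (1 - t) * (1 - t₁) * (a - b)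
      + (1 - t) * t₁ * (a - b') + t * (1 - t₁) * (a' - b) + t * t₁ * (a' - b') := by ring
  rw [e]
  have := mul_nonneg (mul_nonneg s0 s1) h1
  have := mul_nonneg (mul_nonneg s0 ht₁.1) h2
  have := mul_nonneg (mul_nonneg ht.1 s1) h3
  have := mul_nonneg (mul_nonneg ht.1 ht₁.1) h4
  linarith

/-- The points over which a set has several values. -/
def multiDomain (Γ : Set (F × F)) : Set F :=
  {x | ∃ y y', y ≠ y' ∧ (x, y) ∈ Γ ∧ (x, y') ∈ Γ}

variable [FiniteDimensional ℝ F] [MeasurableSpace F] [BorelSpace F]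

/-- Over a multivalued point x the resolvent R is constant on a segment issuing from x + y. So x is
the image under R either of a point where R is not differentiable, or of a point where its
differential has a kernel. The first set of points is null by Rademacher's theorem and has null
Lipschitz image; the second has null image by the Sard estimate in equal dimensions. -/
theorem MonotoneSet.measure_multiDomain {Γ : Set (F × F)} (h : MonotoneSet Γ) (ν : Measure F)
    [ν.IsAddHaarMeasure] : ν (multiDomain Γ) = 0 := by
  -- The Hausdorff measure of full dimension is itself a Haar measure, and the bound for Lipschitz
  -- images applies to it directly.
  let m : Measure F := Measure.hausdorffMeasure (Module.finrank ℝ F)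
  have hνm : ν ≪ m := Measure.absolutelyContinuous_isAddHaarMeasure ν m
  apply hνm
  obtain ⟨K, R, hR, hRΓ⟩ := h.segmentHull.exists_resolvent
  let N : Set F := {u | ¬ DifferentiableAt ℝ R u}
  let C : Set F := {u | DifferentiableAt ℝ R u ∧ (fderiv ℝ R u).det = 0}
  have hN : m (R '' N) = 0 := by
    have h0 : m N = 0 := hR.ae_differentiableAt (μ := m)
    refine le_antisymm ((hR.lipschitzOnWith.hausdorffMeasure_image_le (s := N)
      (Nat.cast_nonneg _)).trans ?_) zero_le
    change _ * m N ≤ 0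
    rw [h0, mul_zero]
  have hC : m (R '' C) = 0 := addHaar_image_eq_zero_of_det_fderivWithin_eq_zero m
    (fun u hu => hu.1.hasFDerivAt.hasFDerivWithinAt) fun u hu => hu.2
  refine measure_mono_null ?_ (measure_union_null hN hC)
  rintro x ⟨y, y', hne, hy, hy'⟩
  have hseg : ∀ t ∈ Icc (0 : ℝ) 1, R (x + y + t • (y' - y)) = x := by
    intro t ht
    have := hRΓ (x, y + t • (y' - y)) ⟨y, y', hy, hy', t, ht, rfl⟩
    rwa [← add_assoc] at this
  have h0 : R (x + y) = x := by simpa using hseg 0 (left_mem_Icc.2 zero_le_one)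
  by_cases hd : DifferentiableAt ℝ R (x + y)
  · refine Or.inr ⟨x + y, ⟨hd, ?_⟩, h0⟩
    have hline : HasDerivAt (fun t : ℝ => x + y + t • (y' - y)) (y' - y) 0 := by
      simpa using ((hasDerivAt_id (0 : ℝ)).smul_const (y' - y)).const_add (x + y)
    have hd' : HasFDerivAt R (fderiv ℝ R (x + y)) (x + y + (0 : ℝ) • (y' - y)) := by
      simpa using hd.hasFDerivAt
    have h1 := (hd'.comp_hasDerivAt (0 : ℝ) hline).hasDerivWithinAt (s := Icc 0 1)
    have h2 : HasDerivWithinAt (R ∘ fun t : ℝ => x + y + t • (y' - y)) 0 (Icc 0 1) 0 :=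
      (hasDerivWithinAt_const 0 _ x).congr hseg (hseg 0 (left_mem_Icc.2 zero_le_one))
    -- The segment begins at x + y, so only one-sided derivatives at 0 are compared.
    have h3 : fderiv ℝ R (x + y) (y' - y) = 0 :=
      (uniqueDiffOn_Icc zero_lt_one 0 (left_mem_Icc.2 zero_le_one)).eq_deriv _ h1 h2
    by_contra hdet
    have hinj := (LinearMap.equivOfDetNeZero (fderiv ℝ R (x + y)).toLinearMap hdet).injective
    exact hne (sub_eq_zero.1 (hinj (by simpa using h3))).symm
  · exact Or.inl ⟨x + y, hd, h0⟩

theorem isOpen_exchangeSet {X Y : Type*} [TopologicalSpace X] [TopologicalSpace Y]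
    {c : X × Y → ℝ≥0∞} (hc : Continuous c) : IsOpen (exchangeSet c) :=
  isOpen_lt (by fun_prop) (by fun_prop)

/-- The quadratic cost. -/
def quadCost (z : F × F) : NNReal := ‖z.1 - z.2‖₊ ^ 2

theorem continuous_quadCost : Continuous (quadCost (F := F)) := by
  unfold quadCost
  fun_prop

variable {μ ν : Measure F} {θ : Measure (F × F)}

/-- For a continuous cost the profitable set is open. A profitable pair of support points would have
a product neighbourhood inside it, of positive mass. For the quadratic cost, an unprofitable pair is
a monotone one after expanding the squares. -/
theorem IsOptimalPlan.monotoneSet_support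
    (h : IsOptimalPlan (fun z => (quadCost z : ℝ≥0∞)) μ ν θ) : MonotoneSet θ.support := by
  intro z hz w hw
  have := h.prob
  have h0 := h.measure_exchangeSet continuous_quadCost.measurable.coe_nnreal_ennreal
  have hle : ¬ ((z, w) ∈ exchangeSet fun z : F × F => (quadCost z : ℝ≥0∞)) := by
    intro hmem
    have hopen : IsOpen (exchangeSet fun z : F × F => (quadCost z : ℝ≥0∞)) :=
      isOpen_exchangeSet (ENNReal.continuous_coe.comp continuous_quadCost)
    obtain ⟨U, hU, V, hV, hUV⟩ := mem_nhds_prod_iff.1 (hopen.mem_nhds hmem)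
    have h1 := measure_mono_null hUV h0
    rw [Measure.prod_prod, mul_eq_zero] at h1
    rw [Measure.mem_support_iff_forall] at hz hw
    exact h1.elim (hz U hU).ne' (hw V hV).ne'
  simp only [exchangeSet, mem_ofPred_eq, not_lt, quadCost] at hle
  have hle' : ‖z.1 - z.2‖ ^ 2 + ‖w.1 - w.2‖ ^ 2 ≤ ‖z.1 - w.2‖ ^ 2 + ‖w.1 - z.2‖ ^ 2 := by
    exact_mod_cast hle
  simp only [norm_sub_sq_real] at hle'
  simp only [inner_sub_left, inner_sub_right]
  linarith

/-- An optimal plan for the quadratic cost is carried by the graph of a map. -/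
theorem IsOptimalPlan.exists_map (h : IsOptimalPlan (fun z => (quadCost z : ℝ≥0∞)) μ ν θ)
    {m : Measure F} [m.IsAddHaarMeasure] (hμ : μ ≪ m) :
    ∃ φ : F → F, Measurable φ ∧ ∀ᵐ z ∂θ, z.2 = φ z.1 := by
  have hmon := h.monotoneSet_support
  -- A measurable null hull, so that no measurability of the multivalued set has to be shown.
  let N := toMeasurable m (multiDomain θ.support)
  have hN : μ N = 0 := hμ (by rw [measure_toMeasurable]; exact hmon.measure_multiDomain m)
  have hNm : MeasurableSet N := measurableSet_toMeasurable _ _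
  let G : Set (F × F) := θ.support ∩ (Prod.fst ⁻¹' Nᶜ)
  have hG : MeasurableSet G := Measure.isClosed_support.measurableSet.inter (measurable_fst hNm.compl)
  have hGae : ∀ᵐ z ∂θ, z ∈ G := by
    have h1 : ∀ᵐ z ∂θ, z.1 ∉ N := by
      have : (θ.map Prod.fst) N = 0 := by rw [h.map_fst, hN]
      rw [Measure.map_apply measurable_fst hNm] at this
      exact measure_eq_zero_iff_ae_notMem.1 this
    filter_upwards [h1, Measure.support_mem_ae (μ := θ)] with z hz1 hz2 using ⟨hz2, hz1⟩
  have : StandardBorelSpace G := hG.standardBorel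
  let f : G → F := fun z => z.1.1
  -- Off N the support is a graph, so the first projection is injective on the Borel set G and, by
  -- the Lusin–Souslin theorem, a measurable embedding. The second coordinate then extends to a
  -- measurable function of the first.
  have hf : Measurable f := by fun_prop
  have hinj : Function.Injective f := by
    rintro ⟨⟨x, y⟩, hz⟩ ⟨⟨x', y'⟩, hw⟩ (rfl : x = x')
    by_contra hne
    refine hz.2 (subset_toMeasurable _ _ ⟨y, y', ?_, hz.1, hw.1⟩)
    rintro rfl
    exact hne rfl
  obtain ⟨φ, hφ, hφf⟩ := (hf.measurableEmbedding hinj).exists_measurable_extend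
    (g := fun z : G => z.1.2) (by fun_prop) fun _ => ⟨0⟩
  refine ⟨φ, hφ, hGae.mono fun z hz => ?_⟩
  exact (congrFun hφf ⟨z, hz⟩).symm

/-- Brenier's theorem: existence and uniqueness of the optimal plan for the quadratic cost, which
is given by a map. -/
theorem exists_optimal_map [IsProbabilityMeasure μ] [IsProbabilityMeasure ν] {m : Measure F}
    [m.IsAddHaarMeasure] (hμ : μ ≪ m) (h : ∃ θ, IsPlan μ ν θ ∧ ∫⁻ z, quadCost z ∂θ ≠ ⊤) :
    ∃ φ : F → F, Measurable φ ∧ ∀ θ, IsOptimalPlan (fun z => (quadCost z : ℝ≥0∞)) μ ν θ ↔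
      θ = μ.map (fun x => (x, φ x)) := by
  obtain ⟨θ, hθ⟩ := exists_isOptimalPlan continuous_quadCost h
  obtain ⟨φ, hφ, hae⟩ := hθ.exists_map hμ
  have e := hθ.eq_map_of_ae hφ hae
  refine ⟨φ, hφ, fun θ' => ⟨fun h' => ?_, fun h' => ?_⟩⟩
  -- The average of the two plans is optimal and so carried by the graph of a single ψ. Both plans
  -- are then carried by this graph, and their common first marginal determines them.
  · obtain ⟨ψ, hψ, hae'⟩ := (hθ.average h').exists_map hμ
    rw [ae_add_measure_iff] at hae'
    have e1 := hθ.eq_map_of_ae hψ ((Measure.ae_ennreal_smul_measure_iff (by simp)).1 hae'.1)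
    have e2 := h'.eq_map_of_ae hψ ((Measure.ae_ennreal_smul_measure_iff (by simp)).1 hae'.2)
    rw [e2, ← e1, e]
  · rw [h', ← e]
    exact hθ

end Monotone

/-! ### The phase-space problem in Euclidean space -/

section PhaseProblem

variable {d : ℕ}

local notation "𝔼" => EuclideanSpace ℝ (Fin d)
local notation "𝕋" => TangentBundle (𝓡 d) (EuclideanSpace ℝ (Fin d))
local notation "𝔽" => WithLp 2 (EuclideanSpace ℝ (Fin d) × EuclideanSpace ℝ (Fin d))

/-- Linear coordinates of the phase space in which the cost becomes quadratic. -/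
def shear (d : ℕ) (s : ℝ) :
    Phase d ≃L[ℝ] WithLp 2 (EuclideanSpace ℝ (Fin d) × EuclideanSpace ℝ (Fin d)) where
  toFun p := WithLp.toLp 2 (√12 • (p.1 + s • p.2), p.2)
  invFun z := ((√12)⁻¹ • z.fst - s • z.snd, z.snd)
  map_add' p q := by
    rw [← WithLp.toLp_add]
    refine congrArg _ (Prod.ext ?_ rfl)
    change √12 • ((p.1 + q.1) + s • (p.2 + q.2)) = √12 • (p.1 + s • p.2) + √12 • (q.1 + s • q.2)
    module
  map_smul' r p := by
    rw [RingHom.id_apply, ← WithLp.toLp_smul]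
    refine congrArg _ (Prod.ext ?_ rfl)
    change √12 • (r • p.1 + s • (r • p.2)) = r • (√12 • (p.1 + s • p.2))
    module
  left_inv p := by
    have h : √12 ≠ 0 := by positivity
    simp [smul_smul, h]
  right_inv z := by
    have h : √12 ≠ 0 := by positivity
    simp only [sub_add_cancel, smul_smul, mul_inv_cancel₀ h, one_smul]
    rfl
  continuous_toFun := by
    refine (WithLp.prod_continuous_toLp 2 _ _).comp ?_
    fun_prop
  continuous_invFun := by fun_prop

/-- Completing the square: the cost is 12 |(x + v/2) - (y - w/2)|² + |v - w|². This is the origin of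
√12 and of the opposite shears 1/2 and -1/2. -/
theorem norm_shear_sub_sq (p q : Phase d) :
    ‖shear d (1 / 2) p - shear d (-1 / 2) q‖ ^ 2 = cph p q := by
  have h : (√12 : ℝ) ^ 2 = 12 := Real.sq_sqrt (by norm_num)
  have h1 : (shear d (1 / 2) p - shear d (-1 / 2) q).fst =
      √12 • (p.1 + (1 / 2 : ℝ) • p.2 - (q.1 + (-1 / 2 : ℝ) • q.2)) := by
    rw [smul_sub]; rfl
  have h2 : (shear d (1 / 2) p - shear d (-1 / 2) q).snd = p.2 - q.2 := rfl
  rw [WithLp.prod_norm_sq_eq_of_L2, h1, h2, norm_smul, mul_pow, Real.norm_eq_abs, sq_abs, h,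
    cph_eq_sum, EuclideanSpace.real_norm_sq_eq, EuclideanSpace.real_norm_sq_eq, Finset.mul_sum,
    ← Finset.sum_add_distrib]
  refine Finset.sum_congr rfl fun i _ => ?_
  simp only [PiLp.add_apply, PiLp.sub_apply, PiLp.smul_apply, smul_eq_mul]
  ring

/-- The coordinates of the tangent bundle in which the cost is quadratic. -/
def shearHomeo (d : ℕ) (s : ℝ) : TangentBundle (𝓡 d) (EuclideanSpace ℝ (Fin d)) ≃ₜ
    WithLp 2 (EuclideanSpace ℝ (Fin d) × EuclideanSpace ℝ (Fin d)) :=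
  (phaseHomeo d).trans (shear d s).toHomeomorph

theorem quadCost_shearHomeo (p q : 𝕋) :
    (quadCost (shearHomeo d (1 / 2) p, shearHomeo d (-1 / 2) q) : ℝ≥0∞) =
      ENNReal.ofReal (cph (toPhase p) (toPhase q)) := by
  rw [← norm_shear_sub_sq, ENNReal.ofReal, ENNReal.coe_inj]
  refine NNReal.eq ?_
  rw [Real.coe_toNNReal _ (sq_nonneg _)]
  rfl

/-- The end points of a path in the coordinates in which the cost is quadratic. -/
def ends (γ : H2Path d 𝔼) : 𝔽 × 𝔽 :=
  (shearHomeo d (1 / 2) (jet 0 γ), shearHomeo d (-1 / 2) (jet 1 γ))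

/-- The Hermite cubic with given end points. -/
def joining (z : 𝔽 × 𝔽) : H2Path d 𝔼 :=
  hermitePath ((shearHomeo d (1 / 2)).symm z.1) ((shearHomeo d (-1 / 2)).symm z.2)

theorem measurable_ends : Measurable (ends (d := d)) :=
  (((shearHomeo d (1 / 2)).continuous.comp
    (continuous_jet (left_mem_Icc.2 zero_le_one))).measurable).prodMk
  (((shearHomeo d (-1 / 2)).continuous.comp
    (continuous_jet (right_mem_Icc.2 zero_le_one))).measurable)

theorem measurable_joining : Measurable (joining (d := d)) :=
  (continuous_hermitePath.comp (((shearHomeo d (1 / 2)).symm.continuous.comp continuous_fst).prodMk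
    ((shearHomeo d (-1 / 2)).symm.continuous.comp continuous_snd))).measurable

theorem ends_joining (z : 𝔽 × 𝔽) : ends (joining z) = z := by
  simp [ends, joining, jet_zero_hermitePath, jet_one_hermitePath]

theorem joining_ends (γ : H2Path d 𝔼) : joining (ends γ) = hermitePath (jet 0 γ) (jet 1 γ) := by
  simp [ends, joining]

theorem quadCost_ends (γ : H2Path d 𝔼) : (quadCost (ends γ) : ℝ≥0∞) =
    ENNReal.ofReal (cph (toPhase (jet 0 γ)) (toPhase (jet 1 γ))) :=
  quadCost_shearHomeo _ _

theorem quadCost_ends_le (γ : H2Path d 𝔼) :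
    (quadCost (ends γ) : ℝ≥0∞) ≤ energy (euclideanMetric d) γ := by
  rw [quadCost_ends]
  exact ofReal_cph_le_energy γ

theorem energy_joining (z : 𝔽 × 𝔽) : energy (euclideanMetric d) (joining z) = quadCost z := by
  conv_rhs => rw [← ends_joining z]
  rw [quadCost_ends, joining, energy_hermitePath, jet_zero_hermitePath, jet_one_hermitePath]

theorem measurable_quadCost : Measurable (fun z : 𝔽 × 𝔽 => (quadCost z : ℝ≥0∞)) :=
  continuous_quadCost.measurable.coe_nnreal_ennreal

variable {ρ₀ ρ₁ : Measure (TangentBundle (𝓡 d) (EuclideanSpace ℝ (Fin d)))}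
  {μ : Measure (H2Path d (EuclideanSpace ℝ (Fin d)))}
  {θ : Measure (WithLp 2 (EuclideanSpace ℝ (Fin d) × EuclideanSpace ℝ (Fin d)) ×
    WithLp 2 (EuclideanSpace ℝ (Fin d) × EuclideanSpace ℝ (Fin d)))}

theorem IsAdmissible.isPlan (h : IsAdmissible ρ₀ ρ₁ μ) :
    IsPlan (ρ₀.map (shearHomeo d (1 / 2))) (ρ₁.map (shearHomeo d (-1 / 2))) (μ.map ends) := by
  have := h.prob
  refine ⟨Measure.isProbabilityMeasure_map measurable_ends.aemeasurable, ?_, ?_⟩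
  · rw [Measure.map_map measurable_fst measurable_ends, ← h.marginal_zero, Measure.map_map
      (shearHomeo d (1 / 2)).continuous.measurable
      (continuous_jet (left_mem_Icc.2 zero_le_one)).measurable]
    rfl
  · rw [Measure.map_map measurable_snd measurable_ends, ← h.marginal_one, Measure.map_map
      (shearHomeo d (-1 / 2)).continuous.measurable
      (continuous_jet (right_mem_Icc.2 zero_le_one)).measurable]
    rfl

theorem IsPlan.isAdmissible
    (h : IsPlan (ρ₀.map (shearHomeo d (1 / 2))) (ρ₁.map (shearHomeo d (-1 / 2))) θ) :
    IsAdmissible ρ₀ ρ₁ (θ.map joining) := by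
  have := h.prob
  refine ⟨Measure.isProbabilityMeasure_map measurable_joining.aemeasurable, ?_, ?_⟩
  · have e : jet 0 ∘ joining (d := d) = (shearHomeo d (1 / 2)).symm ∘ Prod.fst := by
      ext1 z; exact jet_zero_hermitePath _ _
    have hs := (shearHomeo d (1 / 2)).symm.continuous.measurable
    rw [Measure.map_map (continuous_jet (left_mem_Icc.2 zero_le_one)).measurable measurable_joining,
      e, ← Measure.map_map hs measurable_fst, h.map_fst,
      Measure.map_map hs (shearHomeo d (1 / 2)).continuous.measurable]
    simp
  · have e : jet 1 ∘ joining (d := d) = (shearHomeo d (-1 / 2)).symm ∘ Prod.snd := by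
      ext1 z; exact jet_one_hermitePath _ _
    have hs := (shearHomeo d (-1 / 2)).symm.continuous.measurable
    rw [Measure.map_map (continuous_jet (right_mem_Icc.2 zero_le_one)).measurable
      measurable_joining, e, ← Measure.map_map hs measurable_snd, h.map_snd,
      Measure.map_map hs (shearHomeo d (-1 / 2)).continuous.measurable]
    simp

theorem cost_map_joining (θ : Measure (𝔽 × 𝔽)) :
    cost (euclideanMetric d) (θ.map joining) = ∫⁻ z, quadCost z ∂θ := by
  rw [cost, lintegral_map (continuous_energy _).measurable measurable_joining]
  simp only [energy_joining]

theorem lintegral_map_ends (μ : Measure (H2Path d 𝔼)) :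
    ∫⁻ z, quadCost z ∂(μ.map ends) = ∫⁻ γ, quadCost (ends γ) ∂μ :=
  lintegral_map measurable_quadCost measurable_ends

theorem lintegral_map_ends_le (μ : Measure (H2Path d 𝔼)) :
    ∫⁻ z, quadCost z ∂(μ.map ends) ≤ cost (euclideanMetric d) μ := by
  rw [lintegral_map_ends]
  exact lintegral_mono quadCost_ends_le

/-- Optimal measures on paths are the images of the optimal plans. -/
theorem isOptimal_iff : IsOptimal (euclideanMetric d) ρ₀ ρ₁ μ ↔
    ∃ θ, IsOptimalPlan (fun z => (quadCost z : ℝ≥0∞)) (ρ₀.map (shearHomeo d (1 / 2)))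
      (ρ₁.map (shearHomeo d (-1 / 2))) θ ∧ μ = θ.map joining := by
  constructor
  · intro h
    have hle := lintegral_map_ends_le μ
    -- Replacing every path by the Hermite cubic with the same end jets gives an admissible
    -- competitor whose cost is the plan cost.
    have hge : cost (euclideanMetric d) μ ≤ ∫⁻ z, quadCost z ∂(μ.map ends) := by
      rw [← cost_map_joining]
      exact h.le _ h.admissible.isPlan.isAdmissible
    refine ⟨μ.map ends, ⟨h.admissible.isPlan, ne_top_of_le_ne_top h.finite hle, fun θ' h' => ?_⟩, ?_⟩
    · rw [← cost_map_joining θ']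
      exact hle.trans (h.le _ h'.isAdmissible)
    -- The pointwise inequality between `cph` and the energy integrates to an equality of finite
    -- numbers, so it is an equality almost everywhere, and each such path is its own Hermite cubic.
    · have hae : ∀ᵐ γ ∂μ, joining (ends γ) = γ := by
        have heq : ∫⁻ γ, quadCost (ends γ) ∂μ = ∫⁻ γ, energy (euclideanMetric d) γ ∂μ :=
          (lintegral_map_ends μ).symm.trans (le_antisymm hle hge)
        have h1 := ae_eq_of_ae_le_of_lintegral_le (ae_of_all μ quadCost_ends_le)
          (heq ▸ h.finite) (continuous_energy (euclideanMetric d)).measurable.aemeasurable heq.ge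
        filter_upwards [h1] with γ hγ
        rw [joining_ends]
        exact (eq_hermitePath_of_energy_le γ (by rw [← quadCost_ends, hγ])).symm
      rw [Measure.map_map measurable_joining measurable_ends]
      conv_lhs => rw [← Measure.map_id (μ := μ)]
      exact Measure.map_congr (hae.mono fun γ hγ => hγ.symm)
  · rintro ⟨θ, hθ, rfl⟩
    refine ⟨hθ.isAdmissible, ?_, fun ν hν => ?_⟩
    · rw [cost_map_joining]; exact hθ.finite
    · rw [cost_map_joining]
      exact (hθ.le _ hν.isPlan).trans (lintegral_map_ends_le ν)

theorem absolutelyContinuous_shear (h : ρ₀.map toPhase ≪ volume) (s : ℝ) :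
    ρ₀.map (shearHomeo d s) ≪ (volume : Measure (Phase d)).map (shear d s) := by
  have e : ρ₀.map (shearHomeo d s) = (ρ₀.map toPhase).map (shear d s) := by
    rw [Measure.map_map (shear d s).continuous.measurable continuous_toPhase.measurable]
    rfl
  rw [e]
  exact h.map (shear d s).continuous.measurable

theorem ae_eq_of_map_graph_eq {X Y : Type*} [MeasurableSpace X] [MeasurableSpace Y]
    [MeasurableEq Y] {ρ : Measure X} {φ ψ : X → Y} (hφ : Measurable φ)
    (hψ : Measurable ψ) (h : ρ.map (fun x => (x, ψ x)) = ρ.map (fun x => (x, φ x))) :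
    ψ =ᵐ[ρ] φ := by
  have hS : MeasurableSet {z : X × Y | z.2 = φ z.1} :=
    measurableSet_eq_fun measurable_snd (hφ.comp measurable_fst)
  have h1 : ∀ᵐ z ∂ρ.map (fun x => (x, ψ x)), z.2 = φ z.1 := by
    rw [h, ae_map_iff (by fun_prop) hS]
    exact ae_of_all _ fun _ => rfl
  rwa [ae_map_iff (by fun_prop) hS] at h1

/-- Existence, uniqueness and structure of the optimal measure on paths in Euclidean space. -/
theorem exists_optimal_phase_map [IsProbabilityMeasure ρ₀] [IsProbabilityMeasure ρ₁]
    (hac : ρ₀.map toPhase ≪ volume)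
    (hfin : ∃ ν, IsAdmissible ρ₀ ρ₁ ν ∧ cost (euclideanMetric d) ν ≠ ⊤) :
    ∃ φ : 𝕋 → 𝕋, Measurable φ ∧ ρ₀.map φ = ρ₁ ∧
      (∀ μ, IsOptimal (euclideanMetric d) ρ₀ ρ₁ μ ↔ μ = ρ₀.map (fun z => hermitePath z (φ z))) ∧
      ∀ ψ : 𝕋 → 𝕋, Measurable ψ →
        IsOptimal (euclideanMetric d) ρ₀ ρ₁ (ρ₀.map (fun z => hermitePath z (ψ z))) →
          ψ =ᵐ[ρ₀] φ := by
  set a := shearHomeo d (1 / 2) with ha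
  set b := shearHomeo d (-1 / 2) with hb
  have hma : Measurable a := a.continuous.measurable
  have hmb : Measurable b := b.continuous.measurable
  have hmb' : Measurable b.symm := b.symm.continuous.measurable
  have : IsProbabilityMeasure (ρ₀.map a) := Measure.isProbabilityMeasure_map hma.aemeasurable
  have : IsProbabilityMeasure (ρ₁.map b) := Measure.isProbabilityMeasure_map hmb.aemeasurable
  have : (volume : Measure (Phase d)).IsAddHaarMeasure :=
    Measure.prod.instIsAddHaarMeasure (volume : Measure 𝔼) (volume : Measure 𝔼)
  have : ((volume : Measure (Phase d)).map (shear d (1 / 2))).IsAddHaarMeasure :=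
    (shear d (1 / 2)).isAddHaarMeasure_map volume
  obtain ⟨T, hT, hopt⟩ := exists_optimal_map (ν := ρ₁.map b) (absolutelyContinuous_shear hac (1 / 2))
    (by
      obtain ⟨ν, hν, hc⟩ := hfin
      exact ⟨ν.map ends, hν.isPlan, ne_top_of_le_ne_top hc (lintegral_map_ends_le ν)⟩)
  -- The Brenier map of the sheared problem, carried back to the tangent bundle.
  let φ : 𝕋 → 𝕋 := fun z => b.symm (T (a z))
  have hφ : Measurable φ := hmb'.comp (hT.comp hma)
  have hpath : ∀ {ψ : 𝕋 → 𝕋}, Measurable ψ → Measurable fun z => hermitePath z (ψ z) := by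
    intro ψ hψ
    have e : (fun z => hermitePath z (ψ z)) = fun z => joining (a z, b (ψ z)) := by
      ext1 z; simp [joining, ha, hb]
    rw [e]
    exact measurable_joining.comp (hma.prodMk (hmb.comp hψ))
  have hmap : ((ρ₀.map a).map fun x => (x, T x)).map joining =
      ρ₀.map (fun z => hermitePath z (φ z)) := by
    rw [Measure.map_map measurable_joining (by fun_prop),
      Measure.map_map (measurable_joining.comp (by fun_prop)) hma]
    congr 1
    ext1 z
    simp [joining, φ, ha, hb]
  have hiff : ∀ μ, IsOptimal (euclideanMetric d) ρ₀ ρ₁ μ ↔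
      μ = ρ₀.map (fun z => hermitePath z (φ z)) := by
    intro μ
    rw [isOptimal_iff, ← hmap]
    exact ⟨fun ⟨θ, h1, h2⟩ => h2.trans (by rw [(hopt θ).1 h1]), fun h => ⟨_, (hopt _).2 rfl, h⟩⟩
  refine ⟨φ, hφ, ?_, hiff, fun ψ hψ h => ?_⟩
  · have h1 := ((hiff _).2 rfl).admissible.marginal_one
    rw [Measure.map_map (continuous_jet (right_mem_Icc.2 zero_le_one)).measurable (hpath hφ)] at h1
    rw [← h1]
    congr 1
    ext1 z
    exact (jet_one_hermitePath _ _).symm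
  -- Reading off the end jets recovers from a measure on paths the law of (z, ψ z), up to the
  -- homeomorphism `b`. Equal laws of graphs over ρ₀ force the maps to agree almost everywhere.
  · have h1 := congrArg (Measure.map ends) ((hiff _).1 h)
    rw [Measure.map_map measurable_ends (hpath hψ), Measure.map_map measurable_ends (hpath hφ)] at h1
    have h2 := congrArg (Measure.map (Prod.map a.symm id)) h1
    have hma' : Measurable a.symm := a.symm.continuous.measurable
    rw [Measure.map_map (by fun_prop) (measurable_ends.comp (hpath hψ)),
      Measure.map_map (by fun_prop) (measurable_ends.comp (hpath hφ))] at h2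
    have e : ∀ ψ : 𝕋 → 𝕋, Prod.map a.symm id ∘ ends ∘ (fun z => hermitePath z (ψ z)) =
        fun z => (z, b (ψ z)) := by
      intro ψ
      ext1 z
      simp [ends, jet_zero_hermitePath, jet_one_hermitePath, ha, hb]
    rw [e, e] at h2
    filter_upwards [ae_eq_of_map_graph_eq (hmb.comp hφ) (hmb.comp hψ) h2] with z hz
    exact b.injective hz

end PhaseProblem

end PhaseOT

end

theorem mainTheorem6 :
    -- every optimal measure on paths is supported on cubic splines
    (∀ (n : ℕ) (M : Type*) [TopologicalSpace M] [ChartedSpace (EuclideanSpace ℝ (Fin n)) M]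
      [IsManifold (𝓡 n) ∞ M] [T2Space M] [SecondCountableTopology M]
      (g : PhaseOT.RMetric n M) (ρ₀ ρ₁ : Measure (TangentBundle (𝓡 n) M))
      [IsProbabilityMeasure ρ₀] [IsProbabilityMeasure ρ₁] (μ : Measure (PhaseOT.H2Path n M)),
      PhaseOT.IsOptimal g ρ₀ ρ₁ μ →
        ∀ γ ∈ μ.support, PhaseOT.IsCubicSpline g γ ∧
          PhaseOT.jet 0 γ ∈ ρ₀.support ∧ PhaseOT.jet 1 γ ∈ ρ₁.support) ∧
    -- on `ℝ^d`, the optimal measure exists, is unique and is given by a map of the phase space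
    (∀ (d : ℕ) (ρ₀ ρ₁ : Measure (TangentBundle (𝓡 d) (EuclideanSpace ℝ (Fin d))))
      [IsProbabilityMeasure ρ₀] [IsProbabilityMeasure ρ₁],
      ρ₀.map PhaseOT.toPhase ≪ volume →
      (∃ ν, PhaseOT.IsAdmissible ρ₀ ρ₁ ν ∧ PhaseOT.cost (PhaseOT.euclideanMetric d) ν ≠ ⊤) →
      ∃ φ : TangentBundle (𝓡 d) (EuclideanSpace ℝ (Fin d)) →
          TangentBundle (𝓡 d) (EuclideanSpace ℝ (Fin d)),
        Measurable φ ∧ ρ₀.map φ = ρ₁ ∧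
        (∀ μ, PhaseOT.IsOptimal (PhaseOT.euclideanMetric d) ρ₀ ρ₁ μ ↔
          μ = ρ₀.map (fun z => PhaseOT.hermitePath z (φ z))) ∧
        ∀ ψ : TangentBundle (𝓡 d) (EuclideanSpace ℝ (Fin d)) →
            TangentBundle (𝓡 d) (EuclideanSpace ℝ (Fin d)), Measurable ψ →
          PhaseOT.IsOptimal (PhaseOT.euclideanMetric d) ρ₀ ρ₁
            (ρ₀.map (fun z => PhaseOT.hermitePath z (ψ z))) → ψ =ᵐ[ρ₀] φ) ∧
    -- on `ℝ^d`, the spline between two points of the phase space and its cost are explicit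
    (∀ (d : ℕ) (p q : TangentBundle (𝓡 d) (EuclideanSpace ℝ (Fin d))),
      PhaseOT.jet 0 (PhaseOT.hermitePath p q) = p ∧
      PhaseOT.jet 1 (PhaseOT.hermitePath p q) = q ∧
      (∀ γ : PhaseOT.H2Path d (EuclideanSpace ℝ (Fin d)),
        PhaseOT.jet 0 γ = p → PhaseOT.jet 1 γ = q →
          (PhaseOT.IsCubicSpline (PhaseOT.euclideanMetric d) γ ↔
            γ = PhaseOT.hermitePath p q)) ∧
      0 ≤ PhaseOT.cph (PhaseOT.toPhase p) (PhaseOT.toPhase q) ∧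
      PhaseOT.energy (PhaseOT.euclideanMetric d) (PhaseOT.hermitePath p q) =
        ENNReal.ofReal (PhaseOT.cph (PhaseOT.toPhase p) (PhaseOT.toPhase q))) ∧
    -- the cost satisfies the twist condition
    (∀ d : ℕ, PhaseOT.TwistCondition (d := d) PhaseOT.cph) := by
  refine ⟨?_, ?_, ?_, fun d => PhaseOT.twistCondition_cph⟩
  · intro n M _ _ _ _ _ g ρ₀ ρ₁ _ _ μ h γ hγ
    exact h.mem_support hγ
  · intro d ρ₀ ρ₁ _ _ hac hfin
    exact PhaseOT.exists_optimal_phase_map hac hfin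
  · intro d p q
    refine ⟨PhaseOT.jet_zero_hermitePath p q, PhaseOT.jet_one_hermitePath p q, ?_,
      PhaseOT.cph_nonneg _ _, PhaseOT.energy_hermitePath p q⟩
    rintro γ rfl rfl
    exact PhaseOT.isCubicSpline_iff γ
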